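/- Let $X$ be a complex manifold, with its bundle $T$ of holomorphic tangent vectors, and let $R$ be a $\mathbb Z$-graded Artin algebra over $\mathbb C$ (graded-commutative, finite-dimensional, local, with maximal ideal $\mathfrak M_R$) or a projective limit $R=\varprojlim R_i$ of such algebras. In the second case everything below over $R$ means compatible families over the $R_i$, and tensor products with $R$ are completed. Tensor products with $R$ carry Koszul signs. Let $\mathfrak g_{A_\infty}=\bigoplus_{p,q}\Omega^{0,q}(X,\Lambda^pT)$, with $\Omega^{0,q}(X,\Lambda^pT)$ in degree $q-p+1$, with the Dolbeault differential $\bar\partial$ and with the Schouten–Nijenhuis bracket extended by the cup product of $(0,*)$-forms. For $\gamma=\bar\beta\otimes v$ let $i_\gamma$ be the contraction with the polyvector $v$ followed by the wedge product with the $(0,q)$-form $\bar\beta$. The signs of the bracket are those for which $i_{[\gamma_1,\gamma_2]}=[[\partial,i_{\gamma_1}],i_{\gamma_2}]$ with graded commutators; in local coordinates, with $\theta_j=\partial/\partial z_j$ regarded as odd variables and $|a|$ the parity of $q-p$ plus the degree in $R$, $$[a,b]=\sum_j\Bigl(\frac{\partial a}{\partial\theta_j}\frac{\partial b}{\partial z_j}+(-1)^{|a|}\frac{\partial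 a}{\partial z_j}\frac{\partial b}{\partial\theta_j}\Bigr).$$ Let $\Omega^*(X,\mathbb C)[[\hbar^{-1},\hbar]]$ be the space of formal series, infinite in both directions, in integral powers of $\hbar$ with coefficients forms of even degree plus half-integral powers of $\hbar$ with coefficients forms of odd degree. Let $l_\hbar$ be the rescaling operator $\varphi^{p,q}\mapsto\hbar^{(q-p)/2}\varphi^{p,q}$ for $\varphi^{p,q}\in\Omega^{p,q}$. Let $\gamma\in(\mathfrak g_{A_\infty}\otimes\mathfrak M_R)^1$ be a solution of the Maurer–Cartan equation $\bar\partial\gamma+\frac12[\gamma,\gamma]=0$, and let $\widetilde L_\gamma$ be the space of the elements $$l_\hbar\exp\bigl(\tfrac1\hbar i_\gamma\bigr)(\varphi_0+\varphi_1\hbar+\varphi_2\hbar^2+\dots),\qquad\varphi_k\in\Omega^*(X,\mathbb C)\otimes R .$$ Then $\bigl(\Omega^*(X,\mathbb C)[[\hbar^{-1},\hbar]]\otimes R,\ \hbar^{1/2}(\bar\partial+\partial)\bigr)$ is a complex and $\widetilde L_\gamma$ is a sub-complex of it: $\widetilde L_\gamma$ is contained in $\Omega^*(X,\mathbb C)[[\hbar^{-1},\hbar]]\otimes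 R$ and is mapped to itself by $\hbar^{1/2}(\bar\partial+\partial)$. Moreover, on series in powers of $\hbar^{1/2}$ with coefficients in $\Omega^*(X,\mathbb C)\otimes R$, $$\exp\bigl(-\tfrac1\hbar i_\gamma\bigr)(\bar\partial+\hbar\partial)\exp\bigl(\tfrac1\hbar i_\gamma\bigr)=\bar\partial+[\partial,i_\gamma]+\hbar\partial .$$ -/

import Mathlib

open scoped TensorProduct Manifold ContDiff ComplexConjugate

noncomputable section

namespace SemiInfHodge

/-! ### Linear algebra of one tangent space

`V` is the holomorphic tangent space, `V →ₗ⋆[ℂ] ℂ` the space of `(0,1)`-covectors. -/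

section Fibre

variable (V : Type*) [AddCommGroup V] [Module ℂ V]

/-- `(0,1)`-covectors: conjugate-linear functionals. -/
abbrev ConjDual := V →ₗ⋆[ℂ] ℂ

/-- Exterior forms with complex values: `Λ(T^* ⊕ \bar T^*) = ⨁ Λ^{p,q}`. -/
abbrev FormAlg := ExteriorAlgebra ℂ (Module.Dual ℂ V × ConjDual V)

/-- Polyvectors with coefficients in `(0,*)`-forms: `Λ(\bar T^* ⊕ T) = ⨁ Λ^q \bar T^* ⊗ Λ^p T`. -/
abbrev PolyAlg := ExteriorAlgebra ℂ (ConjDual V × V)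

variable {V}

/-- The conjugate `\bar α` of a `(1,0)`-covector `α`. -/
def conjCovector (α : Module.Dual ℂ V) : ConjDual V where
  toFun v := conj (α v)
  map_add' v w := by simp
  map_smul' c v := by simp

/-- Precomposition of `(0,1)`-covectors with a complex linear map. -/
def conjPull {W : Type*} [AddCommGroup W] [Module ℂ W] (A : V →ₗ[ℂ] W) :
    ConjDual W →ₗ[ℂ] ConjDual V where
  toFun β := β.comp A
  map_add' _ _ := rfl
  map_smul' _ _ := rfl

/-- A `(1,0)`-covector as a form. -/
def covForm : Module.Dual ℂ V →ₗ[ℂ] FormAlg V :=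
  (ExteriorAlgebra.ι ℂ).comp (LinearMap.inl ℂ _ _)

/-- A `(0,1)`-covector as a form. -/
def conjForm : ConjDual V →ₗ[ℂ] FormAlg V :=
  (ExteriorAlgebra.ι ℂ).comp (LinearMap.inr ℂ _ _)

/-- A `(0,1)`-covector as an element of `Λ(\bar T^* ⊕ T)`. -/
def conjPoly : ConjDual V →ₗ[ℂ] PolyAlg V :=
  (ExteriorAlgebra.ι ℂ).comp (LinearMap.inl ℂ _ _)

/-- A tangent vector as an element of `Λ(\bar T^* ⊕ T)`. -/
def vecPoly : V →ₗ[ℂ] PolyAlg V :=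
  (ExteriorAlgebra.ι ℂ).comp (LinearMap.inr ℂ _ _)

/-- Pull-back of forms along a complex linear map. -/
def formPull {W : Type*} [AddCommGroup W] [Module ℂ W] (A : V →ₗ[ℂ] W) :
    FormAlg W →ₗ[ℂ] FormAlg V :=
  (ExteriorAlgebra.map (A.dualMap.prodMap (conjPull A))).toLinearMap

/-- Transport of polyvectors with `(0,*)`-form coefficients along an isomorphism `A` with
inverse `B`: covectors are pulled back by `A`, vectors are pushed by `B`. -/
def polyPull {W : Type*} [AddCommGroup W] [Module ℂ W] (A : V →ₗ[ℂ] W) (B : W →ₗ[ℂ] V) :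
    PolyAlg W →ₗ[ℂ] PolyAlg V :=
  (ExteriorAlgebra.map ((conjPull A).prodMap B)).toLinearMap

/-- Contraction of forms with a holomorphic tangent vector `v`: the odd derivation with
`α ↦ α v` on `(1,0)`-covectors and `0` on `(0,1)`-covectors. -/
def contractVec : V →ₗ[ℂ] Module.End ℂ (FormAlg V) :=
  (CliffordAlgebra.contractLeft (Q := (0 : QuadraticForm ℂ (Module.Dual ℂ V × ConjDual V)))).comp
    ((LinearMap.fst ℂ (Module.Dual ℂ V) (ConjDual V)).dualMap.comp (Module.Dual.eval ℂ V))

/-- The generators `(β, v)` of `Λ(\bar T^* ⊕ T)` acting on forms by `β ∧ · + ι_v`. -/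
def contractGen : (ConjDual V × V) →ₗ[ℂ] Module.End ℂ (FormAlg V) :=
  ((Algebra.lmul ℂ (FormAlg V)).toLinearMap.comp conjForm).coprod contractVec

theorem contractGen_sq (a : ConjDual V × V) : contractGen a * contractGen a = 0 := by
  refine LinearMap.ext fun x => ?_
  have h1 : conjForm a.1 * conjForm a.1 = 0 := ExteriorAlgebra.ι_sq_zero _
  have h2 : ∀ y, contractVec a.2 (contractVec a.2 y) = 0 := fun y =>
    CliffordAlgebra.contractLeft_contractLeft _ y
  have h3 : ∀ y, contractVec a.2 (conjForm a.1 * y) = -(conjForm a.1 * contractVec a.2 y) := by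
    intro y
    refine (CliffordAlgebra.contractLeft_ι_mul
      (Q := (0 : QuadraticForm ℂ (Module.Dual ℂ V × ConjDual V))) _ (0, a.1) y).trans ?_
    simp [contractVec, conjForm, ExteriorAlgebra.ι]
  simp [contractGen, mul_add, ← mul_assoc, h1, h2, h3]

/-- The contraction `i : Λ(\bar T^* ⊕ T) → End(Λ(T^* ⊕ \bar T^*))`,
`i_{β₁ ⋯ β_q v₁ ⋯ v_p} φ = β₁ ∧ ⋯ ∧ β_q ∧ ι_{v₁} ⋯ ι_{v_p} φ`. -/
def contraction : PolyAlg V →ₐ[ℂ] Module.End ℂ (FormAlg V) :=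
  ExteriorAlgebra.lift ℂ ⟨contractGen, contractGen_sq⟩

/-- The left derivative `∂/∂θ` of `Λ(\bar T^* ⊕ T)` dual to vectors, in the direction of the
`(1,0)`-covector `α`: the odd derivation with `v ↦ α v` and `β ↦ 0`. -/
def thetaDeriv (α : Module.Dual ℂ V) : PolyAlg V →ₗ[ℂ] PolyAlg V :=
  CliffordAlgebra.contractLeft (Q := (0 : QuadraticForm ℂ (ConjDual V × V)))
    (α.comp (LinearMap.snd ℂ _ _))

variable (V) in
/-- The summand `Λ^q \bar T^* ⊗ Λ^p T` of `Λ(\bar T^* ⊕ T)`. -/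
def polyBidegree (q p : ℕ) : Submodule ℂ (PolyAlg V) :=
  LinearMap.range (conjPoly (V := V)) ^ q * LinearMap.range (vecPoly (V := V)) ^ p

/-- The rescaling on generators, `T` standing for `ħ^{1/2}`: `α ↦ α T⁻¹` for `(1,0)`-covectors
and `β ↦ β T` for `(0,1)`-covectors. -/
def rescaleGen :
    (Module.Dual ℂ V × ConjDual V) →ₗ[ℂ] AddMonoidAlgebra (FormAlg V) ℤ :=
  ((AddMonoidAlgebra.lsingle (-1)).comp covForm).coprod
    ((AddMonoidAlgebra.lsingle 1).comp conjForm)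

theorem rescaleGen_sq (a : Module.Dual ℂ V × ConjDual V) : rescaleGen a * rescaleGen a = 0 := by
  have h1 : covForm a.1 * covForm a.1 = 0 := ExteriorAlgebra.ι_sq_zero _
  have h2 : conjForm a.2 * conjForm a.2 = 0 := ExteriorAlgebra.ι_sq_zero _
  have h3 : covForm a.1 * conjForm a.2 + conjForm a.2 * covForm a.1 = 0 :=
    ExteriorAlgebra.ι_add_mul_swap _ _
  have h : rescaleGen a = AddMonoidAlgebra.single (-1) (covForm a.1) +
      AddMonoidAlgebra.single 1 (conjForm a.2) := rfl
  rw [h, mul_add, add_mul, add_mul]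
  simp only [AddMonoidAlgebra.single_mul_single, h1, h2, AddMonoidAlgebra.single_zero,
    zero_add, add_zero, neg_add_cancel, add_neg_cancel]
  rw [← AddMonoidAlgebra.single_add, add_comm, h3, AddMonoidAlgebra.single_zero]

/-- The multiplicative rescaling `φ^{p,q} ↦ φ^{p,q} T^{q-p}`. -/
def rescaleAlg : FormAlg V →ₐ[ℂ] AddMonoidAlgebra (FormAlg V) ℤ :=
  ExteriorAlgebra.lift ℂ ⟨rescaleGen, rescaleGen_sq⟩

/-- The projection of `Λ(T^* ⊕ \bar T^*)` onto `⨁_{q-p=w} Λ^{p,q}`: the coefficient of `T^w` in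
the rescaled form. -/
def weightPart (w : ℤ) : FormAlg V →ₗ[ℂ] FormAlg V where
  toFun a := (rescaleAlg a).coeff w
  map_add' a b := by simp
  map_smul' c a := by simp

end Fibre

/-! ### Graded Artin algebras and coefficients -/

section Coefficients

variable {R : Type*} [Ring R] [Algebra ℂ R]

/-- A `ℤ`-graded Artin algebra over `ℂ`: graded-commutative, finite-dimensional and local. -/
class IsGradedArtin (𝒜 : ℤ → Submodule ℂ R) [GradedAlgebra 𝒜] : Prop where
  graded_comm : ∀ i j : ℤ, ∀ a ∈ 𝒜 i, ∀ b ∈ 𝒜 j, a * b = (((i * j).negOnePow : ℤ) : ℂ) • (b * a)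
  finite : FiniteDimensional ℂ R
  isLocal : IsLocalRing R

variable (𝒜 : ℤ → Submodule ℂ R) [GradedAlgebra 𝒜]

/-- The parity involution `r ↦ (-1)^{|r|} r`. -/
def parityInv : R →ₗ[ℂ] R :=
  (DirectSum.toModule ℂ ℤ R fun i => (((i.negOnePow : ℤˣ) : ℤ) : ℂ) • (𝒜 i).subtype).comp
    (DirectSum.decomposeLinearEquiv 𝒜).toLinearMap

/-- The even part of an element of `R`. -/
def evenPart : R →ₗ[ℂ] R := (1 / 2 : ℂ) • (LinearMap.id + parityInv 𝒜)

/-- The odd part of an element of `R`. -/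
def oddPart : R →ₗ[ℂ] R := (1 / 2 : ℂ) • (LinearMap.id - parityInv 𝒜)

/-- Extension of an action `ρ` of `P` on a `ℤ/2`-graded space `M` (with parity involution `s`) to
an action of `P ⊗ R` on `M ⊗ R` by the Koszul rule
`(a ⊗ r) · (m ⊗ t) = (-1)^{|r||m|} ρ(a) m ⊗ r t`. -/
def superAct {P M : Type*} [AddCommGroup P] [Module ℂ P] [AddCommGroup M] [Module ℂ M]
    (s : M →ₗ[ℂ] M) (ρ : P →ₗ[ℂ] Module.End ℂ M) : P ⊗[ℂ] R →ₗ[ℂ] Module.End ℂ (M ⊗[ℂ] R) :=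
  (TensorProduct.homTensorHomMap (RingHom.id ℂ) M R M R).comp
      (TensorProduct.map ρ ((Algebra.lmul ℂ R).toLinearMap.comp (evenPart 𝒜))) +
    (TensorProduct.homTensorHomMap (RingHom.id ℂ) M R M R).comp
      (TensorProduct.map ((LinearMap.lcomp ℂ M s).comp ρ)
        ((Algebra.lmul ℂ R).toLinearMap.comp (oddPart 𝒜)))

section Fibre

variable {V : Type*} [AddCommGroup V] [Module ℂ V]

/-- The contraction `i_γ` on forms with coefficients in `R`. `CliffordAlgebra.involute` is
`(-1)^k` on `Λ^k`. -/
def contractR : PolyAlg V ⊗[ℂ] R →ₗ[ℂ] Module.End ℂ (FormAlg V ⊗[ℂ] R) :=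
  superAct 𝒜 CliffordAlgebra.involute.toLinearMap contraction.toLinearMap

/-- The product of polyvectors with coefficients in `R`:
`(a ⊗ r)(b ⊗ t) = (-1)^{|r||b|} ab ⊗ rt`. -/
def polyMul : PolyAlg V ⊗[ℂ] R →ₗ[ℂ] Module.End ℂ (PolyAlg V ⊗[ℂ] R) :=
  superAct 𝒜 CliffordAlgebra.involute.toLinearMap (Algebra.lmul ℂ (PolyAlg V)).toLinearMap

/-- The total parity involution on polyvectors with coefficients in `R`. -/
def polyParity : PolyAlg V ⊗[ℂ] R →ₗ[ℂ] PolyAlg V ⊗[ℂ] R :=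
  TensorProduct.map CliffordAlgebra.involute.toLinearMap (parityInv 𝒜)

variable (V) in
/-- The elements of `Λ(\bar T^* ⊕ T) ⊗ 𝔐_R` of total degree zero, where `Λ^q \bar T^* ⊗ Λ^p T` has
degree `q - p`. The maximal ideal `𝔐_R` of the local ring `R` consists of the non-units. -/
def degreeZeroPart : Submodule ℂ (PolyAlg V ⊗[ℂ] R) :=
  Submodule.span ℂ {t | ∃ q p : ℕ, ∃ a ∈ polyBidegree V q p, ∃ r ∈ 𝒜 ((p : ℤ) - q),
    r ∈ nonunits R ∧ t = a ⊗ₜ[ℂ] r}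

end Fibre

end Coefficients

/-! ### Calculus in a coordinate domain -/

section Local

variable {E : Type*} [NormedAddCommGroup E] [NormedSpace ℂ E]

/-- Smoothness of a map into a finite-dimensional complex vector space (which carries no chosen
norm): all linear functionals of it are smooth. -/
def SmoothOn {F : Type*} [AddCommGroup F] [Module ℂ F] (f : E → F) (s : Set E) : Prop :=
  ∀ l : Module.Dual ℂ F, ContDiffOn ℝ ∞ (fun y => l (f y)) s

/-- The derivative at `y` in the real direction `v` of a map into a finite-dimensional complex
vector space, computed in the coordinates of a basis. -/
def dirDeriv {F : Type*} [AddCommGroup F] [Module ℂ F] (f : E → F) (y v : E) : F :=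
  ∑ᶠ k, fderiv ℝ (fun z => (Module.Basis.ofVectorSpace ℂ F).repr (f z) k) y v •
    Module.Basis.ofVectorSpace ℂ F k

/-- The Wirtinger derivative `∂_v = (D_v - i D_{iv}) / 2`. -/
def wirt {F : Type*} [AddCommGroup F] [Module ℂ F] (f : E → F) (y v : E) : F :=
  (1 / 2 : ℂ) • (dirDeriv f y v - Complex.I • dirDeriv f y (Complex.I • v))

/-- The Wirtinger derivative `\bar∂_v = (D_v + i D_{iv}) / 2`. -/
def wirtBar {F : Type*} [AddCommGroup F] [Module ℂ F] (f : E → F) (y v : E) : F :=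
  (1 / 2 : ℂ) • (dirDeriv f y v + Complex.I • dirDeriv f y (Complex.I • v))

variable [FiniteDimensional ℂ E]

variable (E) in
/-- The linear coordinate `z_j` on `E`. -/
def coordinate (j : Fin (Module.finrank ℂ E)) : Module.Dual ℂ E := (Module.finBasis ℂ E).coord j

variable {R : Type*} [Ring R] [Algebra ℂ R]

/-- `∂ω = ∑ dz_j ∧ ∂ω/∂z_j`. -/
def delLoc (f : E → FormAlg E ⊗[ℂ] R) (y : E) : FormAlg E ⊗[ℂ] R :=
  ∑ j, (LinearMap.mulLeft ℂ (covForm (coordinate E j))).rTensor R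
    (wirt f y (Module.finBasis ℂ E j))

/-- `\bar∂ω = ∑ d\bar z_j ∧ ∂ω/∂\bar z_j` on forms. -/
def delbarLoc (f : E → FormAlg E ⊗[ℂ] R) (y : E) : FormAlg E ⊗[ℂ] R :=
  ∑ j, (LinearMap.mulLeft ℂ (conjForm (conjCovector (coordinate E j)))).rTensor R
    (wirtBar f y (Module.finBasis ℂ E j))

/-- The Dolbeault differential `\bar∂γ = ∑ d\bar z_j ∧ ∂γ/∂\bar z_j` on polyvectors with
coefficients in `(0,*)`-forms. -/
def polyDelbarLoc (f : E → PolyAlg E ⊗[ℂ] R) (y : E) : PolyAlg E ⊗[ℂ] R :=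
  ∑ j, (LinearMap.mulLeft ℂ (conjPoly (conjCovector (coordinate E j)))).rTensor R
    (wirtBar f y (Module.finBasis ℂ E j))

/-- The Schouten–Nijenhuis bracket, extended to coefficients in `(0,*)`-forms and in `R`:
`[a, b] = ∑ ∂a/∂θ_j · ∂b/∂z_j + (-1)^{|a|} ∂a/∂z_j · ∂b/∂θ_j`, where `θ_j` is the vector
`∂/∂z_j` viewed as an odd variable.
This is the Lie bracket on vector fields, and `[v, f] = v(f)` for a function `f`. The signs are those
of the convention `[a, b] = (-1)^{|a||b|} [b, a]`, for which
`i_{[a,b]} = [[∂, i_a], i_b]` with graded commutators. -/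
def schoutenLoc (𝒜 : ℤ → Submodule ℂ R) [GradedAlgebra 𝒜] (a b : E → PolyAlg E ⊗[ℂ] R) (y : E) :
    PolyAlg E ⊗[ℂ] R :=
  ∑ j, (polyMul 𝒜 ((thetaDeriv (coordinate E j)).rTensor R (a y))
      (wirt b y (Module.finBasis ℂ E j)) +
    polyMul 𝒜 (polyParity 𝒜 (wirt a y (Module.finBasis ℂ E j)))
      ((thetaDeriv (coordinate E j)).rTensor R (b y)))

end Local

/-! ### Forms and polyvector fields on a complex manifold -/

section Manifold

variable (E : Type*) [NormedAddCommGroup E] [NormedSpace ℂ E]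
variable (X : Type*) [TopologicalSpace X] [ChartedSpace E X]
variable (R : Type*) [Ring R] [Algebra ℂ R]

/-- Sections (not necessarily continuous) of `Λ(T^* ⊕ \bar T^*) ⊗ R` over `X`. -/
abbrev FormSec := ∀ x : X, FormAlg (TangentSpace 𝓘(ℂ, E) x) ⊗[ℂ] R

/-- Sections (not necessarily continuous) of `Λ(\bar T^* ⊕ T) ⊗ R` over `X`. -/
abbrev PolySec := ∀ x : X, PolyAlg (TangentSpace 𝓘(ℂ, E) x) ⊗[ℂ] R

variable {E X R}

/-- The differential at `x` of the chart `e`. -/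
def dChart (e : OpenPartialHomeomorph X E) (x : X) : TangentSpace 𝓘(ℂ, E) x →ₗ[ℂ] E :=
  (NormedSpace.fromTangentSpace (𝕜 := ℂ) (e x)).toLinearEquiv.toLinearMap.comp
    (mfderiv 𝓘(ℂ, E) 𝓘(ℂ, E) e x).toLinearMap

/-- The differential at `y` of the inverse of the chart `e`. -/
def dChartSymm (e : OpenPartialHomeomorph X E) (y : E) :
    E →ₗ[ℂ] TangentSpace 𝓘(ℂ, E) (e.symm y) :=
  (mfderiv 𝓘(ℂ, E) 𝓘(ℂ, E) e.symm y).toLinearMap.comp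
    (NormedSpace.fromTangentSpace (𝕜 := ℂ) y).symm.toLinearEquiv.toLinearMap

/-- The expression of a form in the chart `e` (meaningful on `e.target`). -/
def FormSec.inChart (e : OpenPartialHomeomorph X E) (φ : FormSec E X R) (y : E) :
    FormAlg E ⊗[ℂ] R :=
  (formPull (dChartSymm e y)).rTensor R (φ (e.symm y))

/-- The expression of a polyvector field in the chart `e` (meaningful on `e.target`). -/
def PolySec.inChart (e : OpenPartialHomeomorph X E) (γ : PolySec E X R) (y : E) :
    PolyAlg E ⊗[ℂ] R :=
  (polyPull (dChartSymm e y) (dChart e (e.symm y))).rTensor R (γ (e.symm y))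

/-- Smooth forms with values in `R`, that is, elements of `Ω^*(X, ℂ) ⊗ R`. -/
def FormSec.IsSmooth (φ : FormSec E X R) : Prop :=
  ∀ e ∈ atlas E X, SmoothOn (φ.inChart e) e.target

/-- Smooth sections of `Λ(\bar T^* ⊕ T) ⊗ R`, that is, elements of `Ω^{0,*}(X, Λ^* T) ⊗ R`. -/
def PolySec.IsSmooth (γ : PolySec E X R) : Prop :=
  ∀ e ∈ atlas E X, SmoothOn (γ.inChart e) e.target

variable [FiniteDimensional ℂ E]

/-- The operator `∂` on forms, computed at `x` in the preferred chart at `x`. -/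
def del (φ : FormSec E X R) : FormSec E X R := fun x =>
  (formPull (dChart (chartAt E x) x)).rTensor R
    (delLoc (φ.inChart (chartAt E x)) (chartAt E x x))

/-- The operator `\bar∂` on forms, computed at `x` in the preferred chart at `x`. -/
def delbar (φ : FormSec E X R) : FormSec E X R := fun x =>
  (formPull (dChart (chartAt E x) x)).rTensor R
    (delbarLoc (φ.inChart (chartAt E x)) (chartAt E x x))

/-- The Maurer–Cartan equation `\bar∂γ + [γ, γ] / 2 = 0`, written in the charts of `X`. -/
def MaurerCartanEq (𝒜 : ℤ → Submodule ℂ R) [GradedAlgebra 𝒜] (γ : PolySec E X R) : Prop :=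
  ∀ e ∈ atlas E X, ∀ y ∈ e.target,
    polyDelbarLoc (γ.inChart e) y +
      (1 / 2 : ℂ) • schoutenLoc 𝒜 (γ.inChart e) (γ.inChart e) y = 0

/-- The set `MC(R)`: smooth `γ ∈ (𝔤[1] ⊗ 𝔐_R)^0` that satisfy the Maurer–Cartan equation. -/
structure IsMaurerCartan (𝒜 : ℤ → Submodule ℂ R) [GradedAlgebra 𝒜] (γ : PolySec E X R) :
    Prop where
  smooth : γ.IsSmooth
  degree : ∀ x, γ x ∈ degreeZeroPart 𝒜 (TangentSpace 𝓘(ℂ, E) x)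
  equation : MaurerCartanEq 𝒜 γ

/-! ### Series in powers of `ħ^{1/2}` -/

variable (E X R) in
/-- Formal series `∑_{m ∈ ℤ} ξ_m ħ^{m/2}`, infinite in both directions, whose coefficients are
sections of `Λ(T^* ⊕ \bar T^*) ⊗ R`. -/
abbrev Series := ℤ → FormSec E X R

/-- `ħ^{1/2} (\bar∂ + ∂)`. -/
def totalD (ξ : Series E X R) : Series E X R := fun m => delbar (ξ (m - 1)) + del (ξ (m - 1))

/-- `\bar∂ + ħ ∂`. -/
def hbarD (ξ : Series E X R) : Series E X R := fun m => delbar (ξ m) + del (ξ (m - 2))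

/-- The contraction `i_γ` on forms. -/
def contractSec (𝒜 : ℤ → Submodule ℂ R) [GradedAlgebra 𝒜] (γ : PolySec E X R)
    (φ : FormSec E X R) : FormSec E X R := fun x => contractR 𝒜 (γ x) (φ x)

/-- `\bar∂ + [∂, i_γ] + ħ ∂`, for `i_γ` of even degree. -/
def twistedD (𝒜 : ℤ → Submodule ℂ R) [GradedAlgebra 𝒜] (γ : PolySec E X R)
    (ξ : Series E X R) : Series E X R := fun m =>
  delbar (ξ m) + (del (contractSec 𝒜 γ (ξ m)) - contractSec 𝒜 γ (del (ξ m))) + del (ξ (m - 2))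

/-- `exp(i_γ / ħ) = ∑_k ħ^{-k} i_γ^k / k!`, for nilpotent `i_γ`. -/
def expContract (𝒜 : ℤ → Submodule ℂ R) [GradedAlgebra 𝒜] (γ : PolySec E X R) :
    Series E X R →ₗ[ℂ] Series E X R where
  toFun ξ := fun m x => ∑ k ∈ Finset.range (nilpotencyClass (contractR 𝒜 (γ x))),
    ((k.factorial : ℂ)⁻¹) • (contractR 𝒜 (γ x) ^ k) (ξ (m + 2 * k) x)
  map_add' ξ η := by
    funext m x
    simp [Finset.sum_add_distrib]
  map_smul' c ξ := by
    funext m x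
    simp [Finset.smul_sum, smul_comm c]

variable (E X R) in
/-- The rescaling `l_ħ : φ^{p,q} ↦ ħ^{(q-p)/2} φ^{p,q}`, with `|q - p| ≤ dim X`. -/
def rescale : Series E X R →ₗ[ℂ] Series E X R where
  toFun ξ := fun m x => ∑ w ∈ Finset.Icc (-(Module.finrank ℂ E : ℤ)) (Module.finrank ℂ E),
    (weightPart w).rTensor R (ξ (m - w) x)
  map_add' ξ η := by
    funext m x
    simp [Finset.sum_add_distrib]
  map_smul' c ξ := by
    funext m x
    simp [Finset.smul_sum]

end Manifold

/-! ### Inverse systems of graded Artin algebras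

The forms over the pro-Artin algebra `lim R_i` are the compatible families of forms over the
`R_i`; one Artin algebra is the case of a one-point index set. -/

section ProArtin

variable {E : Type*} [NormedAddCommGroup E] [NormedSpace ℂ E]
variable {X : Type*} [TopologicalSpace X] [ChartedSpace E X]
variable {ι : Type*} [Preorder ι] {R : ι → Type*} [∀ i, Ring (R i)] [∀ i, Algebra ℂ (R i)]

variable (E X R) in
/-- Families of series of forms over the `R_i`. -/
abbrev ProSeries := ∀ i, Series E X (R i)

/-- Compatible families of polyvector fields. -/
def PolyCompatible (f : ∀ i j, i ≤ j → R j →ₐ[ℂ] R i) (γ : ∀ i, PolySec E X (R i)) : Prop :=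
  ∀ i j (h : i ≤ j) x, (f i j h).toLinearMap.lTensor _ (γ j x) = γ i x

theorem SmoothOn.add {F : Type*} [AddCommGroup F] [Module ℂ F] {f g : E → F} {s : Set E}
    (hf : SmoothOn f s) (hg : SmoothOn g s) : SmoothOn (fun y => f y + g y) s := fun l => by
  simpa using (hf l).add (hg l)

theorem SmoothOn.smul {F : Type*} [AddCommGroup F] [Module ℂ F] {f : E → F} {s : Set E} (c : ℂ)
    (hf : SmoothOn f s) : SmoothOn (fun y => c • f y) s := fun l => by
  simpa using contDiffOn_const.mul (hf l)

variable (E X) in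
/-- All series `∑_m ξ_m ħ^{m/2}` with coefficients in `Ω^*(X, ℂ) ⊗ R`, `R = lim R_i`. -/
def smoothSeries (f : ∀ i j, i ≤ j → R j →ₐ[ℂ] R i) : Submodule ℂ (ProSeries E X R) where
  carrier := {ξ | (∀ i m, (ξ i m).IsSmooth) ∧
    ∀ i j (h : i ≤ j) m x, (f i j h).toLinearMap.lTensor _ (ξ j m x) = ξ i m x}
  zero_mem' := by
    refine ⟨fun i m e _ l => ?_, fun i j h m x => by simp⟩
    have : (fun y => l (FormSec.inChart e (((0 : ProSeries E X R) i) m) y)) = fun _ => 0 := by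
      funext y; simp [FormSec.inChart]
    rw [this]; exact contDiffOn_const
  add_mem' := by
    rintro ξ η ⟨h1, h2⟩ ⟨h3, h4⟩
    refine ⟨fun i m e he => ?_, fun i j h m x => by simp [h2 i j h m x, h4 i j h m x]⟩
    have : FormSec.inChart e ((ξ + η) i m) =
        fun y => FormSec.inChart e (ξ i m) y + FormSec.inChart e (η i m) y := by
      funext y; simp [FormSec.inChart]
    rw [this]; exact (h1 i m e he).add (h3 i m e he)
  smul_mem' := by
    rintro c ξ ⟨h1, h2⟩
    refine ⟨fun i m e he => ?_, fun i j h m x => by simp [h2 i j h m x]⟩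
    have : FormSec.inChart e ((c • ξ) i m) = fun y => c • FormSec.inChart e (ξ i m) y := by
      funext y; simp [FormSec.inChart]
    rw [this]; exact (h1 i m e he).smul c

variable (E X) in
/-- The space `Ω^*(X, ℂ)[[ħ^{-1}, ħ]] ⊗ R`: the coefficient of `ħ^{m/2}` is a form of even degree
for even `m` and of odd degree for odd `m`. -/
def omegaHbar (f : ∀ i j, i ≤ j → R j →ₐ[ℂ] R i) : Submodule ℂ (ProSeries E X R) :=
  smoothSeries E X f ⊓
  { carrier := {ξ | ∀ i m x, (CliffordAlgebra.involute.toLinearMap.rTensor (R i)) (ξ i m x) =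
      ((m.negOnePow : ℤ) : ℂ) • ξ i m x}
    zero_mem' := fun i m x => by simp
    add_mem' := fun {ξ η} h1 h2 i m x => by simp [h1 i m x, h2 i m x]
    smul_mem' := fun c ξ h i m x => by simp [h i m x, smul_comm c] }

variable (E X) in
/-- The series `φ_0 + φ_1 ħ + φ_2 ħ² + ⋯` with `φ_k ∈ Ω^*(X, ℂ) ⊗ R`. -/
def powerSeries (f : ∀ i j, i ≤ j → R j →ₐ[ℂ] R i) : Submodule ℂ (ProSeries E X R) :=
  smoothSeries E X f ⊓
  { carrier := {ξ | ∀ i m, (m < 0 ∨ Odd m) → ξ i m = 0}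
    zero_mem' := fun i m _ => rfl
    add_mem' := fun {ξ η} h1 h2 i m hm => by simp [h1 i m hm, h2 i m hm]
    smul_mem' := fun c ξ h i m hm => by simp [h i m hm] }

variable [FiniteDimensional ℂ E]

/-- The subspace `L̃_γ` of the elements `l_ħ exp(i_γ / ħ)(φ_0 + φ_1 ħ + φ_2 ħ² + ⋯)`. -/
def Ltilde (𝒜 : ∀ i, ℤ → Submodule ℂ (R i)) [∀ i, GradedAlgebra (𝒜 i)]
    (f : ∀ i j, i ≤ j → R j →ₐ[ℂ] R i) (γ : ∀ i, PolySec E X (R i)) :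
    Submodule ℂ (ProSeries E X R) :=
  (powerSeries E X f).map (LinearMap.pi fun i =>
    ((rescale E X (R i)).comp (expContract (𝒜 i) (γ i))).comp (LinearMap.proj i))

/-- `D` restricts to a linear differential on the subspace `Ω`. -/
structure IsDifferentialOn {S : Type*} [AddCommGroup S] [Module ℂ S] (Ω : Submodule ℂ S)
    (D : S → S) : Prop where
  map_mem : ∀ ξ ∈ Ω, D ξ ∈ Ω
  map_add : ∀ ξ ∈ Ω, ∀ η ∈ Ω, D (ξ + η) = D ξ + D η
  map_smul : ∀ c : ℂ, ∀ ξ ∈ Ω, D (c • ξ) = c • D ξ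
  sq_zero : ∀ ξ ∈ Ω, D (D ξ) = 0

end ProArtin

end SemiInfHodge
end

open SemiInfHodge

/-!
The graded commutators of the contraction `i_γ` with the two halves of the de Rham differential are
`[∂̄, i_γ] = i_{∂̄γ}` and `[[∂, i_γ], i_γ] = i_{[γ, γ]}`, and contractions commute with one another.
Conjugating `∂̄ + ħ∂` by `exp (i_γ / ħ)` therefore adds only `ħ⁻¹ i_{∂̄γ}`, `[∂, i_γ]` and
`½ ħ⁻¹ i_{[γ, γ]}`, and by the Maurer–Cartan equation the first and the last cancel. As the
coefficients of `γ` lie in a nilpotent ideal, `i_γ` is nilpotent uniformly on `X`, so that all the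
exponentials are finite sums.

Since `∂̄` raises the weight `q - p` by one and `∂` lowers it by one, `l_ħ` intertwines `∂̄ + ħ∂`
with `ħ^{1/2} (∂̄ + ∂)`. Finally `q - p ≡ p + q` modulo 2, so that `l_ħ` puts the forms of odd
degree exactly at the half-integral powers of `ħ`.
-/

noncomputable section

namespace SemiInfHodge

/-! ### Exterior algebras -/

section ExteriorAlgebra

open CliffordAlgebra (involute contractLeft)

variable {K M N : Type*} [CommRing K] [AddCommGroup M] [Module K M]
  [AddCommGroup N] [Module K N]

theorem exteriorPower_eq_bot [Nontrivial K] [Module.Free K M] [Module.Finite K M] {n : ℕ}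
    (hn : Module.finrank K M < n) : (⋀[K]^n M) = ⊥ := by
  have hrank : Module.finrank K (⋀[K]^n M) = 0 := by
    rw [exteriorPower.finrank_eq, Nat.choose_eq_zero_of_lt hn]
  rw [← Submodule.subsingleton_iff_eq_bot]
  exact (Module.finrank_eq_zero_iff_of_free K _).1 hrank

theorem pow_range_ι_comp_eq_bot [Nontrivial K] [Module.Free K M] [Module.Finite K M]
    (u : M →ₗ[K] N) {n : ℕ} (hn : Module.finrank K M < n) :
    LinearMap.range ((ExteriorAlgebra.ι K).comp u) ^ n = ⊥ := by
  have hmap : LinearMap.range ((ExteriorAlgebra.ι K).comp u) =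
      (LinearMap.range (ExteriorAlgebra.ι K)).map (ExteriorAlgebra.map u).toLinearMap := by
    rw [← LinearMap.range_comp, ExteriorAlgebra.map_comp_ι]
  have hbot : LinearMap.range (ExteriorAlgebra.ι K (M := M)) ^ n = ⊥ := exteriorPower_eq_bot hn
  rw [hmap, ← Submodule.map_pow, hbot, Submodule.map_bot]

theorem iSup_exteriorPower_eq_top : (⨆ n : ℕ, ⋀[K]^n M) = ⊤ :=
  (DirectSum.Decomposition.isInternal fun n : ℕ => ⋀[K]^n M).submodule_iSup_eq_top

instance finite_exteriorAlgebra [Nontrivial K] [Module.Free K M] [Module.Finite K M] :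
    Module.Finite K (ExteriorAlgebra K M) := by
  have hsup : (⨆ n ∈ Finset.range (Module.finrank K M + 1), ⋀[K]^n M) = ⊤ := by
    rw [eq_top_iff, ← iSup_exteriorPower_eq_top]
    refine iSup_le fun n => ?_
    by_cases hn : n < Module.finrank K M + 1
    · exact le_iSup₂_of_le n (Finset.mem_range.2 hn) le_rfl
    · rw [exteriorPower_eq_bot (Nat.lt_of_succ_le (not_lt.1 hn))]
      exact bot_le
  refine ⟨?_⟩
  rw [← hsup]
  exact Submodule.fg_biSup _ _ fun n _ => Module.Finite.iff_fg.1 inferInstance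

theorem ι_mul_ι_eq_neg (m m' : M) : ExteriorAlgebra.ι K m * ExteriorAlgebra.ι K m' =
    -(ExteriorAlgebra.ι K m' * ExteriorAlgebra.ι K m) :=
  eq_neg_of_add_eq_zero_left (ExteriorAlgebra.ι_add_mul_swap _ _)

theorem ι_mul_eq_involute_mul_ι (m : M) (b : ExteriorAlgebra K M) :
    ExteriorAlgebra.ι K m * b = involute b * ExteriorAlgebra.ι K m := by
  induction b using CliffordAlgebra.left_induction with
  | algebraMap r => rw [AlgHom.commutes, Algebra.commutes]
  | add x y hx hy => rw [mul_add, hx, hy, map_add, add_mul]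
  | ι_mul x m' hx =>
    rw [map_mul, CliffordAlgebra.involute_ι, ← mul_assoc, ι_mul_ι_eq_neg, neg_mul, mul_assoc, hx,
      neg_mul, neg_mul, mul_assoc]

theorem ι_mul_ι_mul_comm (m m' : M) (b : ExteriorAlgebra K M) :
    ExteriorAlgebra.ι K m * ExteriorAlgebra.ι K m' * b =
      b * (ExteriorAlgebra.ι K m * ExteriorAlgebra.ι K m') := by
  rw [mul_assoc, ι_mul_eq_involute_mul_ι m' b, ← mul_assoc, ι_mul_eq_involute_mul_ι m,
    CliffordAlgebra.involute_involute, mul_assoc]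

theorem mul_comm_of_mem_even {a : ExteriorAlgebra K M}
    (ha : a ∈ CliffordAlgebra.evenOdd (0 : QuadraticForm K M) 0) (b : ExteriorAlgebra K M) :
    a * b = b * a := by
  induction a, ha using CliffordAlgebra.even_induction with
  | algebraMap r => exact Algebra.commutes r b
  | add x y _ _ hx hy => rw [add_mul, mul_add, hx, hy]
  | ι_mul_ι_mul m m' x _ hx => rw [mul_assoc, hx, ← mul_assoc, ι_mul_ι_mul_comm, mul_assoc]

theorem mul_eq_involute_mul_of_mem_odd {a : ExteriorAlgebra K M}
    (ha : a ∈ CliffordAlgebra.evenOdd (0 : QuadraticForm K M) 1) (b : ExteriorAlgebra K M) :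
    a * b = involute b * a := by
  induction a, ha using CliffordAlgebra.odd_induction with
  | ι m => exact ι_mul_eq_involute_mul_ι m b
  | add x y _ _ hx hy => rw [add_mul, mul_add, hx, hy]
  | ι_mul_ι_mul m m' x _ hx => rw [mul_assoc, hx, ← mul_assoc, ι_mul_ι_mul_comm, mul_assoc]

theorem add_involute_mem_even (a : ExteriorAlgebra K M) :
    a + involute a ∈ CliffordAlgebra.evenOdd (0 : QuadraticForm K M) 0 := by
  obtain ⟨x, hx, y, hy, rfl⟩ := Submodule.mem_sup.1
    ((CliffordAlgebra.evenOdd_isCompl (Q := (0 : QuadraticForm K M))).sup_eq_top.ge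
      (Submodule.mem_top (x := a)))
  rw [map_add, CliffordAlgebra.involute_eq_of_mem_even hx,
    CliffordAlgebra.involute_eq_of_mem_odd hy, add_add_add_comm, add_neg_cancel, add_zero]
  exact add_mem hx hx

theorem sub_involute_mem_odd (a : ExteriorAlgebra K M) :
    a - involute a ∈ CliffordAlgebra.evenOdd (0 : QuadraticForm K M) 1 := by
  obtain ⟨x, hx, y, hy, rfl⟩ := Submodule.mem_sup.1
    ((CliffordAlgebra.evenOdd_isCompl (Q := (0 : QuadraticForm K M))).sup_eq_top.ge
      (Submodule.mem_top (x := a)))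
  rw [map_add, CliffordAlgebra.involute_eq_of_mem_even hx,
    CliffordAlgebra.involute_eq_of_mem_odd hy, add_sub_add_left_eq_sub, sub_neg_eq_add]
  exact add_mem hy hy

theorem involute_map (g : M →ₗ[K] N) (x : ExteriorAlgebra K M) :
    involute (ExteriorAlgebra.map g x) = ExteriorAlgebra.map g (involute x) := by
  induction x using CliffordAlgebra.left_induction with
  | algebraMap r => simp only [AlgHom.commutes]
  | add x y hx hy => simp only [map_add, hx, hy]
  | ι_mul x m hx =>
    simp only [map_mul, hx, ExteriorAlgebra.map_apply_ι, CliffordAlgebra.involute_ι, map_neg]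

theorem contractLeft_map (d : Module.Dual K N) (g : M →ₗ[K] N) (x : ExteriorAlgebra K M) :
    contractLeft (Q := (0 : QuadraticForm K N)) d (ExteriorAlgebra.map g x) =
      ExteriorAlgebra.map g (contractLeft (Q := (0 : QuadraticForm K M)) (d.comp g) x) := by
  induction x using CliffordAlgebra.left_induction with
  | algebraMap r => simp only [AlgHom.commutes, CliffordAlgebra.contractLeft_algebraMap, map_zero]
  | add x y hx hy => simp only [map_add, hx, hy]
  | ι_mul x m hx =>
    simp only [map_mul, hx, ExteriorAlgebra.map_apply_ι, CliffordAlgebra.contractLeft_ι_mul,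
      map_sub, map_smul, LinearMap.comp_apply]

theorem involute_contractLeft (d : Module.Dual K M) (x : ExteriorAlgebra K M) :
    involute (contractLeft (Q := (0 : QuadraticForm K M)) d x) =
      -contractLeft (Q := (0 : QuadraticForm K M)) d (involute x) := by
  induction x using CliffordAlgebra.left_induction with
  | algebraMap r =>
    simp only [AlgHom.commutes, CliffordAlgebra.contractLeft_algebraMap, map_zero, neg_zero]
  | add x y hx hy => simp only [map_add, hx, hy, neg_add]
  | ι_mul x m hx =>
    simp only [map_mul, hx, CliffordAlgebra.involute_ι, CliffordAlgebra.contractLeft_ι_mul, map_sub,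
      map_smul, neg_mul, map_neg, mul_neg, neg_neg]

theorem involute_of_mem_exteriorPower {n : ℕ} {x : ExteriorAlgebra K M} (hx : x ∈ ⋀[K]^n M) :
    involute x = (-1 : K) ^ n • x := by
  induction n generalizing x with
  | zero =>
    obtain ⟨r, rfl⟩ := Submodule.mem_one.1 (by simpa only [pow_zero] using hx)
    simp only [AlgHom.commutes, pow_zero, one_smul]
  | succ n ih =>
    rw [ExteriorAlgebra.exteriorPower, pow_succ'] at hx
    refine Submodule.mul_induction_on hx ?_ fun a b ha hb => by rw [map_add, ha, hb, smul_add]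
    rintro _ ⟨m, rfl⟩ y hy
    rw [map_mul, ih hy, CliffordAlgebra.involute_ι, pow_succ', mul_smul, mul_smul_comm, neg_mul,
      smul_neg, neg_one_smul]

theorem range_ι_comp_mul_comm {M' : Type*} [AddCommGroup M'] [Module K M'] (u : M →ₗ[K] N)
    (v : M' →ₗ[K] N) :
    LinearMap.range ((ExteriorAlgebra.ι K).comp u) *
        LinearMap.range ((ExteriorAlgebra.ι K).comp v) =
      LinearMap.range ((ExteriorAlgebra.ι K).comp v) *
        LinearMap.range ((ExteriorAlgebra.ι K).comp u) := by
  refine le_antisymm (Submodule.mul_le.2 ?_) (Submodule.mul_le.2 ?_) <;>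
  · rintro _ ⟨m, rfl⟩ _ ⟨m', rfl⟩
    rw [LinearMap.comp_apply, LinearMap.comp_apply, ι_mul_eq_involute_mul_ι,
      CliffordAlgebra.involute_ι, ← map_neg, ← map_neg]
    exact Submodule.mul_mem_mul ⟨-m', rfl⟩ ⟨m, rfl⟩

theorem range_ι_inl_sup_range_ι_inr :
    LinearMap.range ((ExteriorAlgebra.ι K).comp (LinearMap.inl K M N)) ⊔
      LinearMap.range ((ExteriorAlgebra.ι K).comp (LinearMap.inr K M N)) =
    LinearMap.range (ExteriorAlgebra.ι K (M := M × N)) := by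
  rw [LinearMap.range_comp, LinearMap.range_comp, ← Submodule.map_sup, LinearMap.sup_range_inl_inr,
    Submodule.map_top]

theorem iSup_pow_range_ι_inl_mul_pow_range_ι_inr :
    (⨆ (p : ℕ) (q : ℕ), LinearMap.range ((ExteriorAlgebra.ι K).comp (LinearMap.inl K M N)) ^ p *
      LinearMap.range ((ExteriorAlgebra.ι K).comp (LinearMap.inr K M N)) ^ q) = ⊤ := by
  set A := LinearMap.range ((ExteriorAlgebra.ι K).comp (LinearMap.inl K M N)) with hA
  set B := LinearMap.range ((ExteriorAlgebra.ι K).comp (LinearMap.inr K M N)) with hB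
  have hcomm : B * A = A * B := range_ι_comp_mul_comm _ _
  have hle : ∀ p q, A ^ p * B ^ q ≤ ⨆ (p : ℕ) (q : ℕ), A ^ p * B ^ q := fun p q =>
    le_iSup₂_of_le p q le_rfl
  rw [eq_top_iff, ← iSup_exteriorPower_eq_top]
  refine iSup_le fun n => ?_
  rw [ExteriorAlgebra.exteriorPower, ← range_ι_inl_sup_range_ι_inr, ← hA, ← hB]
  induction n with
  | zero => simpa only [pow_zero, mul_one] using hle 0 0
  | succ n ih =>
    rw [pow_succ']
    refine (mul_le_mul' le_rfl ih).trans ?_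
    simp only [Submodule.mul_iSup, Submodule.sup_mul]
    refine iSup₂_le fun p q => sup_le ?_ ?_
    · rw [← mul_assoc, ← pow_succ']
      exact hle (p + 1) q
    · rw [← mul_assoc, (Commute.pow_right hcomm p).eq, mul_assoc, ← pow_succ']
      exact hle p (q + 1)

end ExteriorAlgebra

/-! ### Forms and polyvectors at a point -/

section Fibre

open CliffordAlgebra (involute)

variable {V W U : Type*} [AddCommGroup V] [Module ℂ V] [AddCommGroup W] [Module ℂ W]
  [AddCommGroup U] [Module ℂ U]

theorem sum_apply_smul_conjCovector {κ : Type*} [Fintype κ] (b : Module.Basis κ ℂ V)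
    (β : ConjDual V) : ∑ k, β (b k) • conjCovector (b.coord k) = β := by
  refine LinearMap.ext fun v => ?_
  conv_rhs => rw [← b.sum_repr v, map_sum]
  simp [conjCovector, mul_comm]

theorem span_conjCovector_coord {κ : Type*} [Finite κ] (b : Module.Basis κ ℂ V) :
    Submodule.span ℂ (Set.range fun k => conjCovector (b.coord k)) = ⊤ := by
  cases nonempty_fintype κ
  refine eq_top_iff.2 fun β _ => ?_
  rw [← sum_apply_smul_conjCovector b β]
  exact Submodule.sum_mem _ fun k _ => Submodule.smul_mem _ _ (Submodule.subset_span ⟨k, rfl⟩)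

instance finite_conjDual [FiniteDimensional ℂ V] : Module.Finite ℂ (ConjDual V) :=
  ⟨Submodule.fg_def.2
    ⟨_, Set.finite_range _, span_conjCovector_coord (Module.finBasis ℂ V)⟩⟩

theorem finrank_conjDual_le [FiniteDimensional ℂ V] :
    Module.finrank ℂ (ConjDual V) ≤ Module.finrank ℂ V := by
  let b := Module.finBasis ℂ V
  have hcard := finrank_range_le_card (R := ℂ) fun k => conjCovector (b.coord k)
  rwa [Set.finrank, span_conjCovector_coord, finrank_top, Fintype.card_fin] at hcard

theorem ι_eq_covForm_add_conjForm (a : Module.Dual ℂ V × ConjDual V) :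
    ExteriorAlgebra.ι ℂ a = covForm a.1 + conjForm a.2 := by
  simp [covForm, conjForm, ← map_add]

theorem involute_covForm (α : Module.Dual ℂ V) : involute (covForm α) = -covForm α :=
  CliffordAlgebra.involute_ι _

theorem involute_conjForm (β : ConjDual V) : involute (conjForm β) = -conjForm β :=
  CliffordAlgebra.involute_ι _

theorem formPull_mul (A : V →ₗ[ℂ] W) (a b : FormAlg W) :
    formPull A (a * b) = formPull A a * formPull A b :=
  map_mul (ExteriorAlgebra.map _) a b

theorem formPull_algebraMap (A : V →ₗ[ℂ] W) (r : ℂ) :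
    formPull A (algebraMap ℂ _ r) = algebraMap ℂ _ r :=
  (ExteriorAlgebra.map _).commutes r

theorem formPull_ι (A : V →ₗ[ℂ] W) (a : Module.Dual ℂ W × ConjDual W) :
    formPull A (ExteriorAlgebra.ι ℂ a) = ExteriorAlgebra.ι ℂ (a.1.comp A, a.2.comp A) :=
  ExteriorAlgebra.map_apply_ι _ a

theorem formPull_covForm (A : V →ₗ[ℂ] W) (α : Module.Dual ℂ W) :
    formPull A (covForm α) = covForm (α.comp A) := by
  refine (formPull_ι A (α, 0)).trans ?_
  rw [LinearMap.zero_comp]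
  rfl

theorem formPull_conjForm (A : V →ₗ[ℂ] W) (β : ConjDual W) :
    formPull A (conjForm β) = conjForm (β.comp A) := by
  refine (formPull_ι A (0, β)).trans ?_
  rw [LinearMap.zero_comp]
  rfl

theorem formPull_comp (A : V →ₗ[ℂ] W) (B : W →ₗ[ℂ] U) :
    (formPull A).comp (formPull B) = formPull (B.comp A) :=
  congrArg AlgHom.toLinearMap (ExteriorAlgebra.map_comp_map _ _)

theorem formPull_id : formPull (LinearMap.id : V →ₗ[ℂ] V) = LinearMap.id :=
  congrArg AlgHom.toLinearMap ExteriorAlgebra.map_id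

theorem involute_formPull (A : V →ₗ[ℂ] W) (x : FormAlg W) :
    involute (formPull A x) = formPull A (involute x) :=
  involute_map _ x

theorem involute_polyPull (A : V →ₗ[ℂ] W) (B : W →ₗ[ℂ] V) (x : PolyAlg W) :
    involute (polyPull A B x) = polyPull A B (involute x) :=
  involute_map _ x

theorem contractVec_ι_mul (v : V) (a : Module.Dual ℂ V × ConjDual V) (x : FormAlg V) :
    contractVec v (ExteriorAlgebra.ι ℂ a * x) =
      a.1 v • x - ExteriorAlgebra.ι ℂ a * contractVec v x :=
  CliffordAlgebra.contractLeft_ι_mul _ a x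

theorem contractVec_covForm_mul (v : V) (α : Module.Dual ℂ V) (x : FormAlg V) :
    contractVec v (covForm α * x) = α v • x - covForm α * contractVec v x :=
  contractVec_ι_mul v (α, 0) x

theorem thetaDeriv_ι_mul (α : Module.Dual ℂ V) (a : ConjDual V × V) (x : PolyAlg V) :
    thetaDeriv α (ExteriorAlgebra.ι ℂ a * x) =
      α a.2 • x - ExteriorAlgebra.ι ℂ a * thetaDeriv α x :=
  CliffordAlgebra.contractLeft_ι_mul _ a x

theorem thetaDeriv_algebraMap (α : Module.Dual ℂ V) (r : ℂ) :
    thetaDeriv α (algebraMap ℂ (PolyAlg V) r) = 0 :=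
  CliffordAlgebra.contractLeft_algebraMap (Q := (0 : QuadraticForm ℂ (ConjDual V × V))) _ r

theorem involute_contractVec (v : V) (x : FormAlg V) :
    involute (contractVec v x) = -contractVec v (involute x) :=
  involute_contractLeft _ x

theorem contractVec_formPull {A : V →ₗ[ℂ] W} {B : W →ₗ[ℂ] V} (hAB : A.comp B = LinearMap.id)
    (w : W) (x : FormAlg W) :
    contractVec (B w) (formPull A x) = formPull A (contractVec w x) := by
  have hw : A (B w) = w := LinearMap.congr_fun hAB w
  refine (contractLeft_map _ (A.dualMap.prodMap (conjPull A)) x).trans ?_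
  conv_rhs => rw [← hw]
  rfl

theorem contraction_ι (a : ConjDual V × V) (x : FormAlg V) :
    contraction (ExteriorAlgebra.ι ℂ a) x = conjForm a.1 * x + contractVec a.2 x := by
  simp [contraction, contractGen]

theorem contraction_conjPoly (β : ConjDual V) :
    contraction (conjPoly β) = LinearMap.mulLeft ℂ (conjForm β) := by
  refine LinearMap.ext fun x => (contraction_ι (β, 0) x).trans ?_
  rw [map_zero, LinearMap.zero_apply, add_zero, LinearMap.mulLeft_apply]

theorem contraction_algebraMap (r : ℂ) (x : FormAlg V) :
    contraction (algebraMap ℂ (PolyAlg V) r) x = r • x := by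
  rw [AlgHom.commutes, Module.algebraMap_end_apply]

theorem involute_contraction (a : PolyAlg V) (x : FormAlg V) :
    involute (contraction a x) = contraction (involute a) (involute x) := by
  induction a using CliffordAlgebra.left_induction generalizing x with
  | algebraMap r =>
    rw [involute.commutes, contraction_algebraMap, contraction_algebraMap, map_smul]
  | add a b ha hb => simp only [map_add, LinearMap.add_apply, ha, hb]
  | ι_mul a m ha =>
    simp only [map_mul, Module.End.mul_apply, CliffordAlgebra.involute_ι, map_neg,
      LinearMap.neg_apply, contraction_ι, map_add, involute_contractVec, involute_conjForm, ha,
      neg_mul, neg_add]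

theorem contraction_polyPull {A : V →ₗ[ℂ] W} {B : W →ₗ[ℂ] V} (hAB : A.comp B = LinearMap.id)
    (a : PolyAlg W) (x : FormAlg W) :
    contraction (polyPull A B a) (formPull A x) = formPull A (contraction a x) := by
  simp only [polyPull, AlgHom.toLinearMap_apply]
  induction a using CliffordAlgebra.left_induction generalizing x with
  | algebraMap r => rw [AlgHom.commutes, contraction_algebraMap, contraction_algebraMap, map_smul]
  | add a b ha hb => simp only [map_add, LinearMap.add_apply, ha, hb]
  | ι_mul a m ha =>
    simp only [map_mul, Module.End.mul_apply, ha, contraction_ι, ExteriorAlgebra.map_apply_ι,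
      LinearMap.prodMap_apply, map_add, formPull_mul, formPull_conjForm, contractVec_formPull hAB]
    rfl

theorem covForm_mul_conjForm_mul (α : Module.Dual ℂ V) (β : ConjDual V) (x : FormAlg V) :
    covForm α * (conjForm β * x) = -(conjForm β * (covForm α * x)) := by
  have hswap : covForm α * conjForm β = -(conjForm β * covForm α) := ι_mul_ι_eq_neg _ _
  rw [← mul_assoc, hswap, neg_mul, mul_assoc]

theorem covForm_mul_contraction (α : Module.Dual ℂ V) (a : PolyAlg V) (x : FormAlg V) :
    covForm α * contraction a x =
      contraction (involute a) (covForm α * x) + contraction (thetaDeriv α a) x := by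
  induction a using CliffordAlgebra.left_induction generalizing x with
  | algebraMap r =>
    rw [involute.commutes, contraction_algebraMap, contraction_algebraMap, thetaDeriv_algebraMap,
      map_zero, LinearMap.zero_apply, add_zero, mul_smul_comm]
  | add a b ha hb =>
    simp only [map_add, LinearMap.add_apply, mul_add, ha, hb]
    abel
  | ι_mul a m ha =>
    simp only [thetaDeriv_ι_mul, map_mul, Module.End.mul_apply, CliffordAlgebra.involute_ι,
      map_neg, LinearMap.neg_apply, contraction_ι, map_sub, map_smul, LinearMap.sub_apply,
      LinearMap.smul_apply, mul_add, eq_sub_of_add_eq (ha x).symm, contractVec_covForm_mul,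
      covForm_mul_conjForm_mul]
    abel

end Fibre

/-! ### Weights -/

section Weight

open CliffordAlgebra (involute)

variable {V W : Type*} [AddCommGroup V] [Module ℂ V] [AddCommGroup W] [Module ℂ W]

theorem rescaleAlg_covForm (α : Module.Dual ℂ V) :
    rescaleAlg (covForm α) = AddMonoidAlgebra.single (-1) (covForm α) := by
  refine (ExteriorAlgebra.lift_ι_apply ℂ rescaleGen rescaleGen_sq (α, 0)).trans ?_
  simp [rescaleGen]

theorem rescaleAlg_conjForm (β : ConjDual V) :
    rescaleAlg (conjForm β) = AddMonoidAlgebra.single 1 (conjForm β) := by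
  refine (ExteriorAlgebra.lift_ι_apply ℂ rescaleGen rescaleGen_sq (0, β)).trans ?_
  simp [rescaleGen]

theorem weightPart_covForm_mul (w : ℤ) (α : Module.Dual ℂ V) (x : FormAlg V) :
    weightPart w (covForm α * x) = covForm α * weightPart (w + 1) x := by
  simp only [weightPart, LinearMap.coe_mk, AddHom.coe_mk, map_mul, rescaleAlg_covForm,
    AddMonoidAlgebra.coeff_single_mul_apply]
  rw [neg_neg, add_comm]

theorem weightPart_conjForm_mul (w : ℤ) (β : ConjDual V) (x : FormAlg V) :
    weightPart w (conjForm β * x) = conjForm β * weightPart (w - 1) x := by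
  simp only [weightPart, LinearMap.coe_mk, AddHom.coe_mk, map_mul, rescaleAlg_conjForm,
    AddMonoidAlgebra.coeff_single_mul_apply]
  rw [neg_add_eq_sub]

theorem weightPart_ι_mul (w : ℤ) (m : Module.Dual ℂ V × ConjDual V) (x : FormAlg V) :
    weightPart w (ExteriorAlgebra.ι ℂ m * x) =
      covForm m.1 * weightPart (w + 1) x + conjForm m.2 * weightPart (w - 1) x := by
  rw [ι_eq_covForm_add_conjForm, add_mul, map_add, weightPart_covForm_mul, weightPart_conjForm_mul]

theorem weightPart_algebraMap (w : ℤ) (r : ℂ) :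
    weightPart w (algebraMap ℂ (FormAlg V) r) =
      if w = 0 then algebraMap ℂ (FormAlg V) r else 0 := by
  simp only [weightPart, LinearMap.coe_mk, AddHom.coe_mk, AlgHom.commutes]
  simp

theorem weightPart_formPull (w : ℤ) (A : V →ₗ[ℂ] W) (x : FormAlg W) :
    weightPart w (formPull A x) = formPull A (weightPart w x) := by
  induction x using CliffordAlgebra.left_induction generalizing w with
  | algebraMap r =>
    rw [formPull_algebraMap, weightPart_algebraMap, weightPart_algebraMap, apply_ite (formPull A),
      formPull_algebraMap, map_zero]
  | add x y hx hy => simp only [map_add, hx, hy]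
  | ι_mul x m hx =>
    rw [formPull_mul, formPull_ι, weightPart_ι_mul, weightPart_ι_mul, hx, hx, map_add,
      formPull_mul, formPull_mul, formPull_covForm, formPull_conjForm]

theorem involute_weightPart (w : ℤ) (x : FormAlg V) :
    involute (weightPart w x) = ((w.negOnePow : ℤ) : ℂ) • weightPart w x := by
  induction x using CliffordAlgebra.left_induction generalizing w with
  | algebraMap r =>
    rw [weightPart_algebraMap]
    split_ifs with hw
    · simp [hw]
    · simp
  | add x y hx hy => simp only [map_add, hx, hy, smul_add]
  | ι_mul x m hx =>
    simp only [weightPart_ι_mul, map_add, map_mul, hx, involute_covForm, involute_conjForm,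
      Int.negOnePow_succ, Int.negOnePow_sub, Int.negOnePow_one, smul_add]
    simp

theorem weightPart_of_mem_bidegree {w : ℤ} {p q : ℕ} (hw : w ≠ q - p) {x : FormAlg V}
    (hx : x ∈ LinearMap.range (covForm (V := V)) ^ p * LinearMap.range (conjForm (V := V)) ^ q) :
    weightPart w x = 0 := by
  induction p generalizing w x with
  | zero =>
    rw [pow_zero, one_mul] at hx
    induction q generalizing w x with
    | zero =>
      obtain ⟨r, rfl⟩ := Submodule.mem_one.1 (by simpa only [pow_zero] using hx)
      rw [weightPart_algebraMap, if_neg (by simpa using hw)]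
    | succ q ih =>
      rw [pow_succ'] at hx
      refine Submodule.mul_induction_on hx ?_ fun a b ha hb => by rw [map_add, ha, hb, add_zero]
      rintro _ ⟨β, rfl⟩ y hy
      rw [weightPart_conjForm_mul, ih (by push_cast at hw; lia) hy, mul_zero]
  | succ p ih =>
    rw [pow_succ', mul_assoc] at hx
    refine Submodule.mul_induction_on hx ?_ fun a b ha hb => by rw [map_add, ha, hb, add_zero]
    rintro _ ⟨α, rfl⟩ y hy
    rw [weightPart_covForm_mul, ih (by push_cast at hw; lia) hy, mul_zero]

theorem pow_range_covForm_eq_bot [FiniteDimensional ℂ V] {n : ℕ} (hn : Module.finrank ℂ V < n) :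
    LinearMap.range (covForm (V := V)) ^ n = ⊥ :=
  pow_range_ι_comp_eq_bot (LinearMap.inl ℂ (Module.Dual ℂ V) (ConjDual V))
    (by rwa [Subspace.dual_finrank_eq])

theorem pow_range_conjForm_eq_bot [FiniteDimensional ℂ V] {n : ℕ} (hn : Module.finrank ℂ V < n) :
    LinearMap.range (conjForm (V := V)) ^ n = ⊥ :=
  pow_range_ι_comp_eq_bot (LinearMap.inr ℂ (Module.Dual ℂ V) (ConjDual V))
    (finrank_conjDual_le.trans_lt hn)

theorem iSup_bidegree_eq_top : (⨆ (p : ℕ) (q : ℕ), LinearMap.range (covForm (V := V)) ^ p *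
    LinearMap.range (conjForm (V := V)) ^ q) = ⊤ :=
  iSup_pow_range_ι_inl_mul_pow_range_ι_inr

theorem weightPart_eq_zero [FiniteDimensional ℂ V] {w : ℤ}
    (hw : w ∉ Finset.Icc (-(Module.finrank ℂ V : ℤ)) (Module.finrank ℂ V)) :
    weightPart (V := V) w = 0 := by
  rw [← LinearMap.ker_eq_top, eq_top_iff, ← iSup_bidegree_eq_top]
  refine iSup₂_le fun p q x hx => LinearMap.mem_ker.2 ?_
  rcases lt_or_ge (Module.finrank ℂ V) p with hp | hp
  · rw [pow_range_covForm_eq_bot hp, Submodule.bot_mul, Submodule.mem_bot] at hx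
    rw [hx, map_zero]
  rcases lt_or_ge (Module.finrank ℂ V) q with hq | hq
  · rw [pow_range_conjForm_eq_bot hq, Submodule.mul_bot, Submodule.mem_bot] at hx
    rw [hx, map_zero]
  · exact weightPart_of_mem_bidegree (fun h => hw (Finset.mem_Icc.2 (by lia))) hx

end Weight

/-! ### The Koszul rule -/

section Parity

variable {R : Type*} [Ring R] [Algebra ℂ R] (𝒜 : ℤ → Submodule ℂ R) [GradedAlgebra 𝒜]

theorem parityInv_of_mem {i : ℤ} {r : R} (hr : r ∈ 𝒜 i) :
    parityInv 𝒜 r = ((i.negOnePow : ℤ) : ℂ) • r := by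
  simp only [parityInv, LinearMap.comp_apply, LinearEquiv.coe_coe,
    DirectSum.decomposeLinearEquiv_apply]
  rw [DirectSum.decompose_of_mem 𝒜 hr]
  exact DirectSum.toModule_lof (M := fun i => 𝒜 i) ℂ i ⟨r, hr⟩

theorem parityInv_of_mem_even {i : ℤ} (hi : Even i) {r : R} (hr : r ∈ 𝒜 i) :
    parityInv 𝒜 r = r := by
  rw [parityInv_of_mem 𝒜 hr, Int.negOnePow_even i hi, Units.val_one, Int.cast_one, one_smul]

theorem parityInv_of_mem_odd {i : ℤ} (hi : Odd i) {r : R} (hr : r ∈ 𝒜 i) :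
    parityInv 𝒜 r = -r := by
  rw [parityInv_of_mem 𝒜 hr, Int.negOnePow_odd i hi, Units.val_neg, Units.val_one, Int.cast_neg,
    Int.cast_one, neg_one_smul]

theorem evenPart_of_mem_even {i : ℤ} (hi : Even i) {r : R} (hr : r ∈ 𝒜 i) :
    evenPart 𝒜 r = r := by
  simp [evenPart, parityInv_of_mem_even 𝒜 hi hr, ← two_smul ℂ r, -smul_add]

theorem oddPart_of_mem_even {i : ℤ} (hi : Even i) {r : R} (hr : r ∈ 𝒜 i) :
    oddPart 𝒜 r = 0 := by
  simp [oddPart, parityInv_of_mem_even 𝒜 hi hr]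

theorem evenPart_of_mem_odd {i : ℤ} (hi : Odd i) {r : R} (hr : r ∈ 𝒜 i) :
    evenPart 𝒜 r = 0 := by
  simp [evenPart, parityInv_of_mem_odd 𝒜 hi hr]

theorem oddPart_of_mem_odd {i : ℤ} (hi : Odd i) {r : R} (hr : r ∈ 𝒜 i) :
    oddPart 𝒜 r = r := by
  simp [oddPart, parityInv_of_mem_odd 𝒜 hi hr, ← two_smul ℂ r, -smul_add]

variable {𝒜}

theorem mul_comm_of_even_mul [IsGradedArtin 𝒜] {i j : ℤ} (hij : Even (i * j)) {r t : R}
    (hr : r ∈ 𝒜 i) (ht : t ∈ 𝒜 j) : r * t = t * r := by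
  rw [IsGradedArtin.graded_comm i j r hr t ht, Int.negOnePow_even _ hij, Units.val_one,
    Int.cast_one, one_smul]

theorem mul_eq_neg_mul_of_odd_mul [IsGradedArtin 𝒜] {i j : ℤ} (hij : Odd (i * j)) {r t : R}
    (hr : r ∈ 𝒜 i) (ht : t ∈ 𝒜 j) : r * t = -(t * r) := by
  rw [IsGradedArtin.graded_comm i j r hr t ht, Int.negOnePow_odd _ hij, Units.val_neg,
    Units.val_one, Int.cast_neg, Int.cast_one, neg_one_smul]

variable (𝒜) in
@[elab_as_elim]
theorem tmul_homogeneous_induction {P : Type*} [AddCommMonoid P] [Module ℂ P]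
    {motive : P ⊗[ℂ] R → Prop} (g : P ⊗[ℂ] R) (zero : motive 0)
    (add : ∀ g h, motive g → motive h → motive (g + h))
    (even : ∀ a (i : ℤ) (r : R), Even i → r ∈ 𝒜 i → motive (a ⊗ₜ r))
    (odd : ∀ a (i : ℤ) (r : R), Odd i → r ∈ 𝒜 i → motive (a ⊗ₜ r)) : motive g := by
  induction g with
  | zero => exact zero
  | add g h hg hh => exact add g h hg hh
  | tmul a r =>
    induction r using DirectSum.Decomposition.inductionOn 𝒜 with
    | zero => rwa [TensorProduct.tmul_zero]
    | @homogeneous i r => exact (Int.even_or_odd i).elim (even a i r · r.2) (odd a i r · r.2)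
    | add r t hr ht => rw [TensorProduct.tmul_add]; exact add _ _ hr ht

end Parity

section SuperAct

variable {R : Type*} [Ring R] [Algebra ℂ R] {𝒜 : ℤ → Submodule ℂ R} [GradedAlgebra 𝒜]
variable {P M : Type*} [AddCommGroup P] [Module ℂ P] [AddCommGroup M] [Module ℂ M]
  (s : M →ₗ[ℂ] M) (ρ : P →ₗ[ℂ] Module.End ℂ M)

theorem superAct_tmul_of_even {i : ℤ} (hi : Even i) {r : R} (hr : r ∈ 𝒜 i) (a : P) (m : M)
    (t : R) : superAct 𝒜 s ρ (a ⊗ₜ r) (m ⊗ₜ t) = ρ a m ⊗ₜ (r * t) := by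
  simp [superAct, TensorProduct.homTensorHomMap_apply, evenPart_of_mem_even 𝒜 hi hr,
    oddPart_of_mem_even 𝒜 hi hr]

theorem superAct_tmul_of_odd {i : ℤ} (hi : Odd i) {r : R} (hr : r ∈ 𝒜 i) (a : P) (m : M)
    (t : R) : superAct 𝒜 s ρ (a ⊗ₜ r) (m ⊗ₜ t) = ρ a (s m) ⊗ₜ (r * t) := by
  simp [superAct, TensorProduct.homTensorHomMap_apply, evenPart_of_mem_odd 𝒜 hi hr,
    oddPart_of_mem_odd 𝒜 hi hr]

theorem superAct_tmul_one (a : P) : superAct 𝒜 s ρ (a ⊗ₜ (1 : R)) = (ρ a).rTensor R := by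
  refine TensorProduct.ext' fun m t => ?_
  rw [superAct_tmul_of_even s ρ Even.zero SetLike.GradedOne.one_mem, one_mul,
    LinearMap.rTensor_tmul]

theorem superAct_superAct {Q : Type*} [AddCommGroup Q] [Module ℂ Q] {σ : Q →ₗ[ℂ] Q}
    {s : M →ₗ[ℂ] M} {μ : P →ₗ[ℂ] Module.End ℂ Q} {ρ : P →ₗ[ℂ] Module.End ℂ M}
    {τ : Q →ₗ[ℂ] Module.End ℂ M} (hs : ∀ m, s (s m) = m)
    (hτ : ∀ b m, s (τ b m) = τ (σ b) (s m)) (hμ : ∀ a b, τ (μ a b) = ρ a * τ b)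
    (g : P ⊗[ℂ] R) (h : Q ⊗[ℂ] R) :
    superAct 𝒜 s τ (superAct 𝒜 σ μ g h) = superAct 𝒜 s ρ g * superAct 𝒜 s τ h := by
  induction g using tmul_homogeneous_induction 𝒜 with
  | zero => simp
  | add g g' hg hg' => simp only [map_add, LinearMap.add_apply, hg, hg', add_mul]
  | even a i r hi hr =>
    induction h using tmul_homogeneous_induction 𝒜 with
    | zero => simp
    | add h h' hh hh' => simp only [map_add, hh, hh', mul_add]
    | even b j t hj ht =>
      refine TensorProduct.ext' fun m u => ?_
      rw [Module.End.mul_apply, superAct_tmul_of_even σ μ hi hr,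
        superAct_tmul_of_even s τ (hi.add hj) (SetLike.mul_mem_graded hr ht),
        superAct_tmul_of_even s τ hj ht, superAct_tmul_of_even s ρ hi hr, hμ, mul_assoc,
        Module.End.mul_apply]
    | odd b j t hj ht =>
      refine TensorProduct.ext' fun m u => ?_
      rw [Module.End.mul_apply, superAct_tmul_of_even σ μ hi hr,
        superAct_tmul_of_odd s τ (hi.add_odd hj) (SetLike.mul_mem_graded hr ht),
        superAct_tmul_of_odd s τ hj ht, superAct_tmul_of_even s ρ hi hr, hμ, mul_assoc,
        Module.End.mul_apply]
  | odd a i r hi hr =>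
    induction h using tmul_homogeneous_induction 𝒜 with
    | zero => simp
    | add h h' hh hh' => simp only [map_add, hh, hh', mul_add]
    | even b j t hj ht =>
      refine TensorProduct.ext' fun m u => ?_
      rw [Module.End.mul_apply, superAct_tmul_of_odd σ μ hi hr,
        superAct_tmul_of_odd s τ (hi.add_even hj) (SetLike.mul_mem_graded hr ht),
        superAct_tmul_of_even s τ hj ht, superAct_tmul_of_odd s ρ hi hr, hμ, mul_assoc,
        Module.End.mul_apply, hτ]
    | odd b j t hj ht =>
      refine TensorProduct.ext' fun m u => ?_
      rw [Module.End.mul_apply, superAct_tmul_of_odd σ μ hi hr,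
        superAct_tmul_of_even s τ (hi.add_odd hj) (SetLike.mul_mem_graded hr ht),
        superAct_tmul_of_odd s τ hj ht, superAct_tmul_of_odd s ρ hi hr, hμ, mul_assoc,
        Module.End.mul_apply, hτ, hs]

variable {P' M' : Type*} [AddCommGroup P'] [Module ℂ P'] [AddCommGroup M'] [Module ℂ M']
  {s' : M' →ₗ[ℂ] M'} {ρ' : P' →ₗ[ℂ] Module.End ℂ M'} {R' : Type*} [Ring R'] [Algebra ℂ R']
  {ℬ : ℤ → Submodule ℂ R'} [GradedAlgebra ℬ]

theorem superAct_map {s : M →ₗ[ℂ] M} {ρ : P →ₗ[ℂ] Module.End ℂ M} {f : R →ₐ[ℂ] R'}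
    (hf : ∀ d : ℤ, ∀ r ∈ 𝒜 d, f r ∈ ℬ d) {G : P →ₗ[ℂ] P'} {F : M →ₗ[ℂ] M'}
    (hs : ∀ m, s' (F m) = F (s m)) (hρ : ∀ a m, ρ' (G a) (F m) = F (ρ a m))
    (g : P ⊗[ℂ] R) (x : M ⊗[ℂ] R) :
    superAct ℬ s' ρ' (TensorProduct.map G f.toLinearMap g) (TensorProduct.map F f.toLinearMap x) =
      TensorProduct.map F f.toLinearMap (superAct 𝒜 s ρ g x) := by
  induction x with
  | zero => simp
  | add x y hx hy => simp only [map_add, hx, hy]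
  | tmul m t =>
    induction g using tmul_homogeneous_induction 𝒜 with
    | zero => simp
    | add g h hg hh => simp only [map_add, LinearMap.add_apply, hg, hh]
    | even a i r hi hr =>
      simp only [TensorProduct.map_tmul, superAct_tmul_of_even _ _ hi hr, AlgHom.toLinearMap_apply,
        superAct_tmul_of_even _ _ hi (hf i r hr), hρ, map_mul]
    | odd a i r hi hr =>
      simp only [TensorProduct.map_tmul, superAct_tmul_of_odd _ _ hi hr, AlgHom.toLinearMap_apply,
        superAct_tmul_of_odd _ _ hi (hf i r hr), hρ, hs, map_mul]

end SuperAct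

section ContractR

open CliffordAlgebra (involute involute_involute)

variable {R : Type*} [Ring R] [Algebra ℂ R] (𝒜 : ℤ → Submodule ℂ R) [GradedAlgebra 𝒜]
variable {V W : Type*} [AddCommGroup V] [Module ℂ V] [AddCommGroup W] [Module ℂ W]

theorem contractR_polyMul (g h : PolyAlg V ⊗[ℂ] R) :
    contractR 𝒜 (polyMul 𝒜 g h) = contractR 𝒜 g * contractR 𝒜 h :=
  superAct_superAct involute_involute involute_contraction (map_mul contraction) g h

theorem contractR_tmul_one (a : PolyAlg V) :
    contractR 𝒜 (a ⊗ₜ (1 : R)) = (contraction a).rTensor R :=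
  superAct_tmul_one _ _ a

theorem polyMul_tmul_one (a : PolyAlg V) :
    polyMul 𝒜 (a ⊗ₜ (1 : R)) = (LinearMap.mulLeft ℂ a).rTensor R :=
  superAct_tmul_one _ _ a

theorem contractR_pull {A : V →ₗ[ℂ] W} {B : W →ₗ[ℂ] V} (hAB : A.comp B = LinearMap.id)
    (g : PolyAlg W ⊗[ℂ] R) (x : FormAlg W ⊗[ℂ] R) :
    contractR 𝒜 ((polyPull A B).rTensor R g) ((formPull A).rTensor R x) =
      (formPull A).rTensor R (contractR 𝒜 g x) :=
  superAct_map (f := AlgHom.id ℂ R) (fun _ _ hr => hr) (involute_formPull A)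
    (contraction_polyPull hAB) g x

theorem contractR_map {R' : Type*} [Ring R'] [Algebra ℂ R'] (ℬ : ℤ → Submodule ℂ R')
    [GradedAlgebra ℬ] (f : R →ₐ[ℂ] R') (hf : ∀ d : ℤ, ∀ r ∈ 𝒜 d, f r ∈ ℬ d)
    (g : PolyAlg V ⊗[ℂ] R) (x : FormAlg V ⊗[ℂ] R) :
    f.toLinearMap.lTensor _ (contractR 𝒜 g x) =
      contractR ℬ (f.toLinearMap.lTensor _ g) (f.toLinearMap.lTensor _ x) :=
  (superAct_map (s := involute.toLinearMap) (ρ := contraction.toLinearMap) (G := LinearMap.id)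
    (F := LinearMap.id) hf (fun _ => rfl) (fun _ _ => rfl) g x).symm

theorem polyParity_pull (A : V →ₗ[ℂ] W) (B : W →ₗ[ℂ] V) (g : PolyAlg W ⊗[ℂ] R) :
    polyParity 𝒜 ((polyPull A B).rTensor R g) = (polyPull A B).rTensor R (polyParity 𝒜 g) := by
  induction g with
  | zero => simp only [map_zero]
  | add g h hg hh => simp only [map_add, hg, hh]
  | tmul a r =>
    simp only [polyParity, LinearMap.rTensor_tmul, TensorProduct.map_tmul,
      AlgHom.toLinearMap_apply, involute_polyPull]

theorem mulLeft_covForm_contractR (α : Module.Dual ℂ V) (g : PolyAlg V ⊗[ℂ] R) :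
    (LinearMap.mulLeft ℂ (covForm α)).rTensor R * contractR 𝒜 g -
      contractR 𝒜 (polyParity 𝒜 g) * (LinearMap.mulLeft ℂ (covForm α)).rTensor R =
    contractR 𝒜 ((thetaDeriv α).rTensor R g) := by
  induction g using tmul_homogeneous_induction 𝒜 with
  | zero =>
    refine LinearMap.ext fun x => ?_
    simp
  | add g h hg hh =>
    simp only [map_add, ← hg, ← hh, mul_add, add_mul]
    abel
  | even a i r hi hr =>
    refine TensorProduct.ext' fun m t => ?_
    simp only [LinearMap.sub_apply, Module.End.mul_apply, LinearMap.rTensor_tmul, polyParity,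
      TensorProduct.map_tmul, AlgHom.toLinearMap_apply, parityInv_of_mem_even 𝒜 hi hr, contractR,
      superAct_tmul_of_even _ _ hi hr, LinearMap.mulLeft_apply, covForm_mul_contraction,
      TensorProduct.add_tmul, add_sub_cancel_left]
  | odd a i r hi hr =>
    refine TensorProduct.ext' fun m t => ?_
    simp only [LinearMap.sub_apply, Module.End.mul_apply, LinearMap.rTensor_tmul, polyParity,
      TensorProduct.map_tmul, AlgHom.toLinearMap_apply, parityInv_of_mem_odd 𝒜 hi hr, contractR,
      superAct_tmul_of_odd _ _ hi hr, LinearMap.mulLeft_apply, covForm_mul_contraction,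
      TensorProduct.add_tmul, TensorProduct.tmul_neg, map_neg, map_mul, involute_covForm, neg_mul,
      LinearMap.neg_apply, TensorProduct.neg_tmul, neg_neg, add_sub_cancel_left]

variable {𝒜}

theorem polyMul_tmul_comm_of_even [IsGradedArtin 𝒜] {a : PolyAlg V}
    (ha : a ∈ CliffordAlgebra.evenOdd (0 : QuadraticForm ℂ (ConjDual V × V)) 0) {i : ℤ}
    (hi : Even i) {r : R} (hr : r ∈ 𝒜 i) (h : PolyAlg V ⊗[ℂ] R) :
    polyMul 𝒜 (a ⊗ₜ r) h = polyMul 𝒜 h (a ⊗ₜ r) := by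
  have ha' : involute a = a := CliffordAlgebra.involute_eq_of_mem_even ha
  induction h using tmul_homogeneous_induction 𝒜 with
  | zero => simp
  | add g h hg hh => simp only [map_add, LinearMap.add_apply, hg, hh]
  | even b j t hj ht =>
    simp [polyMul, superAct_tmul_of_even _ _ hi hr, superAct_tmul_of_even _ _ hj ht,
      mul_comm_of_mem_even ha b, mul_comm_of_even_mul (hi.mul_right j) hr ht]
  | odd b j t hj ht =>
    simp [polyMul, superAct_tmul_of_even _ _ hi hr, superAct_tmul_of_odd _ _ hj ht, ha',
      mul_comm_of_mem_even ha b, mul_comm_of_even_mul (hi.mul_right j) hr ht]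

theorem polyMul_tmul_comm_of_odd [IsGradedArtin 𝒜] {a : PolyAlg V}
    (ha : a ∈ CliffordAlgebra.evenOdd (0 : QuadraticForm ℂ (ConjDual V × V)) 1) {i : ℤ}
    (hi : Odd i) {r : R} (hr : r ∈ 𝒜 i) (h : PolyAlg V ⊗[ℂ] R) :
    polyMul 𝒜 (a ⊗ₜ r) h = polyMul 𝒜 h (a ⊗ₜ r) := by
  have ha' : involute a = -a := CliffordAlgebra.involute_eq_of_mem_odd ha
  induction h using tmul_homogeneous_induction 𝒜 with
  | zero => simp
  | add g h hg hh => simp only [map_add, LinearMap.add_apply, hg, hh]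
  | even b j t hj ht =>
    simp [polyMul, superAct_tmul_of_odd _ _ hi hr, superAct_tmul_of_even _ _ hj ht,
      mul_eq_involute_mul_of_mem_odd ha, mul_comm_of_even_mul (hj.mul_left i) hr ht]
  | odd b j t hj ht =>
    simp [polyMul, superAct_tmul_of_odd _ _ hi hr, superAct_tmul_of_odd _ _ hj ht, ha',
      mul_eq_involute_mul_of_mem_odd ha, mul_eq_neg_mul_of_odd_mul (hi.mul hj) hr ht,
      TensorProduct.neg_tmul, TensorProduct.tmul_neg]

theorem polyMul_add_polyParity_comm [IsGradedArtin 𝒜] (g h : PolyAlg V ⊗[ℂ] R) :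
    polyMul 𝒜 (g + polyParity 𝒜 g) h = polyMul 𝒜 h (g + polyParity 𝒜 g) := by
  induction g using tmul_homogeneous_induction 𝒜 with
  | zero => simp
  | add g g' hg hg' =>
    rw [map_add (polyParity 𝒜), add_add_add_comm, map_add (polyMul 𝒜), LinearMap.add_apply, hg,
      hg', ← map_add (polyMul 𝒜 h)]
  | even a i r hi hr =>
    rw [polyParity, TensorProduct.map_tmul, parityInv_of_mem_even 𝒜 hi hr,
      ← TensorProduct.add_tmul]
    exact polyMul_tmul_comm_of_even (add_involute_mem_even a) hi hr h
  | odd a i r hi hr =>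
    rw [polyParity, TensorProduct.map_tmul, parityInv_of_mem_odd 𝒜 hi hr, TensorProduct.tmul_neg,
      ← sub_eq_add_neg, ← TensorProduct.sub_tmul]
    exact polyMul_tmul_comm_of_odd (sub_involute_mem_odd a) hi hr h

theorem polyMul_comm_of_polyParity_eq_self [IsGradedArtin 𝒜] {g : PolyAlg V ⊗[ℂ] R}
    (hg : polyParity 𝒜 g = g) (h : PolyAlg V ⊗[ℂ] R) : polyMul 𝒜 g h = polyMul 𝒜 h g := by
  have hcomm := polyMul_add_polyParity_comm (𝒜 := 𝒜) g h
  rw [hg, ← two_smul ℂ g, map_smul, map_smul, LinearMap.smul_apply] at hcomm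
  exact smul_right_injective _ two_ne_zero hcomm

theorem contractR_comm [IsGradedArtin 𝒜] {g : PolyAlg V ⊗[ℂ] R} (hg : polyParity 𝒜 g = g)
    (h : PolyAlg V ⊗[ℂ] R) : contractR 𝒜 g * contractR 𝒜 h = contractR 𝒜 h * contractR 𝒜 g := by
  rw [← contractR_polyMul, ← contractR_polyMul, polyMul_comm_of_polyParity_eq_self hg]

theorem polyBidegree_le_exteriorPower (q p : ℕ) :
    polyBidegree V q p ≤ ⋀[ℂ]^(q + p) (ConjDual V × V) := by
  rw [polyBidegree, ExteriorAlgebra.exteriorPower, pow_add]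
  exact mul_le_mul' (pow_le_pow_left' (LinearMap.range_comp_le_range _ _) q)
    (pow_le_pow_left' (LinearMap.range_comp_le_range _ _) p)

theorem polyParity_of_mem_degreeZeroPart {g : PolyAlg V ⊗[ℂ] R} (hg : g ∈ degreeZeroPart 𝒜 V) :
    polyParity 𝒜 g = g := by
  refine LinearMap.eqOn_span (f := polyParity 𝒜) (g := LinearMap.id) ?_ hg
  rintro _ ⟨q, p, a, ha, r, hr, -, rfl⟩
  have hsign : (-1 : ℂ) ^ (q + p) * ((((p : ℤ) - q).negOnePow : ℤ) : ℂ) = 1 := by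
    rw [Int.negOnePow_sub, ← Int.negOnePow_add, ← Nat.cast_add, Int.negOnePow_def, zpow_natCast]
    push_cast
    rw [add_comm q p, ← mul_pow, neg_one_mul, neg_neg, one_pow]
  simp only [polyParity, TensorProduct.map_tmul, AlgHom.toLinearMap_apply,
    involute_of_mem_exteriorPower (polyBidegree_le_exteriorPower q p ha), parityInv_of_mem 𝒜 hr,
    TensorProduct.smul_tmul_smul, hsign, one_smul, LinearMap.id_apply]

end ContractR

section Nilpotent

theorem mem_jacobson_bot_of_mem_nonunits {R : Type*} [Ring R] [IsDedekindFiniteMonoid R]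
    [IsLocalRing R] {x : R} (hx : x ∈ nonunits R) : x ∈ Ideal.jacobson (⊥ : Ideal R) := by
  rw [Ideal.mem_jacobson_iff]
  intro y
  have hyx : ¬IsUnit (-(y * x)) := fun h =>
    hx (isUnit_of_mul_isUnit_right ((IsUnit.neg_iff _).1 h))
  obtain ⟨u, hu⟩ : IsUnit (1 + y * x) :=
    (IsLocalRing.isUnit_or_isUnit_of_add_one (neg_add_cancel_comm_assoc _ _)).resolve_left hyx
  refine ⟨↑u⁻¹, ?_⟩
  rw [mul_assoc, add_comm, ← mul_one_add, ← hu, Units.inv_mul, sub_self]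
  exact Submodule.zero_mem _

variable {R : Type*} [Ring R] [Algebra ℂ R] (𝒜 : ℤ → Submodule ℂ R) [GradedAlgebra 𝒜]

/-- The tensors in `M ⊗ R` whose coefficients lie in the ideal `I` of `R`: the `𝔐_R`-adic
filtration of the forms with values in `R` is that of the powers of the maximal ideal. -/
def tmulIdeal (M : Type*) [AddCommGroup M] [Module ℂ M] (I : Ideal R) : Submodule ℂ (M ⊗[ℂ] R) :=
  Submodule.span ℂ {t | ∃ m : M, ∃ r ∈ I, t = m ⊗ₜ[ℂ] r}

theorem tmulIdeal_bot (M : Type*) [AddCommGroup M] [Module ℂ M] :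
    tmulIdeal M (⊥ : Ideal R) = ⊥ := by
  rw [tmulIdeal, Submodule.span_eq_bot]
  rintro _ ⟨m, r, hr, rfl⟩
  rw [(Submodule.mem_bot R).1 hr, TensorProduct.tmul_zero]

theorem tmulIdeal_top (M : Type*) [AddCommGroup M] [Module ℂ M] :
    tmulIdeal M (⊤ : Ideal R) = ⊤ := by
  rw [← top_le_iff, ← TensorProduct.span_tmul_eq_top]
  exact Submodule.span_mono fun _ ⟨m, r, h⟩ => ⟨m, r, Submodule.mem_top, h.symm⟩

theorem superAct_tmul_mem_tmulIdeal {P M : Type*} [AddCommGroup P] [Module ℂ P] [AddCommGroup M]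
    [Module ℂ M] (s : M →ₗ[ℂ] M) (ρ : P →ₗ[ℂ] Module.End ℂ M) {I J : Ideal R} {i : ℤ} {r : R}
    (hr : r ∈ 𝒜 i) (hrI : r ∈ I) (a : P) {x : M ⊗[ℂ] R} (hx : x ∈ tmulIdeal M J) :
    superAct 𝒜 s ρ (a ⊗ₜ r) x ∈ tmulIdeal M (I * J) := by
  suffices tmulIdeal M J ≤ (tmulIdeal M (I * J)).comap (superAct 𝒜 s ρ (a ⊗ₜ r)) from this hx
  refine Submodule.span_le.2 ?_
  rintro _ ⟨m, t, ht, rfl⟩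
  rcases Int.even_or_odd i with hi | hi
  · exact Submodule.subset_span
      ⟨_, _, Ideal.mul_mem_mul hrI ht, superAct_tmul_of_even s ρ hi hr a m t⟩
  · exact Submodule.subset_span
      ⟨_, _, Ideal.mul_mem_mul hrI ht, superAct_tmul_of_odd s ρ hi hr a m t⟩

variable {V : Type*} [AddCommGroup V] [Module ℂ V]

theorem contractR_mem_tmulIdeal [IsDedekindFiniteMonoid R] [IsLocalRing R]
    {g : PolyAlg V ⊗[ℂ] R} (hg : g ∈ degreeZeroPart 𝒜 V) {I : Ideal R} {x : FormAlg V ⊗[ℂ] R}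
    (hx : x ∈ tmulIdeal (FormAlg V) I) :
    contractR 𝒜 g x ∈ tmulIdeal (FormAlg V) (Ideal.jacobson ⊥ * I) := by
  suffices degreeZeroPart 𝒜 V ≤ (tmulIdeal (FormAlg V) (Ideal.jacobson ⊥ * I)).comap
    ((contractR 𝒜).flip x) from this hg
  refine Submodule.span_le.2 ?_
  rintro _ ⟨q, p, a, -, r, hr, hr', rfl⟩
  exact superAct_tmul_mem_tmulIdeal 𝒜 _ _ hr (mem_jacobson_bot_of_mem_nonunits hr') a hx

theorem exists_contractR_pow_eq_zero [IsGradedArtin 𝒜] : ∃ N : ℕ,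
    ∀ {V : Type*} [AddCommGroup V] [Module ℂ V] {g : PolyAlg V ⊗[ℂ] R},
      g ∈ degreeZeroPart 𝒜 V → contractR 𝒜 g ^ N = 0 := by
  have : FiniteDimensional ℂ R := IsGradedArtin.finite 𝒜
  have : IsLocalRing R := IsGradedArtin.isLocal 𝒜
  have : IsArtinianRing R := IsArtinianRing.of_finite ℂ R
  have : IsNoetherianRing R := IsNoetherianRing.of_finite ℂ R
  obtain ⟨N, hN⟩ := IsArtinianRing.isNilpotent_jacobson_bot (R := R)
  refine ⟨N, fun {V} _ _ g hg => LinearMap.ext fun x => ?_⟩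
  have mem_pow : ∀ k, (contractR 𝒜 g ^ k) x ∈ tmulIdeal (FormAlg V) (Ideal.jacobson ⊥ ^ k) := by
    intro k
    induction k with
    | zero =>
      rw [Submodule.pow_zero, Ideal.one_eq_top, tmulIdeal_top]
      exact Submodule.mem_top
    | succ k ih =>
      rw [pow_succ', Module.End.mul_apply, Ideal.IsTwoSided.pow_succ]
      exact contractR_mem_tmulIdeal 𝒜 hg ih
  have mem_bot := mem_pow N
  rwa [hN, Ideal.zero_eq_bot, tmulIdeal_bot, Submodule.mem_bot] at mem_bot

end Nilpotent

/-! ### Differential calculus at a point -/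

section Calculus

open Topology

variable {E : Type*} [NormedAddCommGroup E] [NormedSpace ℂ E]
variable {F G H : Type*} [AddCommGroup F] [Module ℂ F] [AddCommGroup G] [Module ℂ G]
  [AddCommGroup H] [Module ℂ H]

/-- Differentiability at a point of a map into a finite-dimensional complex vector space, which
carries no chosen norm: all linear functionals of it are differentiable. It is the counterpart of
`SmoothOn` under which `dirDeriv` obeys the usual rules. -/
def WeakDiffAt (f : E → F) (y : E) : Prop :=
  ∀ l : Module.Dual ℂ F, DifferentiableAt ℝ (fun z => l (f z)) y

theorem SmoothOn.weakDiffAt {f : E → F} {s : Set E} (hf : SmoothOn f s) (hs : IsOpen s) {y : E}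
    (hy : y ∈ s) : WeakDiffAt f y := fun l =>
  ((hf l).contDiffAt (hs.mem_nhds hy)).differentiableAt (by simp)

theorem SmoothOn.congr {f g : E → F} {s : Set E} (hf : SmoothOn f s) (h : ∀ y ∈ s, g y = f y) :
    SmoothOn g s := fun l => (hf l).congr fun y hy => by rw [h y hy]

theorem SmoothOn.map {f : E → F} {s : Set E} (hf : SmoothOn f s) (L : F →ₗ[ℂ] G) :
    SmoothOn (fun y => L (f y)) s := fun l => hf (l.comp L)

theorem SmoothOn.sum {κ : Type*} (t : Finset κ) {f : κ → E → F} {s : Set E}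
    (hf : ∀ k ∈ t, SmoothOn (f k) s) : SmoothOn (fun y => ∑ k ∈ t, f k y) s := fun l => by
  simp only [map_sum]
  exact ContDiffOn.sum fun k hk => hf k hk l

theorem dual_apply_bilin_eq_sum [FiniteDimensional ℂ F] (b : F →ₗ[ℂ] G →ₗ[ℂ] H)
    (l : Module.Dual ℂ H) (x : F) (z : G) :
    l (b x z) = ∑ k, (Module.finBasis ℂ F).coord k x *
      (l.comp (b (Module.finBasis ℂ F k))) z := by
  conv_lhs => rw [← (Module.finBasis ℂ F).sum_repr x]
  simp only [map_sum, map_smul, LinearMap.sum_apply, LinearMap.smul_apply, smul_eq_mul,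
    Module.Basis.coord_apply, LinearMap.comp_apply]

theorem SmoothOn.bilin [FiniteDimensional ℂ F] {f : E → F} {g : E → G} {s : Set E}
    (b : F →ₗ[ℂ] G →ₗ[ℂ] H) (hf : SmoothOn f s) (hg : SmoothOn g s) :
    SmoothOn (fun y => b (f y) (g y)) s := fun l => by
  simp only [dual_apply_bilin_eq_sum b l]
  exact ContDiffOn.sum fun k _ => (hf _).mul (hg _)

theorem WeakDiffAt.const (c : F) (y : E) : WeakDiffAt (fun _ => c) y := fun _ =>
  differentiableAt_const _

theorem WeakDiffAt.add {f g : E → F} {y : E} (hf : WeakDiffAt f y) (hg : WeakDiffAt g y) :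
    WeakDiffAt (fun z => f z + g z) y := fun l => by
  simp only [map_add]
  exact (hf l).add (hg l)

theorem WeakDiffAt.sum {κ : Type*} (t : Finset κ) {f : κ → E → F} {y : E}
    (hf : ∀ k ∈ t, WeakDiffAt (f k) y) : WeakDiffAt (fun z => ∑ k ∈ t, f k z) y := fun l => by
  simp only [map_sum]
  exact DifferentiableAt.fun_sum fun k hk => hf k hk l

theorem WeakDiffAt.map {f : E → F} {y : E} (hf : WeakDiffAt f y) (L : F →ₗ[ℂ] G) :
    WeakDiffAt (fun z => L (f z)) y := fun l => hf (l.comp L)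

theorem WeakDiffAt.bilin [FiniteDimensional ℂ F] {f : E → F} {g : E → G} {y : E}
    (b : F →ₗ[ℂ] G →ₗ[ℂ] H) (hf : WeakDiffAt f y) (hg : WeakDiffAt g y) :
    WeakDiffAt (fun z => b (f z) (g z)) y := fun l => by
  simp only [dual_apply_bilin_eq_sum b l]
  exact DifferentiableAt.fun_sum fun k _ => (hf _).mul (hg _)

theorem WeakDiffAt.comp {f : E → F} {g : E → E} {g' : E →L[ℂ] E} {y : E}
    (hf : WeakDiffAt f (g y)) (hg : HasFDerivAt g g' y) : WeakDiffAt (fun z => f (g z)) y :=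
  fun l => ((hf l).hasFDerivAt.comp y (hg.restrictScalars ℝ)).differentiableAt

theorem weakDiffAt_linearMap [FiniteDimensional ℂ F] {P : E → F →ₗ[ℂ] G} {y : E}
    (hP : ∀ x, WeakDiffAt (fun z => P z x) y) : WeakDiffAt P y := fun l => by
  let b := Module.finBasis ℂ F
  have expand : ∀ Q : F →ₗ[ℂ] G, Q = ∑ k, LinearMap.smulRightₗ (b.coord k) (Q (b k)) := fun Q =>
    b.ext fun j => by simp [LinearMap.sum_apply, Finsupp.single_apply, ite_smul]
  have apply_eq_sum : (fun z => l (P z)) =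
      fun z => ∑ k, (l.comp (LinearMap.smulRightₗ (b.coord k))) (P z (b k)) :=
    funext fun z => (congrArg l (expand (P z))).trans (map_sum l _ _)
  rw [apply_eq_sum]
  exact DifferentiableAt.fun_sum fun k _ => hP (b k) _

theorem eq_of_forall_dual_apply_eq {x y : F} (h : ∀ l : Module.Dual ℂ F, l x = l y) : x = y :=
  Module.eval_apply_injective ℂ (LinearMap.ext h)

theorem dual_dirDeriv [FiniteDimensional ℂ F] {f : E → F} {y : E} (hf : WeakDiffAt f y) (v : E)
    (l : Module.Dual ℂ F) : l (dirDeriv f y v) = fderiv ℝ (fun z => l (f z)) y v := by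
  set b := Module.Basis.ofVectorSpace ℂ F
  have dual_eq_sum : ∀ x : F, l x = ∑ k, b.coord k x * l (b k) := fun x => by
    conv_lhs => rw [← b.sum_repr x]
    simp only [map_sum, map_smul, smul_eq_mul, Module.Basis.coord_apply]
  have hderiv : HasFDerivAt (fun z => ∑ k, b.coord k (f z) * l (b k))
      (∑ k, (l (b k)) • fderiv ℝ (fun z => b.coord k (f z)) y) y :=
    HasFDerivAt.fun_sum fun k _ => (hf (b.coord k)).hasFDerivAt.mul_const (l (b k))
  simp only [dual_eq_sum (f _)]
  rw [hderiv.fderiv, dirDeriv, finsum_eq_sum_of_fintype, map_sum, sum_apply]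
  refine Finset.sum_congr rfl fun k _ => ?_
  rw [map_smul, smul_eq_mul, mul_comm]
  rfl

theorem dirDeriv_congr {f g : E → F} {y : E} (h : f =ᶠ[𝓝 y] g) (v : E) :
    dirDeriv f y v = dirDeriv g y v := by
  refine finsum_congr fun k => ?_
  have hcoord : (fun z => (Module.Basis.ofVectorSpace ℂ F).repr (f z) k) =ᶠ[𝓝 y]
      fun z => (Module.Basis.ofVectorSpace ℂ F).repr (g z) k := h.mono fun z hz => by simp only [hz]
  rw [hcoord.fderiv_eq]

theorem dirDeriv_map [FiniteDimensional ℂ F] [FiniteDimensional ℂ G] {f : E → F} {y : E}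
    (hf : WeakDiffAt f y) (L : F →ₗ[ℂ] G) (v : E) :
    dirDeriv (fun z => L (f z)) y v = L (dirDeriv f y v) :=
  eq_of_forall_dual_apply_eq fun l => by
    rw [dual_dirDeriv (hf.map L)]
    exact (dual_dirDeriv hf v (l.comp L)).symm

theorem dirDeriv_add [FiniteDimensional ℂ F] {f g : E → F} {y : E}
    (hf : WeakDiffAt f y) (hg : WeakDiffAt g y) (v : E) :
    dirDeriv (fun z => f z + g z) y v = dirDeriv f y v + dirDeriv g y v :=
  eq_of_forall_dual_apply_eq fun l => by
    rw [dual_dirDeriv (hf.add hg), map_add, dual_dirDeriv hf, dual_dirDeriv hg]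
    simp only [map_add]
    rw [fderiv_fun_add (hf l) (hg l)]
    rfl

theorem dirDeriv_bilin [FiniteDimensional ℂ F] [FiniteDimensional ℂ G] [FiniteDimensional ℂ H]
    {f : E → F} {g : E → G} {y : E} (b : F →ₗ[ℂ] G →ₗ[ℂ] H) (hf : WeakDiffAt f y)
    (hg : WeakDiffAt g y) (v : E) :
    dirDeriv (fun z => b (f z) (g z)) y v = b (dirDeriv f y v) (g y) + b (f y) (dirDeriv g y v) :=
  eq_of_forall_dual_apply_eq fun l => by
    rw [dual_dirDeriv (hf.bilin b hg), map_add]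
    simp only [dual_apply_bilin_eq_sum b l]
    have hderiv : ∀ k, HasFDerivAt (fun z => (Module.finBasis ℂ F).coord k (f z) *
        (l.comp (b (Module.finBasis ℂ F k))) (g z)) _ y := fun k =>
      (hf ((Module.finBasis ℂ F).coord k)).hasFDerivAt.mul
        (hg (l.comp (b (Module.finBasis ℂ F k)))).hasFDerivAt
    rw [(HasFDerivAt.fun_sum fun k _ => hderiv k).fderiv, sum_apply, ← Finset.sum_add_distrib]
    refine Finset.sum_congr rfl fun k _ => ?_
    rw [dual_dirDeriv hf, dual_dirDeriv hg]
    simp only [add_apply, smul_apply, smul_eq_mul]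
    ring

theorem dirDeriv_add_dir [FiniteDimensional ℂ F] {f : E → F} {y : E}
    (hf : WeakDiffAt f y) (v w : E) :
    dirDeriv f y (v + w) = dirDeriv f y v + dirDeriv f y w :=
  eq_of_forall_dual_apply_eq fun l => by
    rw [map_add, dual_dirDeriv hf, dual_dirDeriv hf, dual_dirDeriv hf, map_add]

theorem dirDeriv_real_smul_dir [FiniteDimensional ℂ F] {f : E → F} {y : E}
    (hf : WeakDiffAt f y) (c : ℝ) (v : E) :
    dirDeriv f y (c • v) = (c : ℂ) • dirDeriv f y v :=
  eq_of_forall_dual_apply_eq fun l => by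
    rw [map_smul, dual_dirDeriv hf, dual_dirDeriv hf, map_smul, Complex.real_smul, smul_eq_mul]

theorem dirDeriv_smul_dir [FiniteDimensional ℂ F] {f : E → F} {y : E} (hf : WeakDiffAt f y)
    (c : ℂ) (v : E) : dirDeriv f y (c • v) =
      (c.re : ℂ) • dirDeriv f y v + (c.im : ℂ) • dirDeriv f y (Complex.I • v) := by
  rw [← dirDeriv_real_smul_dir hf, ← dirDeriv_real_smul_dir hf, ← dirDeriv_add_dir hf]
  congr 1
  conv_lhs => rw [← Complex.re_add_im c, add_smul, mul_smul]
  rfl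

theorem dirDeriv_comp [FiniteDimensional ℂ F] {f : E → F} {g : E → E} {g' : E →L[ℂ] E} {y : E}
    (hf : WeakDiffAt f (g y)) (hg : HasFDerivAt g g' y) (v : E) :
    dirDeriv (fun z => f (g z)) y v = dirDeriv f (g y) (g' v) :=
  eq_of_forall_dual_apply_eq fun l => by
    have hcomp : HasFDerivAt (fun z => l (f (g z))) _ y :=
      (hf l).hasFDerivAt.comp y (hg.restrictScalars ℝ)
    rw [dual_dirDeriv hf, dual_dirDeriv (hf.comp hg), hcomp.fderiv]
    rfl

theorem two_le_infty : (2 : WithTop ℕ∞) ≤ ∞ := WithTop.coe_le_coe.2 (OrderTop.le_top (2 : ℕ∞))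

theorem SmoothOn.dirDeriv [FiniteDimensional ℂ F] {f : E → F} {s : Set E} (hf : SmoothOn f s)
    (hs : IsOpen s) (v : E) : SmoothOn (fun y => dirDeriv f y v) s := fun l => by
  refine ContDiffOn.congr (f := fun y => fderiv ℝ (fun z => l (f z)) y v) ?_
    fun y hy => dual_dirDeriv (hf.weakDiffAt hs hy) v l
  exact ((hf l).fderiv_of_isOpen hs (m := ∞) le_rfl).clm_apply contDiffOn_const

theorem dual_dirDeriv_dirDeriv [FiniteDimensional ℂ F] {f : E → F} {s : Set E}
    (hf : SmoothOn f s) (hs : IsOpen s) {y : E} (hy : y ∈ s) (v w : E) (l : Module.Dual ℂ F) :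
    l (dirDeriv (fun z => dirDeriv f z v) y w) = fderiv ℝ (fderiv ℝ fun z => l (f z)) y w v := by
  have hdiff : DifferentiableAt ℝ (fderiv ℝ fun z => l (f z)) y :=
    (((hf l).contDiffAt (hs.mem_nhds hy)).fderiv_right (m := 1)
      (one_add_one_eq_two.trans_le two_le_infty)).differentiableAt
      one_ne_zero
  have heq : (fun z => l (dirDeriv f z v)) =ᶠ[𝓝 y] fun z => fderiv ℝ (fun z => l (f z)) z v :=
    Filter.eventuallyEq_of_mem (hs.mem_nhds hy) fun z hz =>
      dual_dirDeriv (hf.weakDiffAt hs hz) v l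
  rw [dual_dirDeriv ((hf.dirDeriv hs v).weakDiffAt hs hy), heq.fderiv_eq,
    (hdiff.hasFDerivAt.clm_apply (hasFDerivAt_const v y)).fderiv]
  simp

theorem dirDeriv_dirDeriv_comm [FiniteDimensional ℂ F] {f : E → F} {s : Set E}
    (hf : SmoothOn f s) (hs : IsOpen s) {y : E} (hy : y ∈ s) (v w : E) :
    dirDeriv (fun z => dirDeriv f z v) y w = dirDeriv (fun z => dirDeriv f z w) y v := by
  refine eq_of_forall_dual_apply_eq fun l => ?_
  rw [dual_dirDeriv_dirDeriv hf hs hy, dual_dirDeriv_dirDeriv hf hs hy]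
  refine ((hf l).contDiffAt (hs.mem_nhds hy)).isSymmSndFDerivAt ?_ w v
  rw [minSmoothness_of_isRCLikeNormedField]
  exact two_le_infty

/-- The Wirtinger derivative `(D_v + ε i D_{iv}) / 2`, which is `∂_v` for `ε = -1` and `\bar∂_v`
for `ε = 1`; the parameter treats both at once. -/
def wirtinger (ε : ℂ) (f : E → F) (y v : E) : F :=
  (1 / 2 : ℂ) • (dirDeriv f y v + (ε * Complex.I) • dirDeriv f y (Complex.I • v))

theorem wirt_eq_wirtinger (f : E → F) (y v : E) : wirt f y v = wirtinger (-1) f y v := by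
  simp [wirt, wirtinger, sub_eq_add_neg]

theorem wirtBar_eq_wirtinger (f : E → F) (y v : E) : wirtBar f y v = wirtinger 1 f y v := by
  simp [wirtBar, wirtinger]

theorem wirtinger_congr (ε : ℂ) {f g : E → F} {y : E} (h : f =ᶠ[𝓝 y] g) (v : E) :
    wirtinger ε f y v = wirtinger ε g y v := by
  simp only [wirtinger, dirDeriv_congr h]

theorem wirtinger_map [FiniteDimensional ℂ F] [FiniteDimensional ℂ G] (ε : ℂ) {f : E → F} {y : E}
    (hf : WeakDiffAt f y) (L : F →ₗ[ℂ] G) (v : E) :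
    wirtinger ε (fun z => L (f z)) y v = L (wirtinger ε f y v) := by
  simp only [wirtinger, dirDeriv_map hf, map_smul, map_add]

theorem wirtinger_add [FiniteDimensional ℂ F] (ε : ℂ) {f g : E → F} {y : E}
    (hf : WeakDiffAt f y) (hg : WeakDiffAt g y) (v : E) :
    wirtinger ε (fun z => f z + g z) y v = wirtinger ε f y v + wirtinger ε g y v := by
  simp only [wirtinger, dirDeriv_add hf hg]
  module

theorem wirtinger_const [FiniteDimensional ℂ F] (ε : ℂ) (c : F) (y v : E) :
    wirtinger ε (fun _ => c) y v = 0 := by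
  have dirDeriv_const : ∀ v : E, dirDeriv (fun _ => c) y v = 0 := fun v =>
    eq_of_forall_dual_apply_eq fun l => by simp [dual_dirDeriv (WeakDiffAt.const c y)]
  simp only [wirtinger, dirDeriv_const, smul_zero, add_zero]

theorem wirtinger_sum [FiniteDimensional ℂ F] (ε : ℂ) {κ : Type*} (t : Finset κ) {f : κ → E → F}
    {y : E} (hf : ∀ k ∈ t, WeakDiffAt (f k) y) (v : E) :
    wirtinger ε (fun z => ∑ k ∈ t, f k z) y v = ∑ k ∈ t, wirtinger ε (f k) y v := by
  classical
  induction t using Finset.induction_on with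
  | empty => simpa only [Finset.sum_empty] using wirtinger_const ε (0 : F) y v
  | insert a t ha ih =>
    have hft : ∀ k ∈ t, WeakDiffAt (f k) y := fun k hk => hf k (Finset.mem_insert_of_mem hk)
    simp only [Finset.sum_insert ha]
    rw [wirtinger_add ε (hf a (Finset.mem_insert_self a t)) (WeakDiffAt.sum t hft), ih hft]

theorem wirtinger_bilin [FiniteDimensional ℂ F] [FiniteDimensional ℂ G] [FiniteDimensional ℂ H]
    (ε : ℂ) {f : E → F} {g : E → G} {y : E} (b : F →ₗ[ℂ] G →ₗ[ℂ] H) (hf : WeakDiffAt f y)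
    (hg : WeakDiffAt g y) (v : E) :
    wirtinger ε (fun z => b (f z) (g z)) y v =
      b (wirtinger ε f y v) (g y) + b (f y) (wirtinger ε g y v) := by
  simp only [wirtinger, dirDeriv_bilin b hf hg, map_smul, map_add, LinearMap.smul_apply,
    LinearMap.add_apply]
  module

theorem wirtinger_comp [FiniteDimensional ℂ F] (ε : ℂ) {f : E → F} {g : E → E} {g' : E →L[ℂ] E}
    {y : E} (hf : WeakDiffAt f (g y)) (hg : HasFDerivAt g g' y) (v : E) :
    wirtinger ε (fun z => f (g z)) y v = wirtinger ε f (g y) (g' v) := by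
  simp only [wirtinger, dirDeriv_comp hf hg, map_smul]

theorem SmoothOn.wirtinger [FiniteDimensional ℂ F] (ε : ℂ) {f : E → F} {s : Set E}
    (hf : SmoothOn f s) (hs : IsOpen s) (v : E) : SmoothOn (fun y => wirtinger ε f y v) s :=
  ((hf.dirDeriv hs v).add ((hf.dirDeriv hs (Complex.I • v)).smul (ε * Complex.I))).smul (1 / 2)

theorem dirDeriv_wirtinger [FiniteDimensional ℂ F] (ε : ℂ) {f : E → F} {s : Set E}
    (hf : SmoothOn f s) (hs : IsOpen s) {y : E} (hy : y ∈ s) (v w : E) :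
    dirDeriv (fun z => wirtinger ε f z v) y w = wirtinger ε (fun z => dirDeriv f z w) y v := by
  have hv := (hf.dirDeriv hs v).weakDiffAt hs hy
  have hIv := (hf.dirDeriv hs (Complex.I • v)).weakDiffAt hs hy
  have hεIv := hIv.map (LinearMap.lsmul ℂ F (ε * Complex.I))
  refine (dirDeriv_map (hv.add hεIv) (LinearMap.lsmul ℂ F (1 / 2 : ℂ)) w).trans ?_
  rw [dirDeriv_add hv hεIv, dirDeriv_map hIv, dirDeriv_dirDeriv_comm hf hs hy,
    dirDeriv_dirDeriv_comm hf hs hy (Complex.I • v)]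
  rfl

theorem wirtinger_wirtinger_comm [FiniteDimensional ℂ F] (ε δ : ℂ) {f : E → F} {s : Set E}
    (hf : SmoothOn f s) (hs : IsOpen s) {y : E} (hy : y ∈ s) (v w : E) :
    wirtinger δ (fun z => wirtinger ε f z v) y w =
      wirtinger ε (fun z => wirtinger δ f z w) y v := by
  have hw := (hf.dirDeriv hs w).weakDiffAt hs hy
  have hIw := (hf.dirDeriv hs (Complex.I • w)).weakDiffAt hs hy
  have hδIw := hIw.map (LinearMap.lsmul ℂ F (δ * Complex.I))
  refine .trans ?_
    (wirtinger_map ε (hw.add hδIw) (LinearMap.lsmul ℂ F (1 / 2 : ℂ)) v).symm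
  rw [wirtinger_add ε hw hδIw, wirtinger_map ε hIw, wirtinger, dirDeriv_wirtinger ε hf hs hy,
    dirDeriv_wirtinger ε hf hs hy]
  rfl

theorem wirtinger_add_dir [FiniteDimensional ℂ F] (ε : ℂ) {f : E → F} {y : E}
    (hf : WeakDiffAt f y) (v w : E) :
    wirtinger ε f y (v + w) = wirtinger ε f y v + wirtinger ε f y w := by
  simp only [wirtinger, smul_add Complex.I v w, dirDeriv_add_dir hf]
  module

theorem wirtinger_smul_dir [FiniteDimensional ℂ F] {ε : ℂ} (hε : ε ^ 2 = 1) {f : E → F} {y : E}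
    (hf : WeakDiffAt f y) (c : ℂ) (v : E) :
    wirtinger ε f y (c • v) = (c.re - ε * (c.im * Complex.I)) • wirtinger ε f y v := by
  simp only [wirtinger, smul_smul Complex.I c v]
  rw [dirDeriv_smul_dir hf, dirDeriv_smul_dir hf (Complex.I * c)]
  simp only [Complex.I_mul_re, Complex.I_mul_im]
  match_scalars
  · ring
  · linear_combination (1 / 2 * c.im * ε ^ 2) * Complex.I_sq - 1 / 2 * c.im * hε

section RealLinear

variable {K : Type*} [NormedAddCommGroup K] [NormedSpace ℂ K] [FiniteDimensional ℂ K]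
  {u : E → K} {y : E}

theorem hasFDerivAt_dual_realLinear_comp {u' : E →L[ℝ] K} (hu : HasFDerivAt u u' y)
    (L : K →ₗ[ℝ] F) (l : Module.Dual ℂ F) :
    HasFDerivAt (fun z => l (L (u z)))
      ((LinearMap.toContinuousLinearMap (l.restrictScalars ℝ ∘ₗ L)).comp u') y :=
  (LinearMap.toContinuousLinearMap (l.restrictScalars ℝ ∘ₗ L)).hasFDerivAt.comp y hu

theorem WeakDiffAt.realLinear_comp {u' : E →L[ℝ] K} (hu : HasFDerivAt u u' y) (L : K →ₗ[ℝ] F) :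
    WeakDiffAt (fun z => L (u z)) y := fun l =>
  (hasFDerivAt_dual_realLinear_comp hu L l).differentiableAt

theorem dirDeriv_realLinear_comp [FiniteDimensional ℂ F] {u' : E →L[ℝ] K}
    (hu : HasFDerivAt u u' y) (L : K →ₗ[ℝ] F) (v : E) :
    dirDeriv (fun z => L (u z)) y v = L (u' v) :=
  eq_of_forall_dual_apply_eq fun l => by
    rw [dual_dirDeriv (.realLinear_comp hu L), (hasFDerivAt_dual_realLinear_comp hu L l).fderiv]
    rfl

theorem wirtinger_linear_comp [FiniteDimensional ℂ F] (ε : ℂ) {u' : E →L[ℂ] K}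
    (hu : HasFDerivAt u u' y) (L : K →ₗ[ℂ] F) (v : E) :
    wirtinger ε (fun z => L (u z)) y v = ((1 - ε) / 2) • L (u' v) := by
  have hderiv : ∀ w, dirDeriv (fun z => L (u z)) y w = L (u' w) :=
    dirDeriv_realLinear_comp (hu.restrictScalars ℝ) (L.restrictScalars ℝ)
  rw [wirtinger, hderiv, hderiv, map_smul, map_smul]
  match_scalars
  linear_combination ε / 2 * Complex.I_sq

/-- A conjugate-linear map, regarded as a real linear one. -/
def semilinearRestrictReal (L : K →ₗ⋆[ℂ] F) : K →ₗ[ℝ] F where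
  toFun := L
  map_add' := L.map_add
  map_smul' c x := by
    rw [← Complex.coe_smul, L.map_smulₛₗ, Complex.conj_ofReal, Complex.coe_smul, RingHom.id_apply]

theorem wirtinger_semilinear_comp [FiniteDimensional ℂ F] (ε : ℂ) {u' : E →L[ℂ] K}
    (hu : HasFDerivAt u u' y) (L : K →ₗ⋆[ℂ] F) (v : E) :
    wirtinger ε (fun z => L (u z)) y v = ((1 + ε) / 2) • L (u' v) := by
  have hderiv : ∀ w, dirDeriv (fun z => L (u z)) y w = L (u' w) :=
    dirDeriv_realLinear_comp (hu.restrictScalars ℝ) (semilinearRestrictReal L)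
  rw [wirtinger, hderiv, hderiv, map_smul, L.map_smulₛₗ, Complex.conj_I]
  match_scalars
  linear_combination -ε / 2 * Complex.I_sq

end RealLinear

/-- The map `v ↦ ∂_v f (y)`, which is complex linear. -/
def wirtLinear [FiniteDimensional ℂ F] {f : E → F} {y : E} (hf : WeakDiffAt f y) : E →ₗ[ℂ] F where
  toFun := wirtinger (-1) f y
  map_add' := wirtinger_add_dir (-1) hf
  map_smul' c v := by
    rw [wirtinger_smul_dir (by norm_num) hf, neg_one_mul, sub_neg_eq_add, Complex.re_add_im,
      RingHom.id_apply]

/-- The map `v ↦ \bar∂_v f (y)`, which is conjugate-linear. -/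
def wirtBarSemilinear [FiniteDimensional ℂ F] {f : E → F} {y : E} (hf : WeakDiffAt f y) :
    E →ₗ⋆[ℂ] F where
  toFun := wirtinger 1 f y
  map_add' := wirtinger_add_dir 1 hf
  map_smul' c v := by
    have conj_eq : conj c = c.re - c.im * Complex.I := by apply Complex.ext <;> simp
    rw [wirtinger_smul_dir (one_pow 2) hf, one_mul, conj_eq]

end Calculus

section FirstOrderOperators

open Topology

variable {E : Type*} [NormedAddCommGroup E] [NormedSpace ℂ E]
variable {M N : Type*} [AddCommGroup M] [Module ℂ M] [AddCommGroup N] [Module ℂ N]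
variable {κ : Type*} [Fintype κ]

/-- The first-order operator `∑ c_k ∂_k` with constant coefficients, where `∂_k` is the
Wirtinger derivative of sign `ε k` in the direction `v k`. -/
def wirtOp (ε : κ → ℂ) (v : κ → E) (c : κ → Module.End ℂ M) (f : E → M) (y : E) : M :=
  ∑ k, c k (wirtinger (ε k) f y (v k))

theorem wirtOp_congr (ε : κ → ℂ) (v : κ → E) (c : κ → Module.End ℂ M) {f g : E → M} {y : E}
    (h : f =ᶠ[𝓝 y] g) : wirtOp ε v c f y = wirtOp ε v c g y := by
  simp only [wirtOp, wirtinger_congr _ h]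

theorem wirtOp_add [FiniteDimensional ℂ M] (ε : κ → ℂ) (v : κ → E) (c : κ → Module.End ℂ M)
    {f g : E → M} {y : E} (hf : WeakDiffAt f y) (hg : WeakDiffAt g y) :
    wirtOp ε v c (fun z => f z + g z) y = wirtOp ε v c f y + wirtOp ε v c g y := by
  simp only [wirtOp, wirtinger_add _ hf hg, map_add, Finset.sum_add_distrib]

theorem wirtOp_map [FiniteDimensional ℂ M] [FiniteDimensional ℂ N] (ε : κ → ℂ) (v : κ → E)
    {c : κ → Module.End ℂ M} {c' : κ → Module.End ℂ N} {L L' : M →ₗ[ℂ] N}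
    (hL : ∀ k x, L' (c k x) = c' k (L x)) {f : E → M} {y : E} (hf : WeakDiffAt f y) :
    wirtOp ε v c' (fun z => L (f z)) y = L' (wirtOp ε v c f y) := by
  simp only [wirtOp, wirtinger_map _ hf, map_sum, hL]

theorem SmoothOn.wirtOp [FiniteDimensional ℂ M] (ε : κ → ℂ) (v : κ → E)
    (c : κ → Module.End ℂ M) {f : E → M} {s : Set E} (hf : SmoothOn f s) (hs : IsOpen s) :
    SmoothOn (wirtOp ε v c f) s :=
  SmoothOn.sum _ fun k _ => (hf.wirtinger (ε k) hs (v k)).map (c k)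

theorem sum_sum_eq_zero_of_antisymm {f : κ → κ → M} (h : ∀ j k, f j k = -f k j) :
    ∑ j, ∑ k, f j k = 0 := by
  have eq_neg : ∑ j, ∑ k, f j k = -∑ j, ∑ k, f j k := by
    conv_lhs => rw [Finset.sum_comm]
    simp only [← Finset.sum_neg_distrib]
    exact Finset.sum_congr rfl fun j _ => Finset.sum_congr rfl fun k _ => h k j
  have : IsAddTorsionFree M := .of_isTorsionFree ℂ M
  exact self_eq_neg.1 eq_neg

theorem wirtOp_wirtOp [FiniteDimensional ℂ M] (ε : κ → ℂ) (v : κ → E)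
    {c : κ → Module.End ℂ M} (hc : ∀ j k x, c j (c k x) = -c k (c j x)) {f : E → M} {s : Set E}
    (hf : SmoothOn f s) (hs : IsOpen s) {y : E} (hy : y ∈ s) :
    wirtOp ε v c (wirtOp ε v c f) y = 0 := by
  have hdiff : ∀ k, WeakDiffAt (fun z => wirtinger (ε k) f z (v k)) y := fun k =>
    (hf.wirtinger (ε k) hs (v k)).weakDiffAt hs hy
  have wirtinger_wirtOp : ∀ j, wirtinger (ε j) (wirtOp ε v c f) y (v j) =
      ∑ k, c k (wirtinger (ε j) (fun z => wirtinger (ε k) f z (v k)) y (v j)) := fun j =>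
    (wirtinger_sum (ε j) Finset.univ (fun k _ => (hdiff k).map (c k)) (v j)).trans
      (Finset.sum_congr rfl fun k _ => wirtinger_map (ε j) (hdiff k) (c k) (v j))
  rw [wirtOp]
  simp only [wirtinger_wirtOp, map_sum]
  refine sum_sum_eq_zero_of_antisymm fun j k => ?_
  rw [hc, wirtinger_wirtinger_comm (ε k) (ε j) hf hs hy]

end FirstOrderOperators

section Local

open Topology

variable {E : Type*} [NormedAddCommGroup E] [NormedSpace ℂ E] [FiniteDimensional ℂ E]
variable {R : Type*} [Ring R] [Algebra ℂ R]

/-- Exterior multiplication by `a` on forms with coefficients in `R`. -/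
abbrev wedgeR {V : Type*} [AddCommGroup V] [Module ℂ V] (R : Type*) [Ring R] [Algebra ℂ R]
    (a : FormAlg V) : Module.End ℂ (FormAlg V ⊗[ℂ] R) := (LinearMap.mulLeft ℂ a).rTensor R

variable (E) in
/-- The form `dz_j`. -/
abbrev dz (j : Fin (Module.finrank ℂ E)) : FormAlg E := covForm (coordinate E j)

variable (E) in
/-- The form `d\bar z_j`. -/
abbrev dzBar (j : Fin (Module.finrank ℂ E)) : FormAlg E := conjForm (conjCovector (coordinate E j))

theorem delLoc_eq_wirtOp (f : E → FormAlg E ⊗[ℂ] R) :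
    delLoc f = wirtOp (fun _ => -1) (Module.finBasis ℂ E) (fun j => wedgeR R (dz E j)) f := by
  funext y
  simp only [delLoc, wirtOp, wirt_eq_wirtinger]

theorem delbarLoc_eq_wirtOp (f : E → FormAlg E ⊗[ℂ] R) :
    delbarLoc f = wirtOp (fun _ => 1) (Module.finBasis ℂ E) (fun j => wedgeR R (dzBar E j)) f := by
  funext y
  simp only [delbarLoc, wirtOp, wirtBar_eq_wirtinger]

theorem wedgeR_wedgeR_of_mul_eq_neg {V : Type*} [AddCommGroup V] [Module ℂ V] {a b : FormAlg V}
    (h : a * b = -(b * a)) (x : FormAlg V ⊗[ℂ] R) :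
    wedgeR R a (wedgeR R b x) = -wedgeR R b (wedgeR R a x) := by
  have mulLeft_anticomm : LinearMap.mulLeft ℂ a ∘ₗ LinearMap.mulLeft ℂ b =
      -(LinearMap.mulLeft ℂ b ∘ₗ LinearMap.mulLeft ℂ a) := LinearMap.ext fun c => by
    simp only [LinearMap.comp_apply, LinearMap.neg_apply, LinearMap.mulLeft_apply, ← mul_assoc, h,
      neg_mul]
  rw [← LinearMap.rTensor_comp_apply, mulLeft_anticomm, LinearMap.rTensor_neg,
    LinearMap.neg_apply, LinearMap.rTensor_comp_apply]

theorem delbarLoc_add_delLoc_sq [FiniteDimensional ℂ R] {f : E → FormAlg E ⊗[ℂ] R} {s : Set E}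
    (hf : SmoothOn f s) (hs : IsOpen s) {y : E} (hy : y ∈ s) :
    delbarLoc (fun z => delbarLoc f z + delLoc f z) y +
      delLoc (fun z => delbarLoc f z + delLoc f z) y = 0 := by
  let n := Module.finrank ℂ E
  let ε : Fin n ⊕ Fin n → ℂ := Sum.elim (fun _ => 1) fun _ => -1
  let v : Fin n ⊕ Fin n → E := Sum.elim (Module.finBasis ℂ E) (Module.finBasis ℂ E)
  let a : Fin n ⊕ Fin n → Module.Dual ℂ E × ConjDual E :=
    Sum.elim (fun j => (0, conjCovector (coordinate E j))) fun j => (coordinate E j, 0)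
  have add_eq_wirtOp : ∀ g : E → FormAlg E ⊗[ℂ] R, (fun z => delbarLoc g z + delLoc g z) =
      wirtOp ε v (fun k => wedgeR R (ExteriorAlgebra.ι ℂ (a k))) g := fun g => funext fun z => by
    rw [delbarLoc_eq_wirtOp, delLoc_eq_wirtOp, wirtOp, wirtOp, wirtOp, Fintype.sum_sum_type]
    rfl
  rw [congrFun (add_eq_wirtOp _) y, add_eq_wirtOp]
  exact wirtOp_wirtOp ε v
    (fun j k x => wedgeR_wedgeR_of_mul_eq_neg (ι_mul_ι_eq_neg _ _) x) hf hs hy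

end Local

/-! ### Pullback of forms -/

section Pullback

variable {E : Type*} [NormedAddCommGroup E] [NormedSpace ℂ E]
variable {R : Type*} [Ring R] [Algebra ℂ R]

/-- `A ↦ A^* α`, for a `(1,0)`-covector `α`. -/
def covFormComp (α : Module.Dual ℂ E) : (E →L[ℂ] E) →ₗ[ℂ] FormAlg E where
  toFun A := covForm (α.comp A.toLinearMap)
  map_add' A B := by rw [← map_add, ← LinearMap.comp_add]; rfl
  map_smul' c A := by rw [← map_smul, ← LinearMap.comp_smul]; rfl

/-- `A ↦ A^* β`, for a `(0,1)`-covector `β`; it is conjugate-linear in `A`. -/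
def conjFormComp (β : ConjDual E) : (E →L[ℂ] E) →ₗ⋆[ℂ] FormAlg E where
  toFun A := conjForm (β.comp A.toLinearMap)
  map_add' A B := by
    rw [← map_add]
    exact congrArg conjForm (LinearMap.ext fun v => β.map_add _ _)
  map_smul' c A := by
    rw [← map_smul]
    exact congrArg conjForm (LinearMap.ext fun v => β.map_smulₛₗ _ _)

theorem formPull_ι_eq (m : Module.Dual ℂ E × ConjDual E) (A : E →L[ℂ] E) :
    formPull A.toLinearMap (ExteriorAlgebra.ι ℂ m) = covFormComp m.1 A + conjFormComp m.2 A := by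
  rw [formPull_ι, ι_eq_covForm_add_conjForm]
  rfl

variable [FiniteDimensional ℂ E]

theorem covForm_comp_eq_sum (α : Module.Dual ℂ E) (A : E →ₗ[ℂ] E) :
    covForm (α.comp A) = ∑ k, α (A (Module.finBasis ℂ E k)) • dz E k := by
  conv_lhs => rw [← (Module.finBasis ℂ E).sum_dual_apply_smul_coord (α.comp A)]
  simp only [map_sum, map_smul]
  rfl

theorem conjForm_comp_eq_sum (β : ConjDual E) (A : E →ₗ[ℂ] E) :
    conjForm (β.comp A) = ∑ k, β (A (Module.finBasis ℂ E k)) • dzBar E k := by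
  conv_lhs => rw [← sum_apply_smul_conjCovector (Module.finBasis ℂ E) (β.comp A)]
  simp only [map_sum, map_smul]
  rfl

theorem sum_sum_symm_smul_mul_eq_zero {V κ : Type*} [AddCommGroup V] [Module ℂ V] [Fintype κ]
    {S : κ → κ → ℂ} (hS : ∀ j k, S j k = S k j)
    {d : κ → FormAlg V} (hd : ∀ j k, d j * d k = -(d k * d j)) :
    ∑ j, ∑ k, S j k • (d j * d k) = 0 :=
  sum_sum_eq_zero_of_antisymm fun j k => by rw [hS, hd, smul_neg]

variable {A : E → E →L[ℂ] E} {y : E}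

theorem weakDiffAt_covFormComp {A' : E →L[ℂ] E →L[ℂ] E} (hA : HasFDerivAt A A' y)
    (α : Module.Dual ℂ E) : WeakDiffAt (fun z => covFormComp α (A z)) y :=
  .realLinear_comp (hA.restrictScalars ℝ) ((covFormComp α).restrictScalars ℝ)

theorem weakDiffAt_conjFormComp {A' : E →L[ℂ] E →L[ℂ] E} (hA : HasFDerivAt A A' y)
    (β : ConjDual E) : WeakDiffAt (fun z => conjFormComp β (A z)) y :=
  .realLinear_comp (hA.restrictScalars ℝ) (semilinearRestrictReal (conjFormComp β))

theorem wirtinger_formPull_ι (ε : ℂ) {A' : E →L[ℂ] E →L[ℂ] E} (hA : HasFDerivAt A A' y)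
    (m : Module.Dual ℂ E × ConjDual E) (v : E) :
    wirtinger ε (fun z => formPull (A z).toLinearMap (ExteriorAlgebra.ι ℂ m)) y v =
      ((1 - ε) / 2) • covFormComp m.1 (A' v) + ((1 + ε) / 2) • conjFormComp m.2 (A' v) := by
  simp only [formPull_ι_eq]
  rw [wirtinger_add ε (weakDiffAt_covFormComp hA m.1) (weakDiffAt_conjFormComp hA m.2),
    wirtinger_linear_comp ε hA, wirtinger_semilinear_comp ε hA]

theorem weakDiffAt_formPull_apply {A' : E →L[ℂ] E →L[ℂ] E} (hA : HasFDerivAt A A' y)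
    (x : FormAlg E) : WeakDiffAt (fun z => formPull (A z).toLinearMap x) y := by
  induction x using CliffordAlgebra.left_induction with
  | algebraMap r =>
    simp only [formPull_algebraMap]
    exact .const _ y
  | add x x' hx hx' =>
    simp only [map_add]
    exact hx.add hx'
  | ι_mul x m hx =>
    have hm : WeakDiffAt (fun z => formPull (A z).toLinearMap (ExteriorAlgebra.ι ℂ m)) y := by
      simp only [formPull_ι_eq]
      exact (weakDiffAt_covFormComp hA m.1).add (weakDiffAt_conjFormComp hA m.2)
    simp only [formPull_mul]
    exact hm.bilin (LinearMap.mul ℂ (FormAlg E)) hx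

theorem weakDiffAt_formPull {A' : E →L[ℂ] E →L[ℂ] E} (hA : HasFDerivAt A A' y) :
    WeakDiffAt (fun z => formPull (A z).toLinearMap) y :=
  weakDiffAt_linearMap (weakDiffAt_formPull_apply hA)

theorem sum_mul_wirtinger_formPull_eq_zero {ε : ℂ} {A' : E →L[ℂ] E →L[ℂ] E}
    (hA : HasFDerivAt A A' y) {κ : Type*} [Fintype κ] {v : κ → E}
    {a : κ → Module.Dual ℂ E × ConjDual E}
    (hι : ∀ m, ∑ j, ExteriorAlgebra.ι ℂ (a j) *
      wirtinger ε (fun z => formPull (A z).toLinearMap (ExteriorAlgebra.ι ℂ m)) y (v j) = 0)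
    (x : FormAlg E) :
    ∑ j, ExteriorAlgebra.ι ℂ (a j) *
      wirtinger ε (fun z => formPull (A z).toLinearMap x) y (v j) = 0 := by
  have hdiff := weakDiffAt_formPull_apply hA
  induction x using CliffordAlgebra.left_induction with
  | algebraMap r =>
    simp only [formPull_algebraMap, wirtinger_const, mul_zero, Finset.sum_const_zero]
  | add x x' hx hx' =>
    simp only [map_add, wirtinger_add ε (hdiff x) (hdiff x'), mul_add, Finset.sum_add_distrib, hx,
      hx', add_zero]
  | ι_mul x m hx =>
    have leibniz : ∀ v, wirtinger ε (fun z => formPull (A z).toLinearMap (ExteriorAlgebra.ι ℂ m) *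
        formPull (A z).toLinearMap x) y v = _ := fun v =>
      wirtinger_bilin ε (LinearMap.mul ℂ (FormAlg E)) (hdiff (ExteriorAlgebra.ι ℂ m)) (hdiff x) v
    have ι_mul_formPull_ι : ∀ j, ExteriorAlgebra.ι ℂ (a j) *
        formPull (A y).toLinearMap (ExteriorAlgebra.ι ℂ m) =
          -(formPull (A y).toLinearMap (ExteriorAlgebra.ι ℂ m) * ExteriorAlgebra.ι ℂ (a j)) :=
      fun j => by rw [formPull_ι, ι_mul_ι_eq_neg]
    have formPull_ι_mul : ∀ z, formPull (A z).toLinearMap (CliffordAlgebra.ι 0 m * x) =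
        formPull (A z).toLinearMap (ExteriorAlgebra.ι ℂ m) * formPull (A z).toLinearMap x :=
      fun z => formPull_mul _ _ _
    simp only [formPull_ι_mul, leibniz, LinearMap.mul_apply', mul_add, Finset.sum_add_distrib,
      ← mul_assoc, ι_mul_formPull_ι, neg_mul, Finset.sum_neg_distrib]
    rw [← Finset.sum_mul, hι, zero_mul, zero_add]
    simp only [mul_assoc, ← Finset.mul_sum]
    rw [hx, mul_zero, neg_zero]

theorem sum_dz_mul_wirtinger_formPull {A' : E →L[ℂ] E →L[ℂ] E} (hA : HasFDerivAt A A' y)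
    (hA' : ∀ v w, A' v w = A' w v) (x : FormAlg E) :
    ∑ j, dz E j * wirtinger (-1) (fun z => formPull (A z).toLinearMap x) y
      (Module.finBasis ℂ E j) = 0 := by
  refine sum_mul_wirtinger_formPull_eq_zero hA (fun m => ?_) x
  have hwirt : ∀ v, wirtinger (-1) (fun z => formPull (A z).toLinearMap (ExteriorAlgebra.ι ℂ m))
      y v = ∑ k, m.1 (A' v (Module.finBasis ℂ E k)) • dz E k := fun v =>
    (wirtinger_formPull_ι (-1) hA m v).trans (by norm_num; exact covForm_comp_eq_sum _ _)
  simp only [hwirt, Finset.mul_sum, mul_smul_comm]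
  exact sum_sum_symm_smul_mul_eq_zero (fun j k => by rw [hA']) fun j k => ι_mul_ι_eq_neg _ _

theorem sum_dzBar_mul_wirtinger_formPull {A' : E →L[ℂ] E →L[ℂ] E} (hA : HasFDerivAt A A' y)
    (hA' : ∀ v w, A' v w = A' w v) (x : FormAlg E) :
    ∑ j, dzBar E j * wirtinger 1 (fun z => formPull (A z).toLinearMap x) y
      (Module.finBasis ℂ E j) = 0 := by
  refine sum_mul_wirtinger_formPull_eq_zero hA (fun m => ?_) x
  have hwirt : ∀ v, wirtinger 1 (fun z => formPull (A z).toLinearMap (ExteriorAlgebra.ι ℂ m))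
      y v = ∑ k, m.2 (A' v (Module.finBasis ℂ E k)) • dzBar E k := fun v =>
    (wirtinger_formPull_ι 1 hA m v).trans (by norm_num; exact conjForm_comp_eq_sum _ _)
  simp only [hwirt, Finset.mul_sum, mul_smul_comm]
  exact sum_sum_symm_smul_mul_eq_zero (fun j k => by rw [hA']) fun j k => ι_mul_ι_eq_neg _ _

theorem rTensor_formPull_wedgeR {V W : Type*} [AddCommGroup V] [Module ℂ V] [AddCommGroup W]
    [Module ℂ W] (B : V →ₗ[ℂ] W) (a : FormAlg W) (x : FormAlg W ⊗[ℂ] R) :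
    (formPull B).rTensor R (wedgeR R a x) =
      wedgeR R (formPull B a) ((formPull B).rTensor R x) := by
  rw [← LinearMap.rTensor_comp_apply, ← LinearMap.rTensor_comp_apply]
  exact LinearMap.congr_fun
    (congrArg _ (LinearMap.ext fun b => formPull_mul B a b : formPull B ∘ₗ LinearMap.mulLeft ℂ a =
      LinearMap.mulLeft ℂ (formPull B a) ∘ₗ formPull B)) x

theorem wedgeR_sum_smul {V κ : Type*} [AddCommGroup V] [Module ℂ V] (t : Finset κ) (c : κ → ℂ)
    (d : κ → FormAlg V) (x : FormAlg V ⊗[ℂ] R) :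
    wedgeR R (∑ k ∈ t, c k • d k) x = ∑ k ∈ t, c k • wedgeR R (d k) x := by
  let wedge := (LinearMap.rTensorHom R).comp (LinearMap.mul ℂ (FormAlg V))
  have hwedge : wedge (∑ k ∈ t, c k • d k) = ∑ k ∈ t, c k • wedge (d k) := by
    simp only [map_sum, map_smul]
  have := LinearMap.congr_fun hwedge x
  simp only [LinearMap.sum_apply, LinearMap.smul_apply] at this
  exact this

theorem sum_wedgeR_rTensor_eq_zero {V κ : Type*} [AddCommGroup V] [Module ℂ V] [Fintype κ]
    {d : κ → FormAlg V} {Q : κ → Module.End ℂ (FormAlg V)} (hQ : ∀ x, ∑ j, d j * Q j x = 0)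
    (x : FormAlg V ⊗[ℂ] R) : ∑ j, wedgeR R (d j) ((Q j).rTensor R x) = 0 := by
  induction x with
  | zero => simp only [map_zero, Finset.sum_const_zero]
  | add x x' hx hx' => simp only [map_add, Finset.sum_add_distrib, hx, hx', add_zero]
  | tmul m t =>
    simp only [LinearMap.rTensor_tmul, LinearMap.mulLeft_apply, ← TensorProduct.sum_tmul, hQ,
      TensorProduct.zero_tmul]

variable [FiniteDimensional ℂ R] {F : E → FormAlg E ⊗[ℂ] R} {g : E → E}

theorem wirtOp_formPull {ε : ℂ} {A' : E →L[ℂ] E →L[ℂ] E} (hA : HasFDerivAt A A' y)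
    (hg : HasFDerivAt g (A y) y) (hF : WeakDiffAt F (g y))
    {κ : Type*} [Fintype κ] {b : κ → E} {d : κ → FormAlg E}
    (hclosed : ∀ x, ∑ j, d j * wirtinger ε (fun z => formPull (A z).toLinearMap x) y (b j) = 0)
    {a : κ → κ → ℂ}
    (hdir : ∀ k, wirtinger ε F (g y) (A y (b k)) = ∑ j, a j k • wirtinger ε F (g y) (b j))
    (hd : ∀ j, formPull (A y).toLinearMap (d j) = ∑ k, a j k • d k) :
    wirtOp (fun _ => ε) b (fun j => wedgeR R (d j))
      (fun z => (formPull (A z).toLinearMap).rTensor R (F (g z))) y =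
    (formPull (A y).toLinearMap).rTensor R
      (wirtOp (fun _ => ε) b (fun j => wedgeR R (d j)) F (g y)) := by
  have hP := weakDiffAt_formPull hA
  have leibniz := fun v => wirtinger_bilin ε (LinearMap.rTensorHom R) hP (hF.comp hg) v
  simp only [LinearMap.coe_rTensorHom] at leibniz
  have hclosed' : ∑ j, wedgeR R (d j) ((wirtinger ε (fun z => formPull (A z).toLinearMap) y
      (b j)).rTensor R (F (g y))) = 0 :=
    sum_wedgeR_rTensor_eq_zero (fun x => .trans (Finset.sum_congr rfl fun j _ =>
      congrArg (d j * ·) (wirtinger_map ε hP (LinearMap.applyₗ x) _).symm) (hclosed x)) _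
  have formPull_wedgeR : ∀ j x, (formPull (A y).toLinearMap).rTensor R (wedgeR R (d j) x) =
      ∑ k, a j k • wedgeR R (d k) ((formPull (A y).toLinearMap).rTensor R x) := fun j x => by
    rw [rTensor_formPull_wedgeR, hd, wedgeR_sum_smul]
  simp only [wirtOp, leibniz, wirtinger_comp ε hF hg, map_add,
    Finset.sum_add_distrib, hclosed', zero_add, hdir, map_sum, map_smul, formPull_wedgeR]
  exact Finset.sum_comm

theorem delLoc_formPull (hg : ContDiffAt ℂ ω g y) (hF : WeakDiffAt F (g y)) :
    delLoc (fun z => (formPull (fderiv ℂ g z).toLinearMap).rTensor R (F (g z))) y =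
      (formPull (fderiv ℂ g y).toLinearMap).rTensor R (delLoc F (g y)) := by
  have hA : HasFDerivAt (fderiv ℂ g) (fderiv ℂ (fderiv ℂ g) y) y :=
    ((hg.fderiv_right (m := ω) le_top).differentiableAt (by simp)).hasFDerivAt
  rw [delLoc_eq_wirtOp, delLoc_eq_wirtOp]
  refine wirtOp_formPull hA (hg.differentiableAt (by simp)).hasFDerivAt hF
    (sum_dz_mul_wirtinger_formPull hA hg.isSymmSndFDerivAt_of_omega)
    (a := fun j k => coordinate E j (fderiv ℂ g y (Module.finBasis ℂ E k))) (fun k => ?_)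
    fun j => ?_
  · change wirtLinear hF _ = ∑ j, _ • wirtLinear hF _
    conv_lhs => rw [← (Module.finBasis ℂ E).sum_repr (fderiv ℂ g y (Module.finBasis ℂ E k))]
    simp only [map_sum, map_smul]
    rfl
  · rw [formPull_covForm, covForm_comp_eq_sum]
    rfl

theorem delbarLoc_formPull (hg : ContDiffAt ℂ ω g y) (hF : WeakDiffAt F (g y)) :
    delbarLoc (fun z => (formPull (fderiv ℂ g z).toLinearMap).rTensor R (F (g z))) y =
      (formPull (fderiv ℂ g y).toLinearMap).rTensor R (delbarLoc F (g y)) := by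
  have hA : HasFDerivAt (fderiv ℂ g) (fderiv ℂ (fderiv ℂ g) y) y :=
    ((hg.fderiv_right (m := ω) le_top).differentiableAt (by simp)).hasFDerivAt
  rw [delbarLoc_eq_wirtOp, delbarLoc_eq_wirtOp]
  refine wirtOp_formPull hA (hg.differentiableAt (by simp)).hasFDerivAt hF
    (sum_dzBar_mul_wirtinger_formPull hA hg.isSymmSndFDerivAt_of_omega)
    (a := fun j k => conj (coordinate E j (fderiv ℂ g y (Module.finBasis ℂ E k)))) (fun k => ?_)
    fun j => ?_
  · change wirtBarSemilinear hF _ = ∑ j, _ • wirtBarSemilinear hF _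
    conv_lhs => rw [← (Module.finBasis ℂ E).sum_repr (fderiv ℂ g y (Module.finBasis ℂ E k))]
    simp only [map_sum, LinearMap.map_smulₛₗ]
    rfl
  · rw [formPull_conjForm, conjForm_comp_eq_sum]
    rfl

end Pullback

/-! ### Commutators with the contraction, locally -/

section LocalContraction

open Topology

variable {E : Type*} [NormedAddCommGroup E] [NormedSpace ℂ E] [FiniteDimensional ℂ E]
variable {R : Type*} [Ring R] [Algebra ℂ R]
variable {𝒜 : ℤ → Submodule ℂ R} [GradedAlgebra 𝒜]
variable {γ : E → PolyAlg E ⊗[ℂ] R} {φ : E → FormAlg E ⊗[ℂ] R} {y : E}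

theorem dz_contractR_comm {g : PolyAlg E ⊗[ℂ] R} (hg : polyParity 𝒜 g = g)
    (j : Fin (Module.finrank ℂ E)) (x : FormAlg E ⊗[ℂ] R) :
    wedgeR R (dz E j) (contractR 𝒜 g x) = contractR 𝒜 g (wedgeR R (dz E j) x) +
      contractR 𝒜 ((thetaDeriv (coordinate E j)).rTensor R g) x := by
  rw [← mulLeft_covForm_contractR, hg, LinearMap.sub_apply, Module.End.mul_apply,
    Module.End.mul_apply, add_sub_cancel]

theorem dzBar_contractR_comm [IsGradedArtin 𝒜] {g : PolyAlg E ⊗[ℂ] R}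
    (hg : polyParity 𝒜 g = g) (j : Fin (Module.finrank ℂ E)) (x : FormAlg E ⊗[ℂ] R) :
    wedgeR R (dzBar E j) (contractR 𝒜 g x) = contractR 𝒜 g (wedgeR R (dzBar E j) x) := by
  rw [wedgeR, ← contraction_conjPoly, ← contractR_tmul_one 𝒜]
  exact (LinearMap.congr_fun (contractR_comm hg _) x).symm

theorem contractR_mulLeft_conjPoly [IsGradedArtin 𝒜] {V : Type*} [AddCommGroup V] [Module ℂ V]
    (β : ConjDual V) (g : PolyAlg V ⊗[ℂ] R) (x : FormAlg V ⊗[ℂ] R) :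
    contractR 𝒜 ((LinearMap.mulLeft ℂ (conjPoly β)).rTensor R g) x =
      wedgeR R (conjForm β) (contractR 𝒜 g x) := by
  rw [← polyMul_tmul_one 𝒜, contractR_polyMul, contractR_tmul_one, contraction_conjPoly]
  rfl

theorem wirtinger_contractR [FiniteDimensional ℂ R] (ε : ℂ) (hγ : WeakDiffAt γ y)
    (hφ : WeakDiffAt φ y) (v : E) :
    wirtinger ε (fun z => contractR 𝒜 (γ z) (φ z)) y v =
      contractR 𝒜 (wirtinger ε γ y v) (φ y) + contractR 𝒜 (γ y) (wirtinger ε φ y v) :=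
  wirtinger_bilin ε (contractR 𝒜) hγ hφ v

theorem delbarLoc_contractR [FiniteDimensional ℂ R] [IsGradedArtin 𝒜] (hγ : WeakDiffAt γ y)
    (hφ : WeakDiffAt φ y) (hpar : polyParity 𝒜 (γ y) = γ y) :
    delbarLoc (fun z => contractR 𝒜 (γ z) (φ z)) y =
      contractR 𝒜 (γ y) (delbarLoc φ y) + contractR 𝒜 (polyDelbarLoc γ y) (φ y) := by
  simp only [delbarLoc_eq_wirtOp, wirtOp, polyDelbarLoc, wirtBar_eq_wirtinger,
    wirtinger_contractR 1 hγ hφ, map_add, map_sum, LinearMap.sum_apply,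
    contractR_mulLeft_conjPoly, dzBar_contractR_comm hpar, Finset.sum_add_distrib]
  exact add_comm _ _

theorem delLoc_contractR [FiniteDimensional ℂ R] (hγ : WeakDiffAt γ y) (hφ : WeakDiffAt φ y)
    (hpar : polyParity 𝒜 (γ y) = γ y) :
    delLoc (fun z => contractR 𝒜 (γ z) (φ z)) y = contractR 𝒜 (γ y) (delLoc φ y) +
      ∑ j, (wedgeR R (dz E j) (contractR 𝒜 (wirt γ y (Module.finBasis ℂ E j)) (φ y)) +
        contractR 𝒜 ((thetaDeriv (coordinate E j)).rTensor R (γ y))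
          (wirt φ y (Module.finBasis ℂ E j))) := by
  simp only [delLoc_eq_wirtOp, wirtOp, wirt_eq_wirtinger, wirtinger_contractR (-1) hγ hφ, map_add,
    map_sum, dz_contractR_comm hpar, Finset.sum_add_distrib]
  abel

theorem contractR_schoutenLoc_self [IsGradedArtin 𝒜]
    (hpar : ∀ v, polyParity 𝒜 (wirt γ y v) = wirt γ y v) (x : FormAlg E ⊗[ℂ] R) :
    contractR 𝒜 (schoutenLoc 𝒜 γ γ y) x =
      ∑ j, (2 : ℂ) • contractR 𝒜 ((thetaDeriv (coordinate E j)).rTensor R (γ y))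
        (contractR 𝒜 (wirt γ y (Module.finBasis ℂ E j)) x) := by
  simp only [schoutenLoc, hpar, polyMul_comm_of_polyParity_eq_self (hpar _), map_sum, map_add,
    LinearMap.sum_apply, LinearMap.add_apply, contractR_polyMul, Module.End.mul_apply, two_smul]

theorem polyParity_wirt [FiniteDimensional ℂ R] (hγ : WeakDiffAt γ y)
    (hpar : ∀ᶠ z in 𝓝 y, polyParity 𝒜 (γ z) = γ z) (v : E) :
    polyParity 𝒜 (wirt γ y v) = wirt γ y v := by
  rw [wirt_eq_wirtinger, ← wirtinger_map (-1) hγ, wirtinger_congr (-1) hpar]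

theorem delLoc_contractR_contractR [FiniteDimensional ℂ R] [IsGradedArtin 𝒜]
    (hγ : WeakDiffAt γ y) (hφ : WeakDiffAt φ y) (hpar : ∀ᶠ z in 𝓝 y, polyParity 𝒜 (γ z) = γ z) :
    delLoc (fun z => contractR 𝒜 (γ z) (contractR 𝒜 (γ z) (φ z))) y =
      (2 : ℂ) • contractR 𝒜 (γ y) (delLoc (fun z => contractR 𝒜 (γ z) (φ z)) y) -
      contractR 𝒜 (γ y) (contractR 𝒜 (γ y) (delLoc φ y)) +
      contractR 𝒜 (schoutenLoc 𝒜 γ γ y) (φ y) := by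
  have hpary := hpar.self_of_nhds
  have hγφ : WeakDiffAt (fun z => contractR 𝒜 (γ z) (φ z)) y := hγ.bilin (contractR 𝒜) hφ
  have wirt_contractR : ∀ v, wirt (fun z => contractR 𝒜 (γ z) (φ z)) y v =
      contractR 𝒜 (wirt γ y v) (φ y) + contractR 𝒜 (γ y) (wirt φ y v) := fun v => by
    simp only [wirt_eq_wirtinger, wirtinger_contractR (-1) hγ hφ]
  have contractR_comm_apply : ∀ g x,
      contractR 𝒜 g (contractR 𝒜 (γ y) x) = contractR 𝒜 (γ y) (contractR 𝒜 g x) := fun g x =>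
    (LinearMap.congr_fun (contractR_comm hpary g) x).symm
  rw [contractR_schoutenLoc_self (polyParity_wirt hγ hpar), delLoc_contractR hγ hγφ hpary,
    delLoc_contractR hγ hφ hpary]
  simp only [wirt_contractR, map_add, map_sum, contractR_comm_apply (wirt γ y _),
    contractR_comm_apply ((thetaDeriv _).rTensor R (γ y)) (wirt φ y _),
    dz_contractR_comm hpary, Finset.sum_add_distrib, ← Finset.smul_sum]
  module

end LocalContraction

/-! ### Charts -/

section Charts

open Topology

variable {E : Type*} [NormedAddCommGroup E] [NormedSpace ℂ E]
variable {X : Type*} [TopologicalSpace X] [ChartedSpace E X] [IsManifold 𝓘(ℂ, E) ω X]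

theorem dChart_comp_dChartSymm_eq_fderiv {e e' : OpenPartialHomeomorph X E} (he : e ∈ atlas E X)
    (he' : e' ∈ atlas E X) {y : E} (hy : y ∈ e.target) (hy' : e.symm y ∈ e'.source) :
    (dChart e' (e.symm y)).comp (dChartSymm e y) =
      (fderiv ℂ (fun z => e' (e.symm z)) y).toLinearMap := by
  have chain_rule := mfderiv_comp (I := 𝓘(ℂ, E)) (I' := 𝓘(ℂ, E)) (I'' := 𝓘(ℂ, E)) y
    (mdifferentiableAt_atlas he' hy') (mdifferentiableAt_atlas_symm he hy)
  rw [mfderiv_eq_fderiv] at chain_rule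
  exact LinearMap.ext fun v => (congrArg (fun T : E →L[ℂ] E => T v) chain_rule).symm

theorem dChart_comp_dChartSymm {e : OpenPartialHomeomorph X E} (he : e ∈ atlas E X) {y : E}
    (hy : y ∈ e.target) : (dChart e (e.symm y)).comp (dChartSymm e y) = LinearMap.id := by
  rw [dChart_comp_dChartSymm_eq_fderiv he he hy (e.map_target hy)]
  have right_inv : (fun z => e (e.symm z)) =ᶠ[𝓝 y] id :=
    Filter.eventuallyEq_of_mem (e.open_target.mem_nhds hy) fun z hz => e.right_inv hz
  rw [right_inv.fderiv_eq, fderiv_id]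
  rfl

theorem contDiffAt_transition {e e' : OpenPartialHomeomorph X E} (he : e ∈ atlas E X)
    (he' : e' ∈ atlas E X) {y : E} (hy : y ∈ e.target) (hy' : e.symm y ∈ e'.source) :
    ContDiffAt ℂ ω (fun z => e' (e.symm z)) y := by
  rw [← contMDiffAt_iff_contDiffAt]
  exact ContMDiffAt.comp y
    (contMDiffAt_of_mem_maximalAtlas (IsManifold.subset_maximalAtlas he') hy')
    (contMDiffAt_symm_of_mem_maximalAtlas (IsManifold.subset_maximalAtlas he) hy)

theorem dChartSymm_comp_dChart [FiniteDimensional ℂ E] {e : OpenPartialHomeomorph X E}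
    (he : e ∈ atlas E X) {y : E} (hy : y ∈ e.target) :
    (dChartSymm e y).comp (dChart e (e.symm y)) = LinearMap.id := by
  let A : E →ₗ[ℂ] E := dChart e (e.symm y)
  let B : E →ₗ[ℂ] E := dChartSymm e y
  have mul_eq_one : A * B = 1 := dChart_comp_dChartSymm he hy
  exact (mul_eq_one_comm.1 mul_eq_one : B * A = 1)

end Charts

section FormsInCharts

open Topology

universe u

variable {E : Type u} [NormedAddCommGroup E] [NormedSpace ℂ E]
variable {X : Type*} [TopologicalSpace X] [ChartedSpace E X]
variable {R R' : Type*} [Ring R] [Algebra ℂ R] [Ring R'] [Algebra ℂ R']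

theorem rTensor_formPull_comp {V W U : Type*} [AddCommGroup V] [Module ℂ V] [AddCommGroup W]
    [Module ℂ W] [AddCommGroup U] [Module ℂ U] (A : V →ₗ[ℂ] W) (B : W →ₗ[ℂ] U)
    (x : FormAlg U ⊗[ℂ] R) :
    (formPull A).rTensor R ((formPull B).rTensor R x) = (formPull (B.comp A)).rTensor R x := by
  rw [← formPull_comp, LinearMap.rTensor_comp_apply]

theorem FormSec.inChart_add (φ ψ : FormSec E X R) (e : OpenPartialHomeomorph X E) (y : E) :
    (φ + ψ).inChart e y = φ.inChart e y + ψ.inChart e y := by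
  simp only [FormSec.inChart, Pi.add_apply, map_add]

theorem FormSec.inChart_sub (φ ψ : FormSec E X R) (e : OpenPartialHomeomorph X E) (y : E) :
    (φ - ψ).inChart e y = φ.inChart e y - ψ.inChart e y := by
  simp only [FormSec.inChart, Pi.sub_apply, map_sub]

theorem FormSec.inChart_smul (c : ℂ) (φ : FormSec E X R) (e : OpenPartialHomeomorph X E) (y : E) :
    (c • φ).inChart e y = c • φ.inChart e y := by
  simp only [FormSec.inChart, Pi.smul_apply, LinearMap.map_smul]

theorem FormSec.inChart_zero (e : OpenPartialHomeomorph X E) (y : E) :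
    (0 : FormSec E X R).inChart e y = 0 := map_zero _

theorem FormSec.IsSmooth.weakDiffAt {φ : FormSec E X R} (hφ : φ.IsSmooth)
    {e : OpenPartialHomeomorph X E} (he : e ∈ atlas E X) {y : E} (hy : y ∈ e.target) :
    WeakDiffAt (φ.inChart e) y := (hφ e he).weakDiffAt e.open_target hy

/-- A family of linear maps of forms, one for each vector space, that commutes with pull-backs. -/
def FibreNatural (L : ∀ (V : Type u) [AddCommGroup V] [Module ℂ V],
    FormAlg V ⊗[ℂ] R →ₗ[ℂ] FormAlg V ⊗[ℂ] R') : Prop :=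
  ∀ (V W : Type u) [AddCommGroup V] [Module ℂ V] [AddCommGroup W] [Module ℂ W] (A : V →ₗ[ℂ] W)
    (x : FormAlg W ⊗[ℂ] R), L V ((formPull A).rTensor R x) = (formPull A).rTensor R' (L W x)

/-- The fibrewise action on sections of a family of linear maps of forms. -/
def FormSec.mapFibre (L : ∀ (V : Type u) [AddCommGroup V] [Module ℂ V],
    FormAlg V ⊗[ℂ] R →ₗ[ℂ] FormAlg V ⊗[ℂ] R') (φ : FormSec E X R) : FormSec E X R' :=
  fun x => L (TangentSpace 𝓘(ℂ, E) x) (φ x)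

variable {L L' : ∀ (V : Type u) [AddCommGroup V] [Module ℂ V],
    FormAlg V ⊗[ℂ] R →ₗ[ℂ] FormAlg V ⊗[ℂ] R'}

theorem FormSec.inChart_mapFibre (hL : FibreNatural L) (φ : FormSec E X R)
    (e : OpenPartialHomeomorph X E) :
    (φ.mapFibre L).inChart e = fun y => L E (φ.inChart e y) := by
  funext y
  exact (hL _ _ _ _).symm

theorem FormSec.IsSmooth.mapFibre (hL : FibreNatural L) {φ : FormSec E X R} (hφ : φ.IsSmooth) :
    (φ.mapFibre L).IsSmooth := fun e he => by
  rw [FormSec.inChart_mapFibre hL]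
  exact (hφ e he).map _

theorem fibreNatural_smul (c : ℂ) : FibreNatural fun (V : Type u) [AddCommGroup V] [Module ℂ V] =>
    c • (LinearMap.id : FormAlg V ⊗[ℂ] R →ₗ[ℂ] FormAlg V ⊗[ℂ] R) :=
  fun _ _ _ _ _ _ A x => (((formPull A).rTensor R).map_smul c x).symm

variable [FiniteDimensional ℂ E]

variable (R) in
/-- The operator `∑ d_j ∧ ∂_j` on forms in a coordinate domain, where `∂_j` is the Wirtinger
derivative of sign `ε`: it is `∂` for `ε = -1`, `d_j = dz_j` and `\bar∂` for `ε = 1`,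
`d_j = d\bar z_j`. -/
abbrev formOpLoc (ε : ℂ) (d : Fin (Module.finrank ℂ E) → FormAlg E) (f : E → FormAlg E ⊗[ℂ] R) :
    E → FormAlg E ⊗[ℂ] R :=
  wirtOp (fun _ => ε) (Module.finBasis ℂ E) (fun j => wedgeR R (d j)) f

/-- The operator on sections that `formOpLoc` defines in the preferred charts. -/
def formOp (ε : ℂ) (d : Fin (Module.finrank ℂ E) → FormAlg E) (φ : FormSec E X R) :
    FormSec E X R := fun x =>
  (formPull (dChart (chartAt E x) x)).rTensor R
    (formOpLoc R ε d (φ.inChart (chartAt E x)) (chartAt E x x))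

theorem del_eq_formOp (φ : FormSec E X R) : del φ = formOp (-1) (dz E) φ := by
  funext x
  rw [del, delLoc_eq_wirtOp]
  rfl

theorem delbar_eq_formOp (φ : FormSec E X R) : delbar φ = formOp 1 (dzBar E) φ := by
  funext x
  rw [delbar, delbarLoc_eq_wirtOp]
  rfl

theorem delLoc_congr {f g : E → FormAlg E ⊗[ℂ] R} {y : E} (h : f =ᶠ[𝓝 y] g) :
    delLoc f y = delLoc g y := by
  rw [delLoc_eq_wirtOp, delLoc_eq_wirtOp, wirtOp_congr _ _ _ h]

theorem delbarLoc_congr {f g : E → FormAlg E ⊗[ℂ] R} {y : E} (h : f =ᶠ[𝓝 y] g) :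
    delbarLoc f y = delbarLoc g y := by
  rw [delbarLoc_eq_wirtOp, delbarLoc_eq_wirtOp, wirtOp_congr _ _ _ h]

theorem formOp_add [FiniteDimensional ℂ R] (ε : ℂ) (d : Fin (Module.finrank ℂ E) → FormAlg E)
    {φ ψ : FormSec E X R} (hφ : φ.IsSmooth) (hψ : ψ.IsSmooth) :
    formOp ε d (φ + ψ) = formOp ε d φ + formOp ε d ψ := by
  funext x
  have he := chart_mem_atlas E x
  have hy := (chartAt E x).map_source (mem_chart_source E x)
  rw [formOp, funext (φ.inChart_add ψ (chartAt E x)), formOpLoc,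
    wirtOp_add _ _ _ (hφ.weakDiffAt he hy) (hψ.weakDiffAt he hy), map_add]
  rfl

theorem formOp_mapFibre [FiniteDimensional ℂ R] [FiniteDimensional ℂ R'] {ε : ℂ}
    {d : Fin (Module.finrank ℂ E) → FormAlg E} (hL : FibreNatural L) (hL' : FibreNatural L')
    (h_wedge : ∀ j x, L' E (wedgeR R (d j) x) = wedgeR R' (d j) (L E x)) {φ : FormSec E X R}
    (hφ : φ.IsSmooth) : formOp ε d (φ.mapFibre L) = (formOp ε d φ).mapFibre L' := by
  funext x
  have hφx := hφ.weakDiffAt (chart_mem_atlas E x)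
    ((chartAt E x).map_source (mem_chart_source E x))
  rw [formOp, FormSec.inChart_mapFibre hL, formOpLoc, wirtOp_map (L' := L' E) _ _ h_wedge hφx,
    ← hL']
  rfl

theorem formOp_smul [FiniteDimensional ℂ R] (ε : ℂ) (d : Fin (Module.finrank ℂ E) → FormAlg E)
    (c : ℂ) {φ : FormSec E X R} (hφ : φ.IsSmooth) : formOp ε d (c • φ) = c • formOp ε d φ :=
  formOp_mapFibre (fibreNatural_smul c) (fibreNatural_smul c)
    (fun j x => ((wedgeR R (d j)).map_smul c x).symm) hφ

theorem del_add [FiniteDimensional ℂ R] {φ ψ : FormSec E X R} (hφ : φ.IsSmooth)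
    (hψ : ψ.IsSmooth) : del (φ + ψ) = del φ + del ψ := by
  simp only [del_eq_formOp]
  exact formOp_add _ _ hφ hψ

theorem delbar_add [FiniteDimensional ℂ R] {φ ψ : FormSec E X R} (hφ : φ.IsSmooth)
    (hψ : ψ.IsSmooth) : delbar (φ + ψ) = delbar φ + delbar ψ := by
  simp only [delbar_eq_formOp]
  exact formOp_add _ _ hφ hψ

theorem del_smul [FiniteDimensional ℂ R] (c : ℂ) {φ : FormSec E X R} (hφ : φ.IsSmooth) :
    del (c • φ) = c • del φ := by
  simp only [del_eq_formOp]
  exact formOp_smul _ _ c hφ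

theorem delbar_smul [FiniteDimensional ℂ R] (c : ℂ) {φ : FormSec E X R} (hφ : φ.IsSmooth) :
    delbar (c • φ) = c • delbar φ := by
  simp only [delbar_eq_formOp]
  exact formOp_smul _ _ c hφ

variable (R) in
/-- The operator `formOpLoc R ε d` commutes with pull-backs by holomorphic maps, so that it does
not depend on the coordinates. -/
def IsPullbackInvariant (ε : ℂ) (d : Fin (Module.finrank ℂ E) → FormAlg E) : Prop :=
  ∀ ⦃g : E → E⦄ ⦃y : E⦄, ContDiffAt ℂ ω g y → ∀ ⦃F : E → FormAlg E ⊗[ℂ] R⦄, WeakDiffAt F (g y) →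
    formOpLoc R ε d (fun z => (formPull (fderiv ℂ g z).toLinearMap).rTensor R (F (g z))) y =
      (formPull (fderiv ℂ g y).toLinearMap).rTensor R (formOpLoc R ε d F (g y))

theorem isPullbackInvariant_dz [FiniteDimensional ℂ R] :
    IsPullbackInvariant R (-1) (dz E) := fun g y hg F hF => by
  simpa only [delLoc_eq_wirtOp] using delLoc_formPull hg hF

theorem isPullbackInvariant_dzBar [FiniteDimensional ℂ R] :
    IsPullbackInvariant R 1 (dzBar E) := fun g y hg F hF => by
  simpa only [delbarLoc_eq_wirtOp] using delbarLoc_formPull hg hF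

variable [IsManifold 𝓘(ℂ, E) ω X]

theorem FormSec.pull_inChart {e : OpenPartialHomeomorph X E} (he : e ∈ atlas E X)
    (φ : FormSec E X R) {y : E} (hy : y ∈ e.target) {x : X} (hx : e.symm y = x) :
    (formPull (dChart e x)).rTensor R (φ.inChart e y) = φ x := by
  subst hx
  rw [FormSec.inChart, rTensor_formPull_comp, dChartSymm_comp_dChart he hy, formPull_id,
    LinearMap.rTensor_id]
  rfl

theorem FormSec.ext_inChart {φ ψ : FormSec E X R}
    (h : ∀ e ∈ atlas E X, ∀ y ∈ e.target, φ.inChart e y = ψ.inChart e y) : φ = ψ := by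
  funext x
  have he := chart_mem_atlas E x
  have hy := (chartAt E x).map_source (mem_chart_source E x)
  have hx := (chartAt E x).left_inv (mem_chart_source E x)
  rw [← FormSec.pull_inChart he φ hy hx, ← FormSec.pull_inChart he ψ hy hx, h _ he _ hy]

theorem FormSec.inChart_transition {e e' : OpenPartialHomeomorph X E} (he : e ∈ atlas E X)
    (he' : e' ∈ atlas E X) (φ : FormSec E X R) {y : E} (hy : y ∈ e.target)
    (hy' : e.symm y ∈ e'.source) : φ.inChart e y =
      (formPull (fderiv ℂ (fun z => e' (e.symm z)) y).toLinearMap).rTensor R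
        (φ.inChart e' (e' (e.symm y))) := by
  rw [← dChart_comp_dChartSymm_eq_fderiv he he' hy hy', ← rTensor_formPull_comp,
    FormSec.pull_inChart he' φ (e'.map_source hy') (e'.left_inv hy')]
  rfl

theorem inChart_formOp {ε : ℂ} {d : Fin (Module.finrank ℂ E) → FormAlg E}
    (hinv : IsPullbackInvariant R ε d) {φ : FormSec E X R} (hφ : φ.IsSmooth)
    {e : OpenPartialHomeomorph X E} (he : e ∈ atlas E X) {y : E} (hy : y ∈ e.target) :
    (formOp ε d φ).inChart e y = formOpLoc R ε d (φ.inChart e) y := by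
  have he' := chart_mem_atlas E (e.symm y)
  have hy' := mem_chart_source E (e.symm y)
  have inChart_eq : φ.inChart e =ᶠ[𝓝 y] fun z =>
      (formPull (fderiv ℂ (fun z => chartAt E (e.symm y) (e.symm z)) z).toLinearMap).rTensor R
        (φ.inChart (chartAt E (e.symm y)) (chartAt E (e.symm y) (e.symm z))) := by
    have mem_source : ∀ᶠ z in 𝓝 y, e.symm z ∈ (chartAt E (e.symm y)).source :=
      (e.continuousAt_symm hy).eventually ((chartAt E (e.symm y)).open_source.mem_nhds hy')
    filter_upwards [mem_source, e.open_target.mem_nhds hy] with z hz hz'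
    exact φ.inChart_transition he he' hz' hz
  rw [formOpLoc, wirtOp_congr _ _ _ inChart_eq, ← formOpLoc,
    hinv (contDiffAt_transition he he' hy hy')
      (hφ.weakDiffAt he' ((chartAt E (e.symm y)).map_source hy')), FormSec.inChart, formOp,
    rTensor_formPull_comp, dChart_comp_dChartSymm_eq_fderiv he he' hy hy']

theorem inChart_del [FiniteDimensional ℂ R] {φ : FormSec E X R} (hφ : φ.IsSmooth)
    {e : OpenPartialHomeomorph X E} (he : e ∈ atlas E X) {y : E} (hy : y ∈ e.target) :
    (del φ).inChart e y = delLoc (φ.inChart e) y := by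
  rw [del_eq_formOp, inChart_formOp isPullbackInvariant_dz hφ he hy, delLoc_eq_wirtOp]

theorem inChart_delbar [FiniteDimensional ℂ R] {φ : FormSec E X R} (hφ : φ.IsSmooth)
    {e : OpenPartialHomeomorph X E} (he : e ∈ atlas E X) {y : E} (hy : y ∈ e.target) :
    (delbar φ).inChart e y = delbarLoc (φ.inChart e) y := by
  rw [delbar_eq_formOp, inChart_formOp isPullbackInvariant_dzBar hφ he hy, delbarLoc_eq_wirtOp]

theorem FormSec.IsSmooth.formOp [FiniteDimensional ℂ R] {ε : ℂ}
    {d : Fin (Module.finrank ℂ E) → FormAlg E} (hinv : IsPullbackInvariant R ε d)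
    {φ : FormSec E X R} (hφ : φ.IsSmooth) : (formOp ε d φ).IsSmooth := fun e he =>
  ((hφ e he).wirtOp _ _ _ e.open_target).congr fun _ hy => inChart_formOp hinv hφ he hy

theorem FormSec.IsSmooth.del [FiniteDimensional ℂ R] {φ : FormSec E X R} (hφ : φ.IsSmooth) :
    (del φ).IsSmooth := by
  rw [del_eq_formOp]
  exact hφ.formOp isPullbackInvariant_dz

theorem FormSec.IsSmooth.delbar [FiniteDimensional ℂ R] {φ : FormSec E X R} (hφ : φ.IsSmooth) :
    (delbar φ).IsSmooth := by
  rw [delbar_eq_formOp]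
  exact hφ.formOp isPullbackInvariant_dzBar

variable (E X R) in
/-- The space `Ω^*(X, ℂ) ⊗ R`. -/
def smoothForms : Submodule ℂ (FormSec E X R) where
  carrier := {φ | φ.IsSmooth}
  zero_mem' e _ l := by
    simp only [FormSec.inChart_zero, map_zero]
    exact contDiffOn_const
  add_mem' {φ ψ} hφ hψ e he := ((hφ e he).add (hψ e he)).congr fun y _ => φ.inChart_add ψ e y
  smul_mem' c φ hφ e he := ((hφ e he).smul c).congr fun y _ => φ.inChart_smul c e y

theorem delbar_add_del_sq [FiniteDimensional ℂ R] {φ : FormSec E X R} (hφ : φ.IsSmooth) :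
    delbar (delbar φ + del φ) + del (delbar φ + del φ) = 0 := by
  have smooth : (delbar φ + del φ).IsSmooth := (smoothForms E X R).add_mem hφ.delbar hφ.del
  refine FormSec.ext_inChart fun e he y hy => ?_
  have inChart_eq : (delbar φ + del φ).inChart e =ᶠ[𝓝 y]
      fun z => delbarLoc (φ.inChart e) z + delLoc (φ.inChart e) z :=
    Filter.eventuallyEq_of_mem (e.open_target.mem_nhds hy) fun z hz => by
      rw [FormSec.inChart_add, inChart_delbar hφ he hz, inChart_del hφ he hz]
  rw [FormSec.inChart_add, inChart_delbar smooth he hy, inChart_del smooth he hy,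
    delbarLoc_congr inChart_eq, delLoc_congr inChart_eq,
    delbarLoc_add_delLoc_sq (hφ e he) e.open_target hy, FormSec.inChart_zero]

end FormsInCharts

/-! ### Conjugation by the exponential of a nilpotent element -/

section ExpConj

theorem exp_mulLeft_apply {A : Type*} [Ring A] [Algebra ℚ A] {a : A} (ha : IsNilpotent a) (x : A) :
    IsNilpotent.exp (LinearMap.mulLeft ℚ a) x = IsNilpotent.exp a * x := by
  obtain ⟨N, hN⟩ := ha
  have mulLeft_pow : LinearMap.mulLeft ℚ a ^ N = 0 := by
    rw [LinearMap.pow_mulLeft, hN, LinearMap.mulLeft_zero_eq_zero]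
  simp only [IsNilpotent.exp_eq_sum hN, IsNilpotent.exp_eq_sum mulLeft_pow, LinearMap.sum_apply,
    LinearMap.smul_apply, LinearMap.pow_mulLeft, LinearMap.mulLeft_apply, Finset.sum_mul,
    smul_mul_assoc]

theorem exp_mulRight_apply {A : Type*} [Ring A] [Algebra ℚ A] {a : A} (ha : IsNilpotent a)
    (x : A) : IsNilpotent.exp (LinearMap.mulRight ℚ a) x = x * IsNilpotent.exp a := by
  obtain ⟨N, hN⟩ := ha
  have mulRight_pow : LinearMap.mulRight ℚ a ^ N = 0 := by
    rw [LinearMap.pow_mulRight, hN, LinearMap.mulRight_zero_eq_zero]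
  simp only [IsNilpotent.exp_eq_sum hN, IsNilpotent.exp_eq_sum mulRight_pow, LinearMap.sum_apply,
    LinearMap.smul_apply, LinearMap.pow_mulRight, LinearMap.mulRight_apply, Finset.mul_sum,
    mul_smul_comm]

-- Right multiplication by `a` is left multiplication by `a` plus the commuting operator `⁅·, a⁆`.
theorem mul_exp_of_commute {A : Type*} [Ring A] [Algebra ℚ A] {a d : A} (ha : IsNilpotent a)
    (h_comm : Commute ⁅⁅d, a⁆, a⁆ a) : d * IsNilpotent.exp a =
      IsNilpotent.exp a * (d + ⁅d, a⁆ + (2⁻¹ : ℚ) • ⁅⁅d, a⁆, a⁆) := by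
  let L : Module.End ℚ A := LinearMap.mulLeft ℚ a
  let δ : Module.End ℚ A := LinearMap.mulRight ℚ a - L
  have δ_apply (x : A) : δ x = ⁅x, a⁆ := rfl
  have h_L : IsNilpotent L := (LinearMap.isNilpotent_mulLeft_iff ℚ a).2 ha
  have h_LR : Commute L (LinearMap.mulRight ℚ a) := LinearMap.commute_mulLeft_right a a
  have h_δ : IsNilpotent δ :=
    h_LR.symm.isNilpotent_sub ((LinearMap.isNilpotent_mulRight_iff ℚ a).2 ha) h_L
  have exp_δ : IsNilpotent.exp δ d = d + ⁅d, a⁆ + (2⁻¹ : ℚ) • ⁅⁅d, a⁆, a⁆ := by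
    have δ_pow : (δ ^ 3) • d = 0 := by
      simp only [pow_succ', pow_zero, mul_one, Module.End.smul_def, Module.End.mul_apply, δ_apply]
      exact h_comm.lie_eq
    rw [← Module.End.smul_def, IsNilpotent.exp_smul_eq_sum δ_pow h_δ]
    simp [Finset.sum_range_succ, pow_two, δ_apply]
  rw [← exp_mulRight_apply ha, ← exp_δ, ← exp_mulLeft_apply ha, ← Module.End.mul_apply,
    ← IsNilpotent.exp_add_of_commute (h_LR.sub_right (Commute.refl L)) h_L h_δ,
    add_sub_cancel]

variable {A : Type*} [Ring A] [Algebra ℂ A] {a d : A} {N : ℕ}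

/-- The truncated exponential `∑_{k < N} a^k / k!` in a complex algebra, which is the exponential
of `a` as soon as `a ^ N = 0`. -/
def truncExp (N : ℕ) (a : A) : A := ∑ k ∈ Finset.range N, ((k.factorial : ℂ)⁻¹) • a ^ k

theorem truncExp_eq_exp [Module ℚ A] (ha : a ^ N = 0) : truncExp N a = IsNilpotent.exp a := by
  rw [IsNilpotent.exp_eq_sum ha, truncExp]
  refine Finset.sum_congr rfl fun k _ => ?_
  rw [← Rat.cast_smul_eq_qsmul ℂ, Rat.cast_inv, Rat.cast_natCast]

theorem truncExp_neg_mul_truncExp (ha : a ^ N = 0) : truncExp N (-a) * truncExp N a = 1 := by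
  let _ : Algebra ℚ A := Algebra.compHom A (algebraMap ℚ ℂ)
  have neg_pow_eq_zero : (-a) ^ N = 0 := by rw [neg_pow, ha, mul_zero]
  rw [truncExp_eq_exp ha, truncExp_eq_exp neg_pow_eq_zero]
  exact IsNilpotent.exp_neg_mul_exp_self ⟨N, ha⟩

theorem mul_truncExp (ha : a ^ N = 0) (h_comm : Commute ⁅⁅d, a⁆, a⁆ a) :
    d * truncExp N a = truncExp N a * (d + ⁅d, a⁆ + (2⁻¹ : ℂ) • ⁅⁅d, a⁆, a⁆) := by
  let _ : Algebra ℚ A := Algebra.compHom A (algebraMap ℚ ℂ)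
  rw [truncExp_eq_exp ha, mul_exp_of_commute ⟨N, ha⟩ h_comm, ← Rat.cast_smul_eq_qsmul ℂ,
    Rat.cast_inv, Rat.cast_ofNat]

end ExpConj

/-! ### Operators on series -/

section SeriesOperators

theorem sum_add_right_eq {S : Type*} [AddCommGroup S] {s : Finset ℤ} {f : ℤ → S} {c : ℤ}
    (hf : ∀ w ∉ s, f w = 0) (hf_add : ∀ w ∉ s, f (w + c) = 0) :
    ∑ w ∈ s, f (w + c) = ∑ w ∈ s, f w := by
  rw [← finsum_eq_sum_of_support_subset (f := fun w => f (w + c)),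
    ← finsum_eq_sum_of_support_subset (f := f)]
  · exact finsum_comp_equiv (Equiv.addRight c) (f := f)
  · exact fun w hw => by_contra fun h => hw (hf w h)
  · exact fun w hw => by_contra fun h => hw (hf_add w h)

variable {S : Type*} [AddCommGroup S] [Module ℂ S]

/-- The operator `T ħ^{-n/2}` on series in powers of `ħ^{1/2}`. -/
def shiftEnd (n : ℤ) : Module.End ℂ S →ₗ[ℂ] Module.End ℂ (ℤ → S) where
  toFun T :=
    { toFun := fun ξ m => T (ξ (m + n))
      map_add' := fun _ _ => funext fun _ => map_add T _ _
      map_smul' := fun c _ => funext fun _ => map_smul T c _ }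
  map_add' _ _ := rfl
  map_smul' _ _ := rfl

theorem shiftEnd_apply (n : ℤ) (T : Module.End ℂ S) (ξ : ℤ → S) (m : ℤ) :
    shiftEnd n T ξ m = T (ξ (m + n)) := rfl

theorem shiftEnd_mul (n k : ℤ) (T U : Module.End ℂ S) :
    shiftEnd n T * shiftEnd k U = shiftEnd (n + k) (T * U) := by
  refine LinearMap.ext fun ξ => funext fun m => ?_
  simp only [Module.End.mul_apply, shiftEnd_apply, add_assoc]

theorem shiftEnd_lie (n k : ℤ) (T U : Module.End ℂ S) :
    ⁅shiftEnd n T, shiftEnd k U⁆ = shiftEnd (n + k) ⁅T, U⁆ := by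
  rw [Ring.lie_def, Ring.lie_def, map_sub, shiftEnd_mul, shiftEnd_mul, add_comm k]

theorem shiftEnd_pow (n : ℤ) (T : Module.End ℂ S) (k : ℕ) :
    shiftEnd n T ^ k = shiftEnd (n * k) (T ^ k) := by
  induction k with
  | zero =>
    refine LinearMap.ext fun ξ => funext fun m => ?_
    simp only [pow_zero, Nat.cast_zero, mul_zero, shiftEnd_apply, add_zero, Module.End.one_apply]
  | succ k ih => rw [pow_succ, ih, shiftEnd_mul, pow_succ, Nat.cast_succ, mul_add, mul_one]

variable {P Q A : Module.End ℂ S} {N : ℕ}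

theorem hbar_mul_truncExp (hA : A ^ N = 0) (h_comm : Commute ⁅Q, A⁆ A)
    (h_lie : ⁅⁅P, A⁆, A⁆ = -((2 : ℂ) • ⁅Q, A⁆)) :
    (shiftEnd 0 Q + shiftEnd (-2) P) * truncExp N (shiftEnd 2 A) =
      truncExp N (shiftEnd 2 A) *
        (shiftEnd 0 Q + shiftEnd (-2) P + shiftEnd 0 ⁅P, A⁆) := by
  have lie_eq : ⁅shiftEnd 0 Q + shiftEnd (-2) P, shiftEnd 2 A⁆ =
      shiftEnd 2 ⁅Q, A⁆ + shiftEnd 0 ⁅P, A⁆ := by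
    rw [Ring.lie_def, add_mul, mul_add, add_sub_add_comm, ← Ring.lie_def, ← Ring.lie_def,
      shiftEnd_lie, shiftEnd_lie, zero_add, neg_add_cancel]
  have lie_lie_eq : ⁅⁅shiftEnd 0 Q + shiftEnd (-2) P, shiftEnd 2 A⁆, shiftEnd 2 A⁆ =
      -((2 : ℂ) • shiftEnd 2 ⁅Q, A⁆) := by
    rw [lie_eq, Ring.lie_def, add_mul, mul_add, add_sub_add_comm, ← Ring.lie_def, ← Ring.lie_def,
      shiftEnd_lie, shiftEnd_lie, h_comm.lie_eq, h_lie, map_zero, zero_add, zero_add, map_neg,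
      map_smul]
  have shift_pow : shiftEnd 2 A ^ N = 0 := by rw [shiftEnd_pow, hA, map_zero]
  have shift_comm : Commute (shiftEnd 2 ⁅Q, A⁆) (shiftEnd 2 A) := by
    rw [commute_iff_lie_eq, shiftEnd_lie, h_comm.lie_eq, map_zero]
  rw [mul_truncExp shift_pow (by rw [lie_lie_eq]; exact (shift_comm.smul_left 2).neg_left),
    lie_lie_eq, lie_eq]
  congr 1
  module

/-- `exp(A / ħ)`, truncated at the power `N` of `A`, on series in powers of `ħ^{1/2}`. -/
def expSeries (N : ℕ) (A : Module.End ℂ S) (ξ : ℤ → S) (m : ℤ) : S :=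
  ∑ k ∈ Finset.range N, ((k.factorial : ℂ)⁻¹) • (A ^ k) (ξ (m + 2 * k))

theorem expSeries_eq_truncExp (N : ℕ) (A : Module.End ℂ S) (ξ : ℤ → S) :
    expSeries N A ξ = truncExp N (shiftEnd 2 A) ξ := by
  funext m
  rw [truncExp, LinearMap.sum_apply, Finset.sum_apply]
  refine Finset.sum_congr rfl fun k _ => ?_
  rw [shiftEnd_pow]
  rfl

theorem expSeries_neg_expSeries (hA : A ^ N = 0) (ξ : ℤ → S) :
    expSeries N (-A) (expSeries N A ξ) = ξ := by
  have shift_pow : shiftEnd 2 A ^ N = 0 := by rw [shiftEnd_pow, hA, map_zero]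
  rw [expSeries_eq_truncExp, expSeries_eq_truncExp, map_neg]
  exact LinearMap.congr_fun (truncExp_neg_mul_truncExp shift_pow) ξ

theorem hbar_expSeries (hA : A ^ N = 0) (h_comm : Commute ⁅Q, A⁆ A)
    (h_lie : ⁅⁅P, A⁆, A⁆ = -((2 : ℂ) • ⁅Q, A⁆)) (ξ : ℤ → S) (m : ℤ) :
    Q (expSeries N A ξ m) + P (expSeries N A ξ (m - 2)) =
      expSeries N A (fun m => Q (ξ m) + ⁅P, A⁆ (ξ m) + P (ξ (m - 2))) m := by
  have intertwine := congrFun (LinearMap.congr_fun (hbar_mul_truncExp hA h_comm h_lie) ξ) m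
  have twisted_eq : (shiftEnd 0 Q + shiftEnd (-2) P + shiftEnd 0 ⁅P, A⁆) ξ =
      fun m => Q (ξ m) + ⁅P, A⁆ (ξ m) + P (ξ (m - 2)) := by
    funext m
    simp only [LinearMap.add_apply, Pi.add_apply, shiftEnd_apply, add_zero, ← sub_eq_add_neg]
    abel
  rw [Module.End.mul_apply, Module.End.mul_apply, twisted_eq, ← expSeries_eq_truncExp,
    ← expSeries_eq_truncExp] at intertwine
  rw [← intertwine]
  simp only [LinearMap.add_apply, Pi.add_apply, shiftEnd_apply, add_zero, ← sub_eq_add_neg]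

theorem apply_sum_weight {P : Module.End ℂ S} {W : ℤ → Module.End ℂ S} {s : Finset ℤ} {c : ℤ}
    (hP : ∀ w, P * W w = W (w + c) * P) (hW : ∀ w ∉ s, W w = 0) (ξ : ℤ → S) (m : ℤ) :
    P (∑ w ∈ s, W w (ξ (m - w))) = ∑ w ∈ s, W w (P (ξ (m + c - w))) := by
  have apply_weight (w : ℤ) :
      P (W w (ξ (m - w))) = W (w + c) (P (ξ (m + c - (w + c)))) := by
    rw [add_sub_add_right_eq_sub]
    exact LinearMap.congr_fun (hP w) _
  rw [map_sum, Finset.sum_congr rfl fun w _ => apply_weight w]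
  refine sum_add_right_eq (f := fun w => W w (P (ξ (m + c - w))))
    (fun w hw => by rw [hW w hw, LinearMap.zero_apply]) fun w hw => ?_
  rw [← apply_weight, hW w hw, LinearMap.zero_apply, map_zero]

theorem hbar_sum_weight {P Q : Module.End ℂ S} {W : ℤ → Module.End ℂ S} {s : Finset ℤ}
    (hQ : ∀ w, Q * W w = W (w + 1) * Q) (hP : ∀ w, P * W w = W (w + -1) * P)
    (hW : ∀ w ∉ s, W w = 0) (ξ : ℤ → S) (m : ℤ) :
    Q (∑ w ∈ s, W w (ξ (m - 1 - w))) + P (∑ w ∈ s, W w (ξ (m - 1 - w))) =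
      ∑ w ∈ s, W w (Q (ξ (m - w)) + P (ξ (m - w - 2))) := by
  rw [apply_sum_weight hQ hW, apply_sum_weight hP hW, ← Finset.sum_add_distrib]
  refine Finset.sum_congr rfl fun w _ => ?_
  rw [map_add, sub_add_cancel, show m - 1 + -1 - w = m - w - 2 by ring]

end SeriesOperators

/-! ### Commutators with the contraction -/

section SmoothOperators

open Topology

universe u

variable {E : Type u} [NormedAddCommGroup E] [NormedSpace ℂ E]
variable {X : Type*} [TopologicalSpace X] [ChartedSpace E X]
variable {R : Type*} [Ring R] [Algebra ℂ R]
variable {𝒜 : ℤ → Submodule ℂ R} [GradedAlgebra 𝒜] {γ : PolySec E X R}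

theorem polyParity_inChart (hpar : ∀ x, polyParity 𝒜 (γ x) = γ x)
    (e : OpenPartialHomeomorph X E) (y : E) :
    polyParity 𝒜 (γ.inChart e y) = γ.inChart e y := by
  rw [PolySec.inChart, polyParity_pull, hpar]

variable [FiniteDimensional ℂ E]

theorem IsMaurerCartan.polyParity (hγ : IsMaurerCartan 𝒜 γ) (x : X) :
    polyParity 𝒜 (γ x) = γ x :=
  polyParity_of_mem_degreeZeroPart (hγ.degree x)

theorem IsMaurerCartan.schoutenLoc_self (hγ : IsMaurerCartan 𝒜 γ)
    {e : OpenPartialHomeomorph X E} (he : e ∈ atlas E X) {y : E} (hy : y ∈ e.target) :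
    schoutenLoc 𝒜 (γ.inChart e) (γ.inChart e) y =
      -((2 : ℂ) • polyDelbarLoc (γ.inChart e) y) := by
  rw [eq_neg_iff_add_eq_zero.2 (hγ.equation e he y hy)]
  module

variable [IsManifold 𝓘(ℂ, E) ω X]

theorem inChart_contractSec (γ : PolySec E X R) (φ : FormSec E X R)
    {e : OpenPartialHomeomorph X E} (he : e ∈ atlas E X) {y : E} (hy : y ∈ e.target) :
    (contractSec 𝒜 γ φ).inChart e y = contractR 𝒜 (γ.inChart e y) (φ.inChart e y) :=
  (contractR_pull 𝒜 (dChartSymm_comp_dChart he hy) _ _).symm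

variable [FiniteDimensional ℂ R]

theorem FormSec.IsSmooth.contractSec (hγ : γ.IsSmooth) {φ : FormSec E X R} (hφ : φ.IsSmooth) :
    (contractSec 𝒜 γ φ).IsSmooth := fun e he =>
  (SmoothOn.bilin (contractR 𝒜) (hγ e he) (hφ e he)).congr fun _ hy =>
    inChart_contractSec γ φ he hy

variable (E X R) in
/-- `∂` on smooth forms. -/
def delEnd : Module.End ℂ (smoothForms E X R) where
  toFun φ := ⟨del φ.1, FormSec.IsSmooth.del φ.2⟩
  map_add' φ ψ := Subtype.ext (del_add φ.2 ψ.2)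
  map_smul' c φ := Subtype.ext (del_smul c φ.2)

variable (E X R) in
/-- `\bar∂` on smooth forms. -/
def delbarEnd : Module.End ℂ (smoothForms E X R) where
  toFun φ := ⟨delbar φ.1, FormSec.IsSmooth.delbar φ.2⟩
  map_add' φ ψ := Subtype.ext (delbar_add φ.2 ψ.2)
  map_smul' c φ := Subtype.ext (delbar_smul c φ.2)

variable (𝒜) in
/-- `i_γ` on smooth forms. -/
def contractEnd (hγ : γ.IsSmooth) : Module.End ℂ (smoothForms E X R) where
  toFun φ := ⟨contractSec 𝒜 γ φ.1, FormSec.IsSmooth.contractSec hγ φ.2⟩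
  map_add' _ _ := Subtype.ext (funext fun x => map_add (contractR 𝒜 (γ x)) _ _)
  map_smul' c _ := Subtype.ext (funext fun x => map_smul (contractR 𝒜 (γ x)) c _)

theorem contractEnd_pow_apply (hγ : γ.IsSmooth) (k : ℕ) (φ : smoothForms E X R) (x : X) :
    ((contractEnd 𝒜 hγ ^ k) φ).1 x = (contractR 𝒜 (γ x) ^ k) (φ.1 x) := by
  induction k with
  | zero => simp only [pow_zero, Module.End.one_apply]
  | succ k ih =>
    rw [pow_succ', pow_succ']
    exact congrArg (contractR 𝒜 (γ x)) ih

variable [IsGradedArtin 𝒜] {e : OpenPartialHomeomorph X E} {y : E}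

theorem inChart_lie_delbarEnd_contractEnd (hγ : γ.IsSmooth)
    (hpar : ∀ x, polyParity 𝒜 (γ x) = γ x) (φ : smoothForms E X R) (he : e ∈ atlas E X)
    (hy : y ∈ e.target) :
    FormSec.inChart e (⁅delbarEnd E X R, contractEnd 𝒜 hγ⁆ φ).1 y =
      contractR 𝒜 (polyDelbarLoc (γ.inChart e) y) (φ.1.inChart e y) := by
  have contract_eq : (contractSec 𝒜 γ φ.1).inChart e =ᶠ[𝓝 y]
      fun z => contractR 𝒜 (γ.inChart e z) (φ.1.inChart e z) :=
    Filter.eventuallyEq_of_mem (e.open_target.mem_nhds hy) fun z hz =>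
      inChart_contractSec γ φ.1 he hz
  change (delbar (contractSec 𝒜 γ φ.1) - contractSec 𝒜 γ (delbar φ.1)).inChart e y = _
  rw [FormSec.inChart_sub, inChart_delbar (φ.2.contractSec hγ) he hy,
    inChart_contractSec γ _ he hy, inChart_delbar φ.2 he hy, delbarLoc_congr contract_eq,
    delbarLoc_contractR ((hγ e he).weakDiffAt e.open_target hy) (φ.2.weakDiffAt he hy)
      (polyParity_inChart hpar e y), add_sub_cancel_left]

theorem inChart_lie_lie_delEnd_contractEnd (hγ : γ.IsSmooth)
    (hpar : ∀ x, polyParity 𝒜 (γ x) = γ x) (φ : smoothForms E X R) (he : e ∈ atlas E X)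
    (hy : y ∈ e.target) :
    FormSec.inChart e (⁅⁅delEnd E X R, contractEnd 𝒜 hγ⁆, contractEnd 𝒜 hγ⁆ φ).1 y =
      contractR 𝒜 (schoutenLoc 𝒜 (γ.inChart e) (γ.inChart e) y) (φ.1.inChart e y) := by
  have hγφ := φ.2.contractSec (𝒜 := 𝒜) hγ
  have contract_eq : (contractSec 𝒜 γ φ.1).inChart e =ᶠ[𝓝 y]
      fun z => contractR 𝒜 (γ.inChart e z) (φ.1.inChart e z) :=
    Filter.eventuallyEq_of_mem (e.open_target.mem_nhds hy) fun z hz =>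
      inChart_contractSec γ φ.1 he hz
  have contract_contract_eq : (contractSec 𝒜 γ (contractSec 𝒜 γ φ.1)).inChart e =ᶠ[𝓝 y]
      fun z => contractR 𝒜 (γ.inChart e z) (contractR 𝒜 (γ.inChart e z) (φ.1.inChart e z)) :=
    Filter.eventuallyEq_of_mem (e.open_target.mem_nhds hy) fun z hz => by
      rw [inChart_contractSec γ _ he hz, inChart_contractSec γ φ.1 he hz]
  change (del (contractSec 𝒜 γ (contractSec 𝒜 γ φ.1)) -
    contractSec 𝒜 γ (del (contractSec 𝒜 γ φ.1)) - contractSec 𝒜 γ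
      (del (contractSec 𝒜 γ φ.1) - contractSec 𝒜 γ (del φ.1))).inChart e y = _
  simp only [FormSec.inChart_sub, inChart_contractSec _ _ he hy, inChart_del φ.2 he hy,
    inChart_del hγφ he hy, inChart_del (hγφ.contractSec hγ) he hy, delLoc_congr contract_eq,
    delLoc_congr contract_contract_eq, map_sub]
  rw [delLoc_contractR_contractR ((hγ e he).weakDiffAt e.open_target hy) (φ.2.weakDiffAt he hy)
    (Filter.Eventually.of_forall fun z => polyParity_inChart hpar e z), two_smul]
  abel

theorem commute_lie_delbarEnd_contractEnd (hγ : γ.IsSmooth)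
    (hpar : ∀ x, polyParity 𝒜 (γ x) = γ x) :
    Commute ⁅delbarEnd E X R, contractEnd 𝒜 hγ⁆ (contractEnd 𝒜 hγ) := by
  refine LinearMap.ext fun φ => Subtype.ext (FormSec.ext_inChart fun e he y hy => ?_)
  refine (inChart_lie_delbarEnd_contractEnd hγ hpar _ he hy).trans ?_
  change contractR 𝒜 _ ((contractSec 𝒜 γ φ.1).inChart e y) = (contractSec 𝒜 γ _).inChart e y
  rw [inChart_contractSec γ _ he hy, inChart_contractSec γ _ he hy,
    inChart_lie_delbarEnd_contractEnd hγ hpar φ he hy]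
  exact (LinearMap.congr_fun (contractR_comm (polyParity_inChart hpar e y) _) _).symm

theorem lie_lie_delEnd_contractEnd (hγ : IsMaurerCartan 𝒜 γ) :
    ⁅⁅delEnd E X R, contractEnd 𝒜 hγ.smooth⁆, contractEnd 𝒜 hγ.smooth⁆ =
      -((2 : ℂ) • ⁅delbarEnd E X R, contractEnd 𝒜 hγ.smooth⁆) := by
  refine LinearMap.ext fun φ => Subtype.ext (FormSec.ext_inChart fun e he y hy => ?_)
  calc
    _ = contractR 𝒜 (schoutenLoc 𝒜 (γ.inChart e) (γ.inChart e) y) (φ.1.inChart e y) :=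
      inChart_lie_lie_delEnd_contractEnd hγ.smooth hγ.polyParity φ he hy
    _ = (-(2 : ℂ)) • contractR 𝒜 (polyDelbarLoc (γ.inChart e) y) (φ.1.inChart e y) := by
      rw [hγ.schoutenLoc_self he hy, ← neg_smul, map_smul, LinearMap.smul_apply]
    _ = (-(2 : ℂ)) • FormSec.inChart e (⁅delbarEnd E X R, contractEnd 𝒜 hγ.smooth⁆ φ).1 y := by
      rw [inChart_lie_delbarEnd_contractEnd hγ.smooth hγ.polyParity φ he hy]
    _ = FormSec.inChart e
        ((-(2 : ℂ)) • (⁅delbarEnd E X R, contractEnd 𝒜 hγ.smooth⁆ φ).1) y :=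
      (FormSec.inChart_smul _ _ e y).symm
    _ = _ := by rw [neg_smul]; rfl

end SmoothOperators

/-! ### Natural maps on forms -/

section NaturalMaps

universe u

variable {V : Type u} [AddCommGroup V] [Module ℂ V] {R R' : Type*} [Ring R] [Algebra ℂ R]
  [Ring R'] [Algebra ℂ R']

theorem fibreNatural_lTensor (f : R →ₐ[ℂ] R') :
    FibreNatural fun (V : Type u) [AddCommGroup V] [Module ℂ V] =>
      f.toLinearMap.lTensor (FormAlg V) := fun V W _ _ _ _ A x => by
  rw [← LinearMap.comp_apply, ← LinearMap.comp_apply, LinearMap.lTensor_comp_rTensor,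
    LinearMap.rTensor_comp_lTensor]

theorem lTensor_wedgeR (f : R →ₐ[ℂ] R') (a : FormAlg V) (x : FormAlg V ⊗[ℂ] R) :
    f.toLinearMap.lTensor (FormAlg V) (wedgeR R a x) =
      wedgeR R' a (f.toLinearMap.lTensor (FormAlg V) x) := by
  rw [← LinearMap.comp_apply, ← LinearMap.comp_apply, LinearMap.lTensor_comp_rTensor,
    LinearMap.rTensor_comp_lTensor]

theorem fibreNatural_rTensor {T : ∀ (V : Type u) [AddCommGroup V] [Module ℂ V],
    FormAlg V →ₗ[ℂ] FormAlg V} (hT : ∀ (V W : Type u) [AddCommGroup V] [Module ℂ V]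
    [AddCommGroup W] [Module ℂ W] (A : V →ₗ[ℂ] W) (x : FormAlg W),
    T V (formPull A x) = formPull A (T W x)) :
    FibreNatural fun (V : Type u) [AddCommGroup V] [Module ℂ V] => (T V).rTensor R :=
  fun V W _ _ _ _ A x => by
    rw [← LinearMap.rTensor_comp_apply, ← LinearMap.rTensor_comp_apply]
    exact congrArg (fun Q : FormAlg W →ₗ[ℂ] FormAlg V => Q.rTensor R x)
      (LinearMap.ext (hT V W A))

theorem rTensor_wedgeR {a : FormAlg V} {S T : FormAlg V →ₗ[ℂ] FormAlg V}
    (h : ∀ x, T (a * x) = a * S x) (x : FormAlg V ⊗[ℂ] R) :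
    T.rTensor R (wedgeR R a x) = wedgeR R a (S.rTensor R x) := by
  rw [wedgeR, ← LinearMap.rTensor_comp_apply, ← LinearMap.rTensor_comp_apply]
  exact congrArg (fun Q : FormAlg V →ₗ[ℂ] FormAlg V => Q.rTensor R x) (LinearMap.ext h)

/-- The projection of forms with coefficients in `R` to weight `w`, that is, to the bidegrees
`(p, q)` with `q - p = w`. -/
abbrev weightR (R : Type*) [Ring R] [Algebra ℂ R] (w : ℤ) (V : Type u) [AddCommGroup V]
    [Module ℂ V] : FormAlg V ⊗[ℂ] R →ₗ[ℂ] FormAlg V ⊗[ℂ] R := (weightPart w).rTensor R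

theorem fibreNatural_weightR (w : ℤ) :
    FibreNatural fun (V : Type u) [AddCommGroup V] [Module ℂ V] => weightR R w V :=
  fibreNatural_rTensor fun _ _ _ _ _ _ A x => weightPart_formPull w A x

theorem involute_weightR (w : ℤ) (x : FormAlg V ⊗[ℂ] R) :
    CliffordAlgebra.involute.toLinearMap.rTensor R (weightR R w V x) =
      ((w.negOnePow : ℤ) : ℂ) • weightR R w V x := by
  rw [← LinearMap.rTensor_comp_apply, ← LinearMap.smul_apply, ← LinearMap.rTensor_smul]
  exact congrArg (fun Q : FormAlg V →ₗ[ℂ] FormAlg V => Q.rTensor R x)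
    (LinearMap.ext (involute_weightPart w))

end NaturalMaps

section NaturalOperators

universe u

variable {E : Type u} [NormedAddCommGroup E] [NormedSpace ℂ E] [FiniteDimensional ℂ E]
variable {X : Type*} [TopologicalSpace X] [ChartedSpace E X]
variable {R R' : Type*} [Ring R] [Algebra ℂ R] [FiniteDimensional ℂ R] [Ring R'] [Algebra ℂ R']
  [FiniteDimensional ℂ R'] {φ : FormSec E X R} {ψ : FormSec E X R'}

theorem lTensor_formOp (f : R →ₐ[ℂ] R') (ε : ℂ) (d : Fin (Module.finrank ℂ E) → FormAlg E)
    (hφ : φ.IsSmooth) (h : ∀ x, f.toLinearMap.lTensor _ (φ x) = ψ x) (x : X) :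
    f.toLinearMap.lTensor _ (formOp ε d φ x) = formOp ε d ψ x := by
  have hψ : ψ = φ.mapFibre fun V [AddCommGroup V] [Module ℂ V] =>
      f.toLinearMap.lTensor (FormAlg V) := funext fun x => (h x).symm
  rw [hψ, formOp_mapFibre (fibreNatural_lTensor f) (fibreNatural_lTensor f)
    (fun j x => lTensor_wedgeR f (d j) x) hφ]
  rfl

theorem involute_formOp (ε : ℂ) (a : Fin (Module.finrank ℂ E) → Module.Dual ℂ E × ConjDual E)
    (hφ : φ.IsSmooth) {c : ℂ}
    (h : ∀ x, CliffordAlgebra.involute.toLinearMap.rTensor R (φ x) = c • φ x) (x : X) :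
    CliffordAlgebra.involute.toLinearMap.rTensor R
      (formOp ε (fun j => ExteriorAlgebra.ι ℂ (a j)) φ x) =
      -c • formOp ε (fun j => ExteriorAlgebra.ι ℂ (a j)) φ x := by
  have involute_natural : FibreNatural fun (V : Type u) [AddCommGroup V] [Module ℂ V] =>
      (CliffordAlgebra.involute.toLinearMap : FormAlg V →ₗ[ℂ] FormAlg V).rTensor R :=
    fibreNatural_rTensor fun _ _ _ _ _ _ A y => involute_formPull A y
  have neg_involute_natural : FibreNatural fun (V : Type u) [AddCommGroup V] [Module ℂ V] =>
      (-CliffordAlgebra.involute.toLinearMap : FormAlg V →ₗ[ℂ] FormAlg V).rTensor R :=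
    fibreNatural_rTensor fun _ _ _ _ _ _ A y => by
      rw [LinearMap.neg_apply, LinearMap.neg_apply, map_neg]
      exact congrArg Neg.neg (involute_formPull A y)
  have involute_wedge (j : Fin (Module.finrank ℂ E)) (y : FormAlg E) :
      (-CliffordAlgebra.involute.toLinearMap : FormAlg E →ₗ[ℂ] FormAlg E)
        (ExteriorAlgebra.ι ℂ (a j) * y) =
      ExteriorAlgebra.ι ℂ (a j) * CliffordAlgebra.involute.toLinearMap y := by
    rw [LinearMap.neg_apply, AlgHom.toLinearMap_apply, map_mul, CliffordAlgebra.involute_ι,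
      neg_mul, neg_neg, AlgHom.toLinearMap_apply]
  have involute_eq : c • φ = φ.mapFibre fun V [AddCommGroup V] [Module ℂ V] =>
      (CliffordAlgebra.involute.toLinearMap : FormAlg V →ₗ[ℂ] FormAlg V).rTensor R :=
    funext fun y => (h y).symm
  have formOp_eq := congrFun (formOp_mapFibre (ε := ε) involute_natural neg_involute_natural
    (fun j => rTensor_wedgeR (involute_wedge j)) hφ) x
  rw [← involute_eq, formOp_smul _ _ _ hφ, FormSec.mapFibre, LinearMap.rTensor_neg] at formOp_eq
  rw [neg_smul]
  exact neg_eq_iff_eq_neg.1 formOp_eq.symm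

theorem lTensor_del (f : R →ₐ[ℂ] R') (hφ : φ.IsSmooth)
    (h : ∀ x, f.toLinearMap.lTensor _ (φ x) = ψ x) (x : X) :
    f.toLinearMap.lTensor _ (del φ x) = del ψ x := by
  rw [del_eq_formOp, del_eq_formOp]
  exact lTensor_formOp f _ _ hφ h x

theorem lTensor_delbar (f : R →ₐ[ℂ] R') (hφ : φ.IsSmooth)
    (h : ∀ x, f.toLinearMap.lTensor _ (φ x) = ψ x) (x : X) :
    f.toLinearMap.lTensor _ (delbar φ x) = delbar ψ x := by
  rw [delbar_eq_formOp, delbar_eq_formOp]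
  exact lTensor_formOp f _ _ hφ h x

theorem involute_del (hφ : φ.IsSmooth) {c : ℂ}
    (h : ∀ x, CliffordAlgebra.involute.toLinearMap.rTensor R (φ x) = c • φ x) (x : X) :
    CliffordAlgebra.involute.toLinearMap.rTensor R (del φ x) = -c • del φ x := by
  rw [del_eq_formOp]
  exact involute_formOp _ (fun j => (coordinate E j, 0)) hφ h x

theorem involute_delbar (hφ : φ.IsSmooth) {c : ℂ}
    (h : ∀ x, CliffordAlgebra.involute.toLinearMap.rTensor R (φ x) = c • φ x) (x : X) :
    CliffordAlgebra.involute.toLinearMap.rTensor R (delbar φ x) = -c • delbar φ x := by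
  rw [delbar_eq_formOp]
  exact involute_formOp _ (fun j => (0, conjCovector (coordinate E j))) hφ h x

end NaturalOperators

/-! ### Series of smooth forms -/

section Series

universe u

variable {E : Type u} [NormedAddCommGroup E] [NormedSpace ℂ E]
variable {X : Type*} [TopologicalSpace X] [ChartedSpace E X]
variable {R : Type*} [Ring R] [Algebra ℂ R] {𝒜 : ℤ → Submodule ℂ R} [GradedAlgebra 𝒜]
  {γ : PolySec E X R} {N : ℕ}

theorem PolySec.IsSmooth.neg (hγ : γ.IsSmooth) : PolySec.IsSmooth (-γ) := fun e he =>
  ((hγ e he).smul (-1)).congr fun y _ => by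
    simp only [PolySec.inChart, Pi.neg_apply, map_neg, neg_smul, one_smul]

theorem expContract_apply {x : X} (hN : contractR 𝒜 (γ x) ^ N = 0) (ξ : Series E X R) (m : ℤ) :
    expContract 𝒜 γ ξ m x =
      ∑ k ∈ Finset.range N, ((k.factorial : ℂ)⁻¹) • (contractR 𝒜 (γ x) ^ k) (ξ (m + 2 * k) x) := by
  have class_le : nilpotencyClass (contractR 𝒜 (γ x)) ≤ N := Nat.sInf_le hN
  refine Finset.sum_subset (Finset.range_subset_range.2 class_le) fun k _ hk => ?_
  rw [pow_eq_zero_of_le (not_lt.1 fun h => hk (Finset.mem_range.2 h))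
    (pow_nilpotencyClass ⟨N, hN⟩), LinearMap.zero_apply, smul_zero]

variable (E X R) in
/-- The value of smooth forms at a point. -/
def evalAt (x : X) : smoothForms E X R →ₗ[ℂ] FormAlg (TangentSpace 𝓘(ℂ, E) x) ⊗[ℂ] R :=
  (LinearMap.proj x).comp (smoothForms E X R).subtype

theorem evalAt_apply (φ : smoothForms E X R) (x : X) : evalAt E X R x φ = φ.1 x := rfl

variable (E X R) in
/-- The projection to weight `w` as an operator on smooth forms. -/
def weightEnd (w : ℤ) : Module.End ℂ (smoothForms E X R) where
  toFun φ := ⟨φ.1.mapFibre (weightR R w), φ.2.mapFibre (fibreNatural_weightR w)⟩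
  map_add' _ _ := Subtype.ext (funext fun _ => map_add _ _ _)
  map_smul' c _ := Subtype.ext (funext fun _ => map_smul _ c _)

theorem rescale_coe (ξ : ℤ → smoothForms E X R) :
    rescale E X R (fun m => (ξ m).1) = fun m =>
      (∑ w ∈ Finset.Icc (-(Module.finrank ℂ E : ℤ)) (Module.finrank ℂ E),
        weightEnd E X R w (ξ (m - w))).1 := by
  funext m x
  rw [← evalAt_apply, map_sum]
  rfl

theorem isSmooth_rescale {ξ : Series E X R} (hξ : ∀ m, (ξ m).IsSmooth) (m : ℤ) :
    (rescale E X R ξ m).IsSmooth := by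
  lift ξ to ℤ → smoothForms E X R using hξ
  rw [rescale_coe]
  exact Subtype.property _

variable [FiniteDimensional ℂ E]

theorem weightEnd_eq_zero {w : ℤ}
    (hw : w ∉ Finset.Icc (-(Module.finrank ℂ E : ℤ)) (Module.finrank ℂ E)) :
    weightEnd E X R w = 0 := by
  refine LinearMap.ext fun φ => Subtype.ext (funext fun x => ?_)
  have weight_eq_zero : weightPart (V := TangentSpace 𝓘(ℂ, E) x) w = 0 :=
    weightPart_eq_zero (V := E) hw
  change (weightPart (V := TangentSpace 𝓘(ℂ, E) x) w).rTensor R (φ.1 x) = 0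
  rw [weight_eq_zero, LinearMap.rTensor_zero, LinearMap.zero_apply]

variable [FiniteDimensional ℂ R] [IsManifold 𝓘(ℂ, E) ω X]

theorem delbarEnd_mul_weightEnd (w : ℤ) :
    delbarEnd E X R * weightEnd E X R w = weightEnd E X R (w + 1) * delbarEnd E X R := by
  refine LinearMap.ext fun φ => Subtype.ext ?_
  change delbar (φ.1.mapFibre (weightR R w)) = (delbar φ.1).mapFibre (weightR R (w + 1))
  rw [delbar_eq_formOp, delbar_eq_formOp]
  refine formOp_mapFibre (fibreNatural_weightR w) (fibreNatural_weightR (w + 1))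
    (fun j x => rTensor_wedgeR (fun y => ?_) x) φ.2
  rw [weightPart_conjForm_mul, add_sub_cancel_right]

theorem delEnd_mul_weightEnd (w : ℤ) :
    delEnd E X R * weightEnd E X R w = weightEnd E X R (w + -1) * delEnd E X R := by
  refine LinearMap.ext fun φ => Subtype.ext ?_
  change del (φ.1.mapFibre (weightR R w)) = (del φ.1).mapFibre (weightR R (w + -1))
  rw [del_eq_formOp, del_eq_formOp]
  refine formOp_mapFibre (fibreNatural_weightR w) (fibreNatural_weightR (w + -1))
    (fun j x => rTensor_wedgeR (fun y => ?_) x) φ.2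
  rw [weightPart_covForm_mul, neg_add_cancel_right]

theorem totalD_rescale {ξ : Series E X R} (hξ : ∀ m, (ξ m).IsSmooth) :
    totalD (rescale E X R ξ) = rescale E X R (hbarD ξ) := by
  lift ξ to ℤ → smoothForms E X R using hξ
  have hbarD_coe : hbarD (fun m => (ξ m).1) =
      fun m => (delbarEnd E X R (ξ m) + delEnd E X R (ξ (m - 2))).1 := rfl
  rw [hbarD_coe, rescale_coe, rescale_coe]
  funext m
  have hbar_sum := hbar_sum_weight delbarEnd_mul_weightEnd delEnd_mul_weightEnd
    (fun _ hw => weightEnd_eq_zero (E := E) (X := X) (R := R) hw) ξ m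
  exact congrArg Subtype.val hbar_sum

theorem expContract_coe (hγ : γ.IsSmooth) (hN : ∀ x, contractR 𝒜 (γ x) ^ N = 0)
    (ξ : ℤ → smoothForms E X R) :
    expContract 𝒜 γ (fun m => (ξ m).1) = fun m => (expSeries N (contractEnd 𝒜 hγ) ξ m).1 := by
  funext m x
  refine (expContract_apply (hN x) _ m).trans (Eq.trans ?_ (map_sum (evalAt E X R x) _ _).symm)
  refine Finset.sum_congr rfl fun k _ => ?_
  rw [map_smul]
  exact congrArg _ (contractEnd_pow_apply hγ k _ x).symm

theorem isSmooth_expContract (hγ : γ.IsSmooth) (hN : ∀ x, contractR 𝒜 (γ x) ^ N = 0)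
    {ξ : Series E X R} (hξ : ∀ m, (ξ m).IsSmooth) (m : ℤ) : (expContract 𝒜 γ ξ m).IsSmooth := by
  lift ξ to ℤ → smoothForms E X R using hξ
  rw [expContract_coe hγ hN]
  exact Subtype.property _

theorem contractEnd_pow_eq_zero (hγ : γ.IsSmooth) (hN : ∀ x, contractR 𝒜 (γ x) ^ N = 0) :
    contractEnd 𝒜 hγ ^ N = 0 :=
  LinearMap.ext fun φ => Subtype.ext <| funext fun x =>
    (contractEnd_pow_apply hγ N φ x).trans (LinearMap.congr_fun (hN x) (φ.1 x))

theorem contractEnd_neg (hγ : γ.IsSmooth) : contractEnd 𝒜 hγ.neg = -contractEnd 𝒜 hγ :=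
  LinearMap.ext fun φ => Subtype.ext <| funext fun x =>
    LinearMap.congr_fun (map_neg (contractR 𝒜) (γ x)) (φ.1 x)

theorem expContract_neg_expContract (hγ : γ.IsSmooth) (hN : ∀ x, contractR 𝒜 (γ x) ^ N = 0)
    {ξ : Series E X R} (hξ : ∀ m, (ξ m).IsSmooth) :
    expContract 𝒜 (-γ) (expContract 𝒜 γ ξ) = ξ := by
  lift ξ to ℤ → smoothForms E X R using hξ
  have neg_pow (x : X) : contractR 𝒜 ((-γ) x) ^ N = 0 := by
    rw [Pi.neg_apply, ← neg_one_smul ℂ, map_smul, smul_pow, hN, smul_zero]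
  rw [expContract_coe hγ hN, expContract_coe hγ.neg neg_pow, contractEnd_neg hγ,
    expSeries_neg_expSeries (contractEnd_pow_eq_zero hγ hN)]

theorem isSmooth_twistedD (hγ : γ.IsSmooth) {ξ : Series E X R} (hξ : ∀ m, (ξ m).IsSmooth) (m : ℤ) :
    (twistedD 𝒜 γ ξ m).IsSmooth :=
  (smoothForms E X R).add_mem ((smoothForms E X R).add_mem (hξ m).delbar
    ((smoothForms E X R).sub_mem ((hξ m).contractSec hγ).del ((hξ m).del.contractSec hγ)))
    (hξ (m - 2)).del

theorem hbarD_expContract [IsGradedArtin 𝒜] (hγ : IsMaurerCartan 𝒜 γ)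
    (hN : ∀ x, contractR 𝒜 (γ x) ^ N = 0) {ξ : Series E X R} (hξ : ∀ m, (ξ m).IsSmooth) :
    hbarD (expContract 𝒜 γ ξ) = expContract 𝒜 γ (twistedD 𝒜 γ ξ) := by
  lift ξ to ℤ → smoothForms E X R using hξ
  have twistedD_coe : twistedD 𝒜 γ (fun m => (ξ m).1) = fun m =>
      (delbarEnd E X R (ξ m) + ⁅delEnd E X R, contractEnd 𝒜 hγ.smooth⁆ (ξ m) +
        delEnd E X R (ξ (m - 2))).1 := rfl
  rw [twistedD_coe, expContract_coe hγ.smooth hN, expContract_coe hγ.smooth hN]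
  funext m
  exact congrArg Subtype.val (hbar_expSeries (contractEnd_pow_eq_zero hγ.smooth hN)
    (commute_lie_delbarEnd_contractEnd hγ.smooth hγ.polyParity) (lie_lie_delEnd_contractEnd hγ)
    ξ m)

end Series

/-! ### Compatible families -/

section ChangeOfCoefficients

universe u

variable {E : Type u} [NormedAddCommGroup E] [NormedSpace ℂ E]
variable {X : Type*} [TopologicalSpace X] [ChartedSpace E X]
variable {R R' : Type*} [Ring R] [Algebra ℂ R] [Ring R'] [Algebra ℂ R']
  {𝒜 : ℤ → Submodule ℂ R} [GradedAlgebra 𝒜] {ℬ : ℤ → Submodule ℂ R'} [GradedAlgebra ℬ]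
  {f : R →ₐ[ℂ] R'}

theorem lTensor_contractR_pow (hf : ∀ d, ∀ r ∈ 𝒜 d, f r ∈ ℬ d) {V : Type*} [AddCommGroup V]
    [Module ℂ V] (g : PolyAlg V ⊗[ℂ] R) (k : ℕ) (x : FormAlg V ⊗[ℂ] R) :
    f.toLinearMap.lTensor _ ((contractR 𝒜 g ^ k) x) =
      (contractR ℬ (f.toLinearMap.lTensor _ g) ^ k) (f.toLinearMap.lTensor _ x) := by
  induction k with
  | zero => simp only [pow_zero, Module.End.one_apply]
  | succ k ih =>
    rw [pow_succ', pow_succ', Module.End.mul_apply, Module.End.mul_apply, ← ih,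
      contractR_map 𝒜 ℬ f hf]

theorem exists_contractSec_pow_eq_zero [IsGradedArtin 𝒜] {γ : PolySec E X R}
    (hγ : ∀ x, γ x ∈ degreeZeroPart 𝒜 (TangentSpace 𝓘(ℂ, E) x)) :
    ∃ N : ℕ, ∀ x, contractR 𝒜 (γ x) ^ N = 0 := by
  obtain ⟨N, hN⟩ := exists_contractR_pow_eq_zero.{_, u} 𝒜
  exact ⟨N, fun x => hN (hγ x)⟩

variable {γ : PolySec E X R} {γ' : PolySec E X R'}

theorem lTensor_rescale {ξ : Series E X R} {η : Series E X R'}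
    (hξ : ∀ m x, f.toLinearMap.lTensor _ (ξ m x) = η m x) (m : ℤ) (x : X) :
    f.toLinearMap.lTensor _ (rescale E X R ξ m x) = rescale E X R' η m x := by
  change f.toLinearMap.lTensor _
      (∑ w ∈ Finset.Icc (-(Module.finrank ℂ E : ℤ)) (Module.finrank ℂ E),
        weightR R w (TangentSpace 𝓘(ℂ, E) x) (ξ (m - w) x)) =
    ∑ w ∈ Finset.Icc (-(Module.finrank ℂ E : ℤ)) (Module.finrank ℂ E),
      weightR R' w (TangentSpace 𝓘(ℂ, E) x) (η (m - w) x)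
  rw [map_sum]
  refine Finset.sum_congr rfl fun w _ => ?_
  rw [← hξ, ← LinearMap.comp_apply, ← LinearMap.comp_apply, LinearMap.lTensor_comp_rTensor,
    LinearMap.rTensor_comp_lTensor]

theorem lTensor_expContract (hf : ∀ d, ∀ r ∈ 𝒜 d, f r ∈ ℬ d)
    (hγ : ∀ x, f.toLinearMap.lTensor _ (γ x) = γ' x) {x : X}
    (h_nil : IsNilpotent (contractR 𝒜 (γ x))) (h_nil' : IsNilpotent (contractR ℬ (γ' x)))
    {ξ : Series E X R} {η : Series E X R'}
    (hξ : ∀ m x, f.toLinearMap.lTensor _ (ξ m x) = η m x) (m : ℤ) :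
    f.toLinearMap.lTensor _ (expContract 𝒜 γ ξ m x) = expContract ℬ γ' η m x := by
  obtain ⟨N, hN⟩ := h_nil
  obtain ⟨N', hN'⟩ := h_nil'
  rw [expContract_apply (pow_eq_zero_of_le (le_max_left N N') hN),
    expContract_apply (pow_eq_zero_of_le (le_max_right N N') hN'), map_sum]
  refine Finset.sum_congr rfl fun k _ => ?_
  rw [map_smul, lTensor_contractR_pow hf, hγ, hξ]

theorem lTensor_contractSec (hf : ∀ d, ∀ r ∈ 𝒜 d, f r ∈ ℬ d)
    (hγ : ∀ x, f.toLinearMap.lTensor _ (γ x) = γ' x) {φ : FormSec E X R} {ψ : FormSec E X R'}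
    (hφ : ∀ x, f.toLinearMap.lTensor _ (φ x) = ψ x) (x : X) :
    f.toLinearMap.lTensor _ (contractSec 𝒜 γ φ x) = contractSec ℬ γ' ψ x := by
  rw [contractSec, contractSec, contractR_map 𝒜 ℬ f hf, hγ, hφ]

theorem lTensor_twistedD [FiniteDimensional ℂ E] [IsManifold 𝓘(ℂ, E) ω X]
    [FiniteDimensional ℂ R] [FiniteDimensional ℂ R']
    (hf : ∀ d, ∀ r ∈ 𝒜 d, f r ∈ ℬ d) (hγ : ∀ x, f.toLinearMap.lTensor _ (γ x) = γ' x)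
    (γ_smooth : γ.IsSmooth) {ξ : Series E X R} {η : Series E X R'} (ξ_smooth : ∀ m, (ξ m).IsSmooth)
    (hξ : ∀ m x, f.toLinearMap.lTensor _ (ξ m x) = η m x) (m : ℤ) (x : X) :
    f.toLinearMap.lTensor _ (twistedD 𝒜 γ ξ m x) = twistedD ℬ γ' η m x := by
  simp only [twistedD, Pi.add_apply, Pi.sub_apply, map_add, map_sub]
  rw [lTensor_delbar f (ξ_smooth m) (hξ m), lTensor_del f (ξ_smooth (m - 2)) (hξ (m - 2)),
    lTensor_del f ((ξ_smooth m).contractSec γ_smooth) (lTensor_contractSec hf hγ (hξ m)),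
    lTensor_contractSec hf hγ (lTensor_del f (ξ_smooth m) (hξ m))]

end ChangeOfCoefficients

section Families

universe u

variable {E : Type u} [NormedAddCommGroup E] [NormedSpace ℂ E]
variable {X : Type*} [TopologicalSpace X] [ChartedSpace E X]

theorem expContract_eq_zero {R : Type*} [Ring R] [Algebra ℂ R] {𝒜 : ℤ → Submodule ℂ R}
    [GradedAlgebra 𝒜] (γ : PolySec E X R) {ξ : Series E X R} {m : ℤ}
    (hξ : ∀ n : ℕ, ξ (m + 2 * n) = 0) : expContract 𝒜 γ ξ m = 0 := by
  funext x
  change ∑ n ∈ Finset.range (nilpotencyClass (contractR 𝒜 (γ x))),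
    ((n.factorial : ℂ)⁻¹) • (contractR 𝒜 (γ x) ^ n) (ξ (m + 2 * n) x) = 0
  refine Finset.sum_eq_zero fun n _ => ?_
  rw [hξ, Pi.zero_apply, map_zero, smul_zero]

theorem involute_rescale {R : Type*} [Ring R] [Algebra ℂ R] {ξ : Series E X R}
    (hξ : ∀ m, Odd m → ξ m = 0) (m : ℤ) (x : X) :
    CliffordAlgebra.involute.toLinearMap.rTensor R (rescale E X R ξ m x) =
      ((m.negOnePow : ℤ) : ℂ) • rescale E X R ξ m x := by
  change CliffordAlgebra.involute.toLinearMap.rTensor R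
      (∑ w ∈ Finset.Icc (-(Module.finrank ℂ E : ℤ)) (Module.finrank ℂ E),
        weightR R w (TangentSpace 𝓘(ℂ, E) x) (ξ (m - w) x)) =
    ((m.negOnePow : ℤ) : ℂ) • ∑ w ∈ Finset.Icc (-(Module.finrank ℂ E : ℤ)) (Module.finrank ℂ E),
      weightR R w (TangentSpace 𝓘(ℂ, E) x) (ξ (m - w) x)
  rw [map_sum, Finset.smul_sum]
  refine Finset.sum_congr rfl fun w _ => ?_
  rcases Int.even_or_odd (m - w) with h_even | h_odd
  · rw [involute_weightR, ← (Int.negOnePow_eq_iff m w).2 h_even]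
  · rw [hξ _ h_odd, Pi.zero_apply, map_zero, map_zero, smul_zero]

variable {ι : Type*} [Preorder ι] {R : ι → Type*} [∀ i, Ring (R i)] [∀ i, Algebra ℂ (R i)]
  {f : ∀ i j, i ≤ j → R j →ₐ[ℂ] R i}

theorem rescale_mem_smoothSeries {ξ : ProSeries E X R} (hξ : ξ ∈ smoothSeries E X f) :
    (fun i => rescale E X (R i) (ξ i)) ∈ smoothSeries E X f :=
  ⟨fun i => isSmooth_rescale (hξ.1 i), fun i j h => lTensor_rescale (hξ.2 i j h)⟩

variable [FiniteDimensional ℂ E] [IsManifold 𝓘(ℂ, E) ω X] [∀ i, FiniteDimensional ℂ (R i)]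

theorem totalD_mem_smoothSeries {ξ : ProSeries E X R} (hξ : ξ ∈ smoothSeries E X f) :
    (fun i => totalD (ξ i)) ∈ smoothSeries E X f := by
  refine ⟨fun i m => (smoothForms E X (R i)).add_mem (hξ.1 i _).delbar (hξ.1 i _).del,
    fun i j h m x => ?_⟩
  simp only [totalD, Pi.add_apply, map_add]
  rw [lTensor_delbar _ (hξ.1 j _) (hξ.2 i j h _), lTensor_del _ (hξ.1 j _) (hξ.2 i j h _)]

theorem totalD_mem_omegaHbar {ξ : ProSeries E X R} (hξ : ξ ∈ omegaHbar E X f) :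
    (fun i => totalD (ξ i)) ∈ omegaHbar E X f := by
  refine ⟨totalD_mem_smoothSeries hξ.1, fun i m x => ?_⟩
  have negOnePow_eq : ((m.negOnePow : ℤ) : ℂ) = -(((m - 1).negOnePow : ℤ) : ℂ) := by
    rw [Int.negOnePow_sub, Int.negOnePow_one, mul_neg, mul_one, Units.val_neg, Int.cast_neg,
      neg_neg]
  simp only [totalD, Pi.add_apply, map_add]
  rw [involute_delbar (hξ.1.1 i (m - 1)) (hξ.2 i (m - 1)),
    involute_del (hξ.1.1 i (m - 1)) (hξ.2 i (m - 1)), negOnePow_eq, smul_add]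

theorem isDifferentialOn_totalD :
    IsDifferentialOn (omegaHbar E X f) fun ξ i => totalD (ξ i) where
  map_mem _ hξ := totalD_mem_omegaHbar hξ
  map_add ξ hξ η hη := by
    funext i m
    simp only [totalD, Pi.add_apply]
    rw [del_add (hξ.1.1 i _) (hη.1.1 i _), delbar_add (hξ.1.1 i _) (hη.1.1 i _),
      add_add_add_comm]
  map_smul c ξ hξ := by
    funext i m
    simp only [totalD, Pi.smul_apply]
    rw [del_smul c (hξ.1.1 i _), delbar_smul c (hξ.1.1 i _), smul_add]
  sq_zero ξ hξ := by
    funext i m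
    exact delbar_add_del_sq (hξ.1.1 i (m - 1 - 1))

variable {𝒜 : ∀ i, ℤ → Submodule ℂ (R i)} [∀ i, GradedAlgebra (𝒜 i)]
  {γ : ∀ i, PolySec E X (R i)}

theorem twistedD_mem_powerSeries
    (f_graded : ∀ i j (hij : i ≤ j) (d : ℤ), ∀ r ∈ 𝒜 j d, f i j hij r ∈ 𝒜 i d)
    (hγ : PolyCompatible f γ) (γ_smooth : ∀ i, (γ i).IsSmooth) {ξ : ProSeries E X R}
    (hξ : ξ ∈ powerSeries E X f) :
    (fun i => twistedD (𝒜 i) (γ i) (ξ i)) ∈ powerSeries E X f := by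
  refine ⟨⟨fun i => isSmooth_twistedD (γ_smooth i) (hξ.1.1 i), fun i j h =>
    lTensor_twistedD (f_graded i j h) (hγ i j h) (γ_smooth j) (hξ.1.1 j) (hξ.1.2 i j h)⟩,
    fun i m hm => ?_⟩
  have sub_two : m - 2 < 0 ∨ Odd (m - 2) :=
    hm.imp (fun h_neg => by lia) fun h_odd => h_odd.sub_even even_two
  have del_zero : del (0 : FormSec E X (R i)) = 0 :=
    congrArg Subtype.val (map_zero (delEnd E X (R i)))
  have delbar_zero : delbar (0 : FormSec E X (R i)) = 0 :=
    congrArg Subtype.val (map_zero (delbarEnd E X (R i)))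
  have contract_zero : contractSec (𝒜 i) (γ i) (0 : FormSec E X (R i)) = 0 :=
    funext fun x => map_zero (contractR (𝒜 i) (γ i x))
  change twistedD (𝒜 i) (γ i) (ξ i) m = 0
  rw [twistedD, hξ.2 i m hm, hξ.2 i (m - 2) sub_two, del_zero, delbar_zero, contract_zero,
    del_zero, sub_zero, add_zero, add_zero]

variable [∀ i, IsGradedArtin (𝒜 i)]

theorem expContract_mem_smoothSeries
    (f_graded : ∀ i j (hij : i ≤ j) (d : ℤ), ∀ r ∈ 𝒜 j d, f i j hij r ∈ 𝒜 i d)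
    (hγ : PolyCompatible f γ) (hmc : ∀ i, IsMaurerCartan (𝒜 i) (γ i)) {ξ : ProSeries E X R}
    (hξ : ξ ∈ smoothSeries E X f) :
    (fun i => expContract (𝒜 i) (γ i) (ξ i)) ∈ smoothSeries E X f := by
  choose N hN using fun i => exists_contractSec_pow_eq_zero (hmc i).degree
  exact ⟨fun i => isSmooth_expContract (hmc i).smooth (hN i) (hξ.1 i), fun i j h m x =>
    lTensor_expContract (f_graded i j h) (hγ i j h) ⟨N j, hN j x⟩ ⟨N i, hN i x⟩ (hξ.2 i j h) m⟩

theorem Ltilde_le_omegaHbar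
    (f_graded : ∀ i j (hij : i ≤ j) (d : ℤ), ∀ r ∈ 𝒜 j d, f i j hij r ∈ 𝒜 i d)
    (hγ : PolyCompatible f γ) (hmc : ∀ i, IsMaurerCartan (𝒜 i) (γ i)) :
    Ltilde 𝒜 f γ ≤ omegaHbar E X f := by
  rintro _ ⟨φ, hφ, rfl⟩
  refine ⟨rescale_mem_smoothSeries (expContract_mem_smoothSeries f_graded hγ hmc hφ.1),
    fun i => involute_rescale fun m hm => expContract_eq_zero _ fun n => ?_⟩
  exact hφ.2 i _ (Or.inr (hm.add_even (even_two_mul _)))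

theorem totalD_mem_Ltilde
    (f_graded : ∀ i j (hij : i ≤ j) (d : ℤ), ∀ r ∈ 𝒜 j d, f i j hij r ∈ 𝒜 i d)
    (hγ : PolyCompatible f γ) (hmc : ∀ i, IsMaurerCartan (𝒜 i) (γ i)) {ξ : ProSeries E X R}
    (hξ : ξ ∈ Ltilde 𝒜 f γ) : (fun i => totalD (ξ i)) ∈ Ltilde 𝒜 f γ := by
  obtain ⟨φ, hφ, rfl⟩ := hξ
  refine ⟨_, twistedD_mem_powerSeries f_graded hγ (fun i => (hmc i).smooth) hφ,
    funext fun i => ?_⟩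
  obtain ⟨N, hN⟩ := exists_contractSec_pow_eq_zero (hmc i).degree
  change rescale E X (R i) (expContract (𝒜 i) (γ i) (twistedD (𝒜 i) (γ i) (φ i))) =
    totalD (rescale E X (R i) (expContract (𝒜 i) (γ i) (φ i)))
  rw [totalD_rescale (isSmooth_expContract (hmc i).smooth hN (hφ.1.1 i)),
    hbarD_expContract (hmc i) hN (hφ.1.1 i)]

end Families

end SemiInfHodge
end

theorem mainTheorem6
    {E : Type*} [NormedAddCommGroup E] [NormedSpace ℂ E] [FiniteDimensional ℂ E]
    {X : Type*} [TopologicalSpace X] [ChartedSpace E X] [IsManifold 𝓘(ℂ, E) ω X]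
    {ι : Type*} [Preorder ι] {R : ι → Type*} [∀ i, Ring (R i)] [∀ i, Algebra ℂ (R i)]
    (𝒜 : ∀ i, ℤ → Submodule ℂ (R i)) [∀ i, GradedAlgebra (𝒜 i)] [∀ i, IsGradedArtin (𝒜 i)]
    (f : ∀ i j, i ≤ j → R j →ₐ[ℂ] R i)
    (f_id : ∀ i r, f i i le_rfl r = r)
    (f_comp : ∀ i j k (hij : i ≤ j) (hjk : j ≤ k) r,
      f i j hij (f j k hjk r) = f i k (hij.trans hjk) r)
    (f_graded : ∀ i j (hij : i ≤ j) (d : ℤ), ∀ r ∈ 𝒜 j d, f i j hij r ∈ 𝒜 i d)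
    (γ : ∀ i, PolySec E X (R i))
    (γ_compatible : PolyCompatible f γ)
    (γ_mc : ∀ i, IsMaurerCartan (𝒜 i) (γ i)) :
    IsDifferentialOn (omegaHbar E X f) (fun ξ i => totalD (ξ i)) ∧
    Ltilde 𝒜 f γ ≤ omegaHbar E X f ∧
    (∀ ξ ∈ Ltilde 𝒜 f γ, (fun i => totalD (ξ i)) ∈ Ltilde 𝒜 f γ) ∧
    (∀ φ ∈ smoothSeries E X f, ∀ i,
      expContract (𝒜 i) (-γ i) (hbarD (expContract (𝒜 i) (γ i) (φ i))) =
        twistedD (𝒜 i) (γ i) (φ i)) := by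
  have R_finite : ∀ i, FiniteDimensional ℂ (R i) := fun i => IsGradedArtin.finite (𝒜 i)
  refine ⟨isDifferentialOn_totalD, Ltilde_le_omegaHbar f_graded γ_compatible γ_mc,
    fun ξ hξ => totalD_mem_Ltilde f_graded γ_compatible γ_mc hξ, fun φ hφ i => ?_⟩
  obtain ⟨N, contract_pow_eq_zero⟩ := exists_contractSec_pow_eq_zero (γ_mc i).degree
  rw [hbarD_expContract (γ_mc i) contract_pow_eq_zero (hφ.1 i)]
  exact expContract_neg_expContract (γ_mc i).smooth contract_pow_eq_zero
    (isSmooth_twistedD (γ_mc i).smooth (hφ.1 i))
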